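/- Let $G$ be a compact connected simple Lie group of type $F_4$, $E_7$ or $E_8$, with Lie algebra $\mathfrak g$, and let $B$ be the negative of the Killing form of $\mathfrak g$. Let $\mathfrak t\subset\mathfrak g$ be a maximal abelian subalgebra, $\alpha_1,\dots,\alpha_\ell$ a basis of simple roots of $(\mathfrak g^{\mathbb C},\mathfrak t^{\mathbb C})$, and $\alpha_{i_0}$ one of the following simple roots, all of which have coefficient $3$ in the maximal root $\tilde\alpha$: the unique simple root of coefficient $3$ for $G$ of type $F_4$ (case $F_4(2)$); for $G$ of type $E_8$, the simple root of coefficient $3$ whose removal splits the Dynkin diagram into components $A_1$ and $E_6$ (case $E_8(2)$); for $G$ of type $E_7$, the simple root of coefficient $3$ whose removal splits the diagram into $A_1$ and $A_5$ (case $E_7(5)$) or into $A_4$ and $A_2$ (case $E_7(3)$). These are the Lie groups of Type $II_b(3)$. Let $\mathfrak g=\mathfrak k_0\oplus\mathfrak k_1\oplus\mathfrak k_2\oplus\mathfrak p_1\oplus\mathfrak p_2\oplus\mathfrak p_3$ be the decomposition defined by $\alpha_{i_0}$: $\mathfrak p_m$ is the real form (the intersection with $\mathfrak g$) of the sum of the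 root spaces of all roots $\sum_j c_j\alpha_j$ with $c_{i_0}=\pm m$; $\mathfrak k=\mathfrak k_0\oplus\mathfrak k_1\oplus\mathfrak k_2$ is the Lie algebra of the isotropy group $K$ of the flag manifold $G/K$, that is, the real form of the sum of $\mathfrak t^{\mathbb C}$ and of the root spaces of all roots with $c_{i_0}=0$; $\mathfrak k_0$ is its one-dimensional centre, and $\mathfrak k_1,\mathfrak k_2$ are its simple ideals, where $\mathfrak k_1$ is the one whose Dynkin diagram is connected with $-\tilde\alpha$ in the extended Dynkin diagram. So $(\mathfrak k_1,\mathfrak k_2)$ is $(\mathfrak{su}_2,\mathfrak{su}_3)$ for $F_4(2)$, $(\mathfrak{su}_2,\mathfrak{su}_6)$ for $E_7(5)$, $(\mathfrak{su}_2,\mathfrak e_6)$ for $E_8(2)$, and $(\mathfrak{su}_5,\mathfrak{su}_3)$ for $E_7(3)$. For positive real numbers $u_0,u_1,u_2,x_1,x_2,x_3$ let $\langle\ ,\ \rangle$ be the ($\mathrm{Ad}(K)$-invariant) left-invariant metric on $G$ given on $\mathfrak g=T_eG$ by $$\langle\ ,\ \rangle=u_0 B|_{\mathfrak k_0}+u_1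 B|_{\mathfrak k_1}+u_2 B|_{\mathfrak k_2}+x_1 B|_{\mathfrak p_1}+x_2 B|_{\mathfrak p_2}+x_3 B|_{\mathfrak p_3}.$$ For a closed subgroup $L$ of $G$ with Lie algebra $\mathfrak l$, the metric is called naturally reductive with respect to $G\times L$, acting on $G$ by $(g,h)y=gyh^{-1}$, if it is invariant under this action and there is an $\mathrm{Ad}(\Delta L)$-invariant complement $\mathfrak M$ of $\Delta\mathfrak l=\{(Y,Y):Y\in\mathfrak l\}$ in $\mathfrak g\oplus\mathfrak l$ such that, for each $U\in\mathfrak M$, the endomorphism $V\mapsto[U,V]_{\mathfrak M}$ of $\mathfrak M$ is skew-symmetric for the inner product induced by $\langle\ ,\ \rangle$ through the isomorphism $\mathfrak M\to\mathfrak g$, $(X,Y)\mapsto X-Y$. Then the metric $\langle\ ,\ \rangle$ is naturally reductive with respect to $G\times L$ for some closed subgroup $L$ of $G$ if and only if at least one of the following conditions holds: 1. $u_0=u_2=x_2$ and $x_1=x_3$, and, in the case $E_7(3)$, moreover $u_1=x_2$; 2. $u_0=u_1=x_3$ and $x_1=x_2$; 3. $x_1=x_2=x_3$. -/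

import Mathlib

open scoped Manifold ContDiff TensorProduct

noncomputable section

/-! ## The complexification of a real Lie algebra -/

section Complexification

variable (g : Type*) [LieRing g] [LieAlgebra ℝ g]

/-- The Killing form of the complexification of a semisimple real Lie algebra is nondegenerate. -/
instance isKilling_complexification [Module.Finite ℝ g] [LieAlgebra.IsKilling ℝ g] :
    LieAlgebra.IsKilling ℂ (ℂ ⊗[ℝ] g) where
  killingCompl_top_eq_bot := by
    classical
    let v := Module.finBasis ℝ g
    have h₀ : (killingForm ℝ g).Nondegenerate := LieAlgebra.IsKilling.killingForm_nondegenerate ℝ g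
    have h₁ := (LinearMap.BilinForm.nondegenerate_iff_det_ne_zero v).mp h₀
    have h₂ : LinearMap.BilinForm.toMatrix (v.baseChange ℂ) (killingForm ℂ (ℂ ⊗[ℝ] g)) =
        (LinearMap.BilinForm.toMatrix v (killingForm ℝ g)).map (algebraMap ℝ ℂ) := by
      ext i j
      have h := LieModule.traceForm_baseChange ℝ g g ℂ
      have h' : killingForm ℂ (ℂ ⊗[ℝ] g) = (killingForm ℝ g).baseChange ℂ := h
      rw [LinearMap.BilinForm.toMatrix_apply, h']
      simp [LinearMap.BilinForm.toMatrix_apply, LinearMap.BilinForm.baseChange_tmul]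
    have h₃ : (killingForm ℂ (ℂ ⊗[ℝ] g)).Nondegenerate := by
      refine (LinearMap.BilinForm.nondegenerate_iff_det_ne_zero (v.baseChange ℂ)).mpr ?_
      rw [h₂, ← RingHom.mapMatrix_apply, ← RingHom.map_det]
      simpa using h₁
    rw [eq_bot_iff]
    intro x hx
    rw [LieIdeal.mem_killingCompl] at hx
    rw [LieSubmodule.mem_bot]
    exact h₃.2 x fun y => hx y (LieSubmodule.mem_top y)

variable {g}

/-- The complexification `𝔱^ℂ = ℂ ⊗ 𝔱` of a real Lie subalgebra `𝔱`, inside `𝔤^ℂ = ℂ ⊗ 𝔤`. -/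
def LieSubalgebra.complexify (t : LieSubalgebra ℝ g) : LieSubalgebra ℂ (ℂ ⊗[ℝ] g) :=
  { t.toSubmodule.baseChange ℂ with
    lie_mem' := by
      intro x y hx hy
      simp only [AddSubsemigroup.mem_carrier, AddSubmonoid.mem_toSubsemigroup,
        Submodule.mem_toAddSubmonoid] at hx hy ⊢
      rw [Submodule.baseChange_eq_span] at hx hy
      induction hx using Submodule.span_induction with
      | zero => simp
      | add a b _ _ ha hb => rw [add_lie]; exact add_mem ha hb
      | smul c a _ ha => rw [smul_lie]; exact Submodule.smul_mem _ _ ha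
      | mem a ha =>
        obtain ⟨a, ha, rfl⟩ := ha
        induction hy using Submodule.span_induction with
        | zero => simp
        | add b c _ _ hb hc => rw [lie_add]; exact add_mem hb hc
        | smul c b _ hb => rw [lie_smul]; exact Submodule.smul_mem _ _ hb
        | mem b hb =>
          obtain ⟨b, hb, rfl⟩ := hb
          simp only [TensorProduct.mk_apply, LieAlgebra.ExtendScalars.bracket_tmul, mul_one]
          exact Submodule.tmul_mem_baseChange_of_mem 1 (t.lie_mem ha hb) }

/-- The real points `V ∩ 𝔤 = {X ∈ 𝔤 | 1 ⊗ X ∈ V}` of a complex subspace `V` of `𝔤^ℂ`. -/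
def realPoints (V : Submodule ℂ (ℂ ⊗[ℝ] g)) : Submodule ℝ g :=
  (V.restrictScalars ℝ).comap (TensorProduct.mk ℝ ℂ g 1)

end Complexification

/-! ## The painted Dynkin diagrams of type `II_b(3)` -/

/-- The four painted Dynkin diagrams of type `II_b(3)`. The Dynkin diagrams are numbered here as in
Bourbaki (the numbering of Mathlib's Cartan matrices), starting from `0`. -/
inductive TypeIIb3
  | F4_2
  | E7_5
  | E8_2
  | E7_3

namespace TypeIIb3

/-- The rank `ℓ` of the group. -/
def rank : TypeIIb3 → ℕ
  | F4_2 => 4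
  | E7_5 => 7
  | E8_2 => 8
  | E7_3 => 7

/-- The Cartan matrix. -/
def cartan : (c : TypeIIb3) → Matrix (Fin c.rank) (Fin c.rank) ℤ
  | F4_2 => CartanMatrix.F₄
  | E7_5 => CartanMatrix.E₇
  | E8_2 => CartanMatrix.E₈
  | E7_3 => CartanMatrix.E₇

/-- The painted (black) node `i₀`, a simple root of height (Dynkin mark) `3`. It is
`α₂` in `F₄`, `α₃` in `E₇` for `E₇(5)`, `α₇` in `E₈`, and `α₅` in `E₇` for `E₇(3)`, in the numbering
of Bourbaki. -/
def node : (c : TypeIIb3) → Fin c.rank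
  | F4_2 => (1 : Fin 4)
  | E7_5 => (2 : Fin 7)
  | E8_2 => (6 : Fin 8)
  | E7_3 => (4 : Fin 7)

/-- The nodes of that one of the two components of the Dynkin diagram without its painted node
which is connected, in the extended Dynkin diagram, with the negative of the maximal root:
of type `A₁`, `A₁`, `A₁`, `A₄`, respectively. -/
def nodes₁ : (c : TypeIIb3) → Finset (Fin c.rank)
  | F4_2 => ({0} : Finset (Fin 4))
  | E7_5 => ({0} : Finset (Fin 7))
  | E8_2 => ({7} : Finset (Fin 8))
  | E7_3 => ({0, 1, 2, 3} : Finset (Fin 7))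

/-- The nodes of the other component: of type `A₂`, `A₅`, `E₆`, `A₂`, respectively. -/
def nodes₂ (c : TypeIIb3) : Finset (Fin c.rank) :=
  (insert c.node c.nodes₁)ᶜ

end TypeIIb3

/-! ## The reductive decomposition defined by a painted Dynkin diagram -/

/-- A root datum on the real Lie algebra `𝔤`: a subalgebra `𝔱 ⊆ 𝔤` whose complexification is a
Cartan subalgebra of `𝔤^ℂ` (for the Lie algebra of a compact group: a maximal abelian subalgebra,
i.e. the Lie algebra of a maximal torus), together with a basis `α₀, …, α_{ℓ-1}` of simple roots of
the root system of `(𝔤^ℂ, 𝔱^ℂ)`, enumerated such that their Cartan matrix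
`2(αᵢ, αⱼ)/(αⱼ, αⱼ)` is the one of the given Dynkin diagram. -/
structure PaintedRootDatum (c : TypeIIb3) (g : Type*) [LieRing g] [LieAlgebra ℝ g]
    [Module.Finite ℝ g] [LieAlgebra.IsKilling ℝ g] where
  /-- the subalgebra `𝔱` -/
  t : LieSubalgebra ℝ g
  /-- `𝔱^ℂ` is a Cartan subalgebra of `𝔤^ℂ` -/
  cartan_t : t.complexify.IsCartanSubalgebra
  /-- a basis of the root system -/
  base : (LieAlgebra.IsKilling.rootSystem t.complexify).Base
  /-- the enumeration of the simple roots -/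
  enum : Fin c.rank ≃ base.support
  /-- the Cartan matrix of the basis -/
  cartanMatrix_eq : ∀ i j, base.cartanMatrix (enum i) (enum j) = c.cartan i j

namespace PaintedRootDatum

attribute [instance] PaintedRootDatum.cartan_t

variable {c : TypeIIb3} {g : Type*} [LieRing g] [LieAlgebra ℝ g]
  [Module.Finite ℝ g] [LieAlgebra.IsKilling ℝ g] (D : PaintedRootDatum c g)

/-- The Cartan subalgebra `𝔱^ℂ` of `𝔤^ℂ`. -/
abbrev tC : LieSubalgebra ℂ (ℂ ⊗[ℝ] g) := D.t.complexify

/-- The simple root `αⱼ`. -/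
def simpleRoot (j : Fin c.rank) : D.tC.root := (D.enum j : D.tC.root)

/-- `α = ∑ⱼ fⱼ αⱼ`. -/
def HasCoeffs (α : D.tC.root) (f : Fin c.rank → ℤ) : Prop :=
  (LieAlgebra.IsKilling.rootSystem D.tC).root α =
    ∑ j, f j • (LieAlgebra.IsKilling.rootSystem D.tC).root (D.simpleRoot j)

/-- The sum of the root spaces `𝔤^α` over the roots `α = ∑ⱼ fⱼ αⱼ` whose coefficients satisfy
`P f`. -/
def rootSpaceSum (P : (Fin c.rank → ℤ) → Prop) : Submodule ℂ (ℂ ⊗[ℝ] g) :=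
  ⨆ (α : D.tC.root) (_ : ∃ f, D.HasCoeffs α f ∧ P f),
    (LieAlgebra.rootSpace D.tC (α : LieModule.Weight ℂ D.tC (ℂ ⊗[ℝ] g))).toSubmodule

/-- `𝔨₀ = {H ∈ 𝔱 | αⱼ(H) = 0 for all j ≠ i₀}`, the centre of `𝔨`. -/
def k₀ : Submodule ℝ g :=
  realPoints <| Submodule.map D.tC.toSubmodule.subtype <|
    ⨅ (j : Fin c.rank) (_ : j ≠ c.node),
      LinearMap.ker ((LieAlgebra.IsKilling.rootSystem D.tC).root (D.simpleRoot j))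

/-- The real form of the semisimple Lie algebra with the simple roots `αⱼ`, `j ∈ S`: the real
points of the sum of the span of the coroots of `αⱼ`, `j ∈ S` (equivalently, of the vectors
dual to the `αⱼ` for the Killing form), and of the root spaces of all the roots
`∑_{j ∈ S} fⱼ αⱼ`. -/
def ideal (S : Finset (Fin c.rank)) : Submodule ℝ g :=
  realPoints <|
    Submodule.map D.tC.toSubmodule.subtype
      (Submodule.span ℂ
        ((fun j => (LieAlgebra.IsKilling.rootSystem D.tC).coroot (D.simpleRoot j)) '' S)) ⊔
    D.rootSpaceSum fun f => ∀ j, j ∉ S → f j = 0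

/-- The simple ideal `𝔨₁` of `𝔨`, whose Dynkin diagram is connected with the negative of the
maximal root. -/
def k₁ : Submodule ℝ g := D.ideal c.nodes₁

/-- The other simple ideal `𝔨₂` of `𝔨`. -/
def k₂ : Submodule ℝ g := D.ideal c.nodes₂

/-- `𝔭ₘ`, the real points of the sum of the root spaces `𝔤^α` over all the roots `α = ∑ⱼ fⱼ αⱼ`
with `f_{i₀} = ± m`. -/
def p (m : ℕ) : Submodule ℝ g :=
  realPoints <| D.rootSpaceSum fun f => |f c.node| = m

/-- The summands of the decomposition `𝔤 = 𝔨₀ ⊕ 𝔨₁ ⊕ 𝔨₂ ⊕ 𝔭₁ ⊕ 𝔭₂ ⊕ 𝔭₃`. -/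
def summand : Fin 6 → Submodule ℝ g :=
  ![D.k₀, D.k₁, D.k₂, D.p 1, D.p 2, D.p 3]

/-- `Q = y₀ B|𝔨₀ + y₁ B|𝔨₁ + y₂ B|𝔨₂ + y₃ B|𝔭₁ + y₄ B|𝔭₂ + y₅ B|𝔭₃`, where `B` is the negative of
the Killing form of `𝔤`: the summands are mutually `Q`-orthogonal, and `Q` is the given multiple of
`B` on each of them. -/
def IsDiagonalForm (Q : LinearMap.BilinForm ℝ g) (y : Fin 6 → ℝ) : Prop :=
  ∀ i j, ∀ X ∈ D.summand i, ∀ Y ∈ D.summand j,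
    Q X Y = if i = j then y i * -(killingForm ℝ g X Y) else 0

end PaintedRootDatum

/-! ## Naturally reductive left-invariant metrics on a Lie group -/

section NaturallyReductive

variable {n : ℕ} (G : Type*) [TopologicalSpace G] [ChartedSpace (EuclideanSpace ℝ (Fin n)) G]
  [Group G]

instance lieGroup_minSmoothness [LieGroup (𝓡 n) ∞ G] : LieGroup (𝓡 n) (minSmoothness ℝ 3) G :=
  LieGroup.of_le (n := ∞) (by
    rw [minSmoothness_of_isRCLikeNormedField]
    exact ENat.LEInfty.out)

instance finite_groupLieAlgebra : Module.Finite ℝ (GroupLieAlgebra (𝓡 n) G) :=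
  inferInstanceAs (Module.Finite ℝ (EuclideanSpace ℝ (Fin n)))

variable {G}

/-- The adjoint representation: `Ad h` is the differential at `1` of `x ↦ h x h⁻¹`. -/
def Ad (h : G) : GroupLieAlgebra (𝓡 n) G →L[ℝ] GroupLieAlgebra (𝓡 n) G :=
  mfderiv (𝓡 n) (𝓡 n) (fun x : G => h * x * h⁻¹) 1

/-- The underlying set `{X ∈ 𝔤 | exp (s X) ∈ L for all s ∈ ℝ}` of the Lie algebra of a closed
subgroup `L`, where `s ↦ exp (s X)` is the integral curve through `1` of the left-invariant vector
field defined by `X`. -/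
def lieAlgebraCarrier (L : Subgroup G) : Set (GroupLieAlgebra (𝓡 n) G) :=
  {X | ∃ γ : ℝ → G, IsMIntegralCurve (I := 𝓡 n) γ (mulInvariantVectorField X) ∧ γ 0 = 1 ∧
    ∀ s, γ s ∈ L}

variable [LieGroup (𝓡 n) ∞ G]

/-- The left-invariant metric on `G` with value `Q` on `𝔤 = T₁G` is naturally reductive with respect
to the action `(g, h) y = g y h⁻¹` of `G × L`, for a closed subgroup `L` of `G` with Lie algebra
`𝔩`. The isotropy group of `1` is `ΔL = {(h, h) | h ∈ L}`, with Lie algebra `Δ𝔩`; the differential at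
`1` of the orbit map is `𝔤 ⊕ 𝔩 → 𝔤`, `(X, Y) ↦ X - Y`, with kernel `Δ𝔩`. The metric has to be
invariant under the action, and there has to be a reductive decomposition `𝔤 ⊕ 𝔩 = Δ𝔩 ⊕ 𝔐`,
`Ad(ΔL) 𝔐 ⊆ 𝔐`, such that the `𝔐`-component of `[U, ·] : 𝔐 → 𝔐` is, for all `U ∈ 𝔐`, skew-symmetric
with respect to the inner product that `𝔐` carries through `𝔐 ≅ 𝔤`, `(X, Y) ↦ X - Y`. As this map is
zero on `Δ𝔩`, it takes the same value on an element of `𝔤 ⊕ 𝔩` and on its `𝔐`-component. -/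
def IsNaturallyReductive (Q : LinearMap.BilinForm ℝ (GroupLieAlgebra (𝓡 n) G))
    (L : Subgroup G) : Prop :=
  ∃ l : LieSubalgebra ℝ (GroupLieAlgebra (𝓡 n) G),
    (l : Set (GroupLieAlgebra (𝓡 n) G)) = lieAlgebraCarrier L ∧
    (∀ h ∈ L, ∀ X Y, Q (Ad h X) (Ad h Y) = Q X Y) ∧
    ∃ M : Submodule ℝ (GroupLieAlgebra (𝓡 n) G × GroupLieAlgebra (𝓡 n) G),
      Submodule.map (LinearMap.prod LinearMap.id LinearMap.id) l.toSubmodule ⊓ M = ⊥ ∧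
      Submodule.map (LinearMap.prod LinearMap.id LinearMap.id) l.toSubmodule ⊔ M =
        Submodule.prod ⊤ l.toSubmodule ∧
      (∀ h ∈ L, ∀ U ∈ M, (Ad h U.1, Ad h U.2) ∈ M) ∧
      ∀ U ∈ M, ∀ V ∈ M, ∀ W ∈ M,
        Q (⁅U, V⁆.1 - ⁅U, V⁆.2) (W.1 - W.2) + Q (V.1 - V.2) (⁅U, W⁆.1 - ⁅U, W⁆.2) = 0

end NaturallyReductive

end

/-!
The metric is `B(φ ·, ·)` for the endomorphism `φ` of `𝔤` that is multiplication by the parameters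
`u₀, u₁, u₂, x₁, x₂, x₃ = y₀, …, y₅` on the six summands. Let `κ = -B` be the Killing form.

A complement `𝔐` of `Δ𝔩` is the graph `{(σ V, σ V - V)}` of an endomorphism `σ` of `𝔤` with
`σ V - V ∈ 𝔩`. As `Ad L` preserves the metric, `ad (σ V - V)` is skew-symmetric for it, and then
natural reductivity of the decomposition means that `V ↦ [U, σ V]` is skew-symmetric for all `U`
(`IsNaturallyReductive.exists_endomorphism`). In terms of `φ`, the second condition reads
`[σ V, φ W] + [σ W, φ V] = 0`: the endomorphism `τ = σ φ⁻¹` makes `[τ V, W]` alternating. On the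
complexification, root vectors show that such a `τ` is a homothety, because the Dynkin diagram is
connected (`PaintedRootDatum.exists_eq_smul_killingForm`). Hence `σ = r φ`, and what is left is that
`φ` commutes with `ad ((r φ - 1) V)`. For `V`, `W`, `U` in the summands `i`, `j`, `k` this is
`(r yᵢ - 1) (yⱼ - yₖ) κ([V, W], U) = 0`, so `r yᵢ = 1` or `yⱼ = yₖ` whenever the trilinear form
`κ([V, W], U)` is not zero on the three summands (`PaintedRootDatum.exists_forall_linked`).

Conversely, if these equations hold for some `r ≠ 0`, then the closed subgroup `L` of all elements
whose adjoint action commutes with `σ = r φ` and preserves `κ` has the Lie algebra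
`{X | [ad X, σ] = 0}`, which contains the image of `σ - 1`, and the graph of `σ` is the required
complement (`exists_isNaturallyReductive`). The choice `r = x₁⁻¹` covers each of the three
conditions.

So the theorem is reduced to the list of the triples of summands on which `κ([V, W], U)` vanishes.
It vanishes if the coefficients at the painted node cannot add up to zero, or if two of the summands
commute: distinct summands of `𝔨`, `𝔨₂` and `𝔭₃`, and, except for `E₇(3)`, `𝔨₁` and `𝔭₂`. The last
two facts hold since a root is bounded in the invariant quadratic form of the root lattice, which,
written as a sum of squares, forces roots of level `3` or `2` to be orthogonal to the component
in question (`TypeIIb3.pairing_nodes₂_eq_zero`, `TypeIIb3.pairing_nodes₁_eq_zero`). For the triples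
`(𝔭₁, 𝔭₁, 𝔭₂)`, `(𝔭₁, 𝔭₂, 𝔭₃)`, `(𝔨₀, 𝔭₂, 𝔭₂)`, `(𝔨₂, 𝔭₂, 𝔭₂)`, `(𝔨₀, 𝔭₃, 𝔭₃)`, `(𝔨₁, 𝔭₃, 𝔭₃)`
and, for `E₇(3)`, `(𝔨₁, 𝔭₂, 𝔭₂)` it does not vanish, as explicit roots show
(`PaintedRootDatum.linked_level_one_two`, `PaintedRootDatum.linked_level_two_three`).

The summands are real points of complex subspaces, and compactness of `G` enters in the descent: the
eigenvalues of `ad X` are imaginary (`re_eigenvalue_eq_zero`), so the complex conjugation maps the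
root space of `α` to the one of `-α`, and the complex subspaces are spanned by their real points.
-/

noncomputable section

/-! ### The adjoint representation -/

section AdjointRepresentation

open Filter Topology Set VectorField

variable {n : ℕ} {G : Type*} [TopologicalSpace G] [ChartedSpace (EuclideanSpace ℝ (Fin n)) G]
  [Group G]

/-- Multiplication of the Lie group `G`, read in the preferred chart at `1`. -/
def chartMul (n : ℕ) (G : Type*) [TopologicalSpace G] [ChartedSpace (EuclideanSpace ℝ (Fin n)) G]
    [Group G] (z : EuclideanSpace ℝ (Fin n) × EuclideanSpace ℝ (Fin n)) :
    EuclideanSpace ℝ (Fin n) :=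
  extChartAt (𝓡 n) (1 : G)
    ((extChartAt (𝓡 n) (1 : G)).symm z.1 * (extChartAt (𝓡 n) (1 : G)).symm z.2)

/-- The differential of a map of `G` at a point, as an endomorphism of the model space (every
tangent space of `G` is, by definition, the model space). -/
def modelDeriv (f : G → G) (x : G) : EuclideanSpace ℝ (Fin n) →L[ℝ] EuclideanSpace ℝ (Fin n) :=
  mfderiv (𝓡 n) (𝓡 n) f x

lemma modelDeriv_comp {f g : G → G} {x y : G} (hg : MDifferentiable (𝓡 n) (𝓡 n) g)
    (hf : MDifferentiable (𝓡 n) (𝓡 n) f) (hy : f x = y) :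
    modelDeriv (n := n) (g ∘ f) x = (modelDeriv g y).comp (modelDeriv f x) := by
  subst hy
  exact mfderiv_comp (I := 𝓡 n) (I' := 𝓡 n) (I'' := 𝓡 n) x (hg (f x)) (hf x)

/-- The adjoint representation on the model space. -/
def modelAd (h : G) : EuclideanSpace ℝ (Fin n) →L[ℝ] EuclideanSpace ℝ (Fin n) := Ad (n := n) h

lemma modelAd_eq (h : G) : modelAd (n := n) h = modelDeriv (fun x : G => h * x * h⁻¹) 1 := rfl

lemma modelAd_one : modelAd (n := n) (1 : G) = ContinuousLinearMap.id ℝ _ := by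
  have : (fun x : G => 1 * x * 1⁻¹) = id := by ext x; simp
  rw [modelAd_eq, this]
  exact mfderiv_id

lemma modelAd_eventuallyEq :
    (modelAd (n := n) : G → _) =ᶠ[𝓝 1]
      fun g => modelAd ((extChartAt (𝓡 n) (1 : G)).symm (extChartAt (𝓡 n) (1 : G) g)) := by
  filter_upwards [extChartAt_source_mem_nhds (I := 𝓡 n) (1 : G)] with g hg
  rw [(extChartAt (𝓡 n) (1 : G)).left_inv hg]

variable [LieGroup (𝓡 n) ∞ G]

lemma mdifferentiable_leftMul (h : G) : MDifferentiable (𝓡 n) (𝓡 n) (fun x : G => h * x) :=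
  (contMDiff_mul_left (I := 𝓡 n) (n := ∞)).mdifferentiable (by simp)

lemma mdifferentiable_rightMul (h : G) : MDifferentiable (𝓡 n) (𝓡 n) (fun x : G => x * h) :=
  (contMDiff_mul_right (I := 𝓡 n) (n := ∞)).mdifferentiable (by simp)

lemma mdifferentiable_conj (h : G) : MDifferentiable (𝓡 n) (𝓡 n) (fun x : G => h * x * h⁻¹) :=
  (mdifferentiable_rightMul (n := n) h⁻¹).comp (mdifferentiable_leftMul (n := n) h)

lemma modelAd_mul (h k : G) : modelAd (n := n) (h * k) = (modelAd h).comp (modelAd k) := by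
  have e : (fun x : G => h * k * x * (h * k)⁻¹) =
      (fun x : G => h * x * h⁻¹) ∘ (fun x : G => k * x * k⁻¹) := by
    ext x; simp [mul_assoc]
  rw [modelAd_eq, e, modelDeriv_comp (mdifferentiable_conj h) (mdifferentiable_conj k)
    (y := 1) (by simp)]
  rfl

/-- Left translation by `h` is right translation by `h` after conjugation by `h`. -/
lemma modelDeriv_mul_left_eq (h : G) :
    modelDeriv (n := n) (fun x : G => h * x) 1 =
      (modelDeriv (fun x : G => x * h) 1).comp (modelAd h) := by
  have e : (fun x : G => h * x) = (fun x : G => x * h) ∘ (fun x : G => h * x * h⁻¹) := by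
    ext x; simp
  rw [modelAd_eq, ← modelDeriv_comp (mdifferentiable_rightMul h) (mdifferentiable_conj h)
    (by simp), ← e]

lemma contDiffAt_chartMul :
    ContDiffAt ℝ ∞ (chartMul n G) (extChartAt (𝓡 n) (1 : G) 1, extChartAt (𝓡 n) (1 : G) 1) := by
  rw [← contMDiffAt_iff_contDiffAt]
  have hs : ContMDiffAt 𝓘(ℝ, EuclideanSpace ℝ (Fin n)) (𝓡 n) ∞ (extChartAt (𝓡 n) (1 : G)).symm
      (extChartAt (𝓡 n) (1 : G) 1) :=
    (contMDiffOn_extChartAt_symm (1 : G)).contMDiffAt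
      ((isOpen_extChartAt_target (1 : G)).mem_nhds (mem_extChartAt_target (1 : G)))
  have h1 : ContMDiffAt 𝓘(ℝ, EuclideanSpace ℝ (Fin n) × EuclideanSpace ℝ (Fin n)) (𝓡 n) ∞
      (fun z => (extChartAt (𝓡 n) (1 : G)).symm z.1)
      (extChartAt (𝓡 n) (1 : G) 1, extChartAt (𝓡 n) (1 : G) 1) :=
    ContMDiffAt.comp (g := (extChartAt (𝓡 n) (1 : G)).symm) (f := Prod.fst)
      (extChartAt (𝓡 n) (1 : G) 1, extChartAt (𝓡 n) (1 : G) 1) hs contDiff_fst.contMDiff.contMDiffAt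
  have h2 : ContMDiffAt 𝓘(ℝ, EuclideanSpace ℝ (Fin n) × EuclideanSpace ℝ (Fin n)) (𝓡 n) ∞
      (fun z => (extChartAt (𝓡 n) (1 : G)).symm z.2)
      (extChartAt (𝓡 n) (1 : G) 1, extChartAt (𝓡 n) (1 : G) 1) :=
    ContMDiffAt.comp (g := (extChartAt (𝓡 n) (1 : G)).symm) (f := Prod.snd)
      (extChartAt (𝓡 n) (1 : G) 1, extChartAt (𝓡 n) (1 : G) 1) hs contDiff_snd.contMDiff.contMDiffAt
  have h3 := h1.mul h2
  have h4 : ContMDiffAt (𝓡 n) 𝓘(ℝ, EuclideanSpace ℝ (Fin n)) ∞ (extChartAt (𝓡 n) (1 : G))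
     ((extChartAt (𝓡 n) (1 : G)).symm (extChartAt (𝓡 n) (1 : G) 1) *
      (extChartAt (𝓡 n) (1 : G)).symm (extChartAt (𝓡 n) (1 : G) 1)) := by
    have e : (extChartAt (𝓡 n) (1 : G)).symm (extChartAt (𝓡 n) (1 : G) 1) *
      (extChartAt (𝓡 n) (1 : G)).symm (extChartAt (𝓡 n) (1 : G) 1) = 1 := by simp
    rw [e]
    exact contMDiffAt_extChartAt
  exact ContMDiffAt.comp _ h4 h3

/-- The differential at `x` of the preferred chart at `1`. -/
def chartDeriv (n : ℕ) {G : Type*} [TopologicalSpace G]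
    [ChartedSpace (EuclideanSpace ℝ (Fin n)) G] [Group G] (x : G) :
    EuclideanSpace ℝ (Fin n) →L[ℝ] EuclideanSpace ℝ (Fin n) :=
  mfderiv (𝓡 n) 𝓘(ℝ, EuclideanSpace ℝ (Fin n)) (extChartAt (𝓡 n) (1 : G)) x

lemma isManifold_one_of_lieGroup (n : ℕ) (G : Type*) [TopologicalSpace G]
    [ChartedSpace (EuclideanSpace ℝ (Fin n)) G] [Group G] [LieGroup (𝓡 n) ∞ G] :
    IsManifold (𝓡 n) 1 G :=
  haveI : IsManifold (𝓡 n) ∞ G := inferInstance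
  IsManifold.of_le (n := ∞) (by simp)

lemma chartDeriv_one : chartDeriv n (1 : G) = ContinuousLinearMap.id ℝ _ := by
  have := isManifold_one_of_lieGroup n G
  have h := mfderiv_chartAt_eq_tangentCoordChange (I := 𝓡 n) (x := (1 : G)) (y := 1)
    (by simp)
  ext1 v
  have h2 := tangentCoordChange_self (I := 𝓡 n) (x := (1 : G)) (z := 1) (v := v)
    (mem_extChartAt_source 1)
  exact (DFunLike.congr_fun h v).trans h2

lemma chartDeriv_comp_modelDeriv {f : G → G} (hf : MDifferentiable (𝓡 n) (𝓡 n) f)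
    (hx : f 1 ∈ (extChartAt (𝓡 n) (1 : G)).source)
    {F : EuclideanSpace ℝ (Fin n) → EuclideanSpace ℝ (Fin n)}
    (hF : DifferentiableAt ℝ F (extChartAt (𝓡 n) (1 : G) 1))
    (hFf : ∀ x ∈ (extChartAt (𝓡 n) (1 : G)).source, F (extChartAt (𝓡 n) (1 : G) x) =
      extChartAt (𝓡 n) (1 : G) (f x)) :
    (fderiv ℝ F (extChartAt (𝓡 n) (1 : G) 1)).comp (chartDeriv n (1 : G)) =
      (chartDeriv n (f 1)).comp (modelDeriv f 1) := by
  have := isManifold_one_of_lieGroup n G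
  have hφ : ∀ y ∈ (extChartAt (𝓡 n) (1 : G)).source,
      MDifferentiableAt (𝓡 n) 𝓘(ℝ, EuclideanSpace ℝ (Fin n)) (extChartAt (𝓡 n) (1 : G)) y :=
    fun y hy => mdifferentiableAt_extChartAt (by simpa using hy)
  have h1 := mfderiv_comp (I := 𝓡 n) (I' := 𝓡 n) (I'' := 𝓘(ℝ, EuclideanSpace ℝ (Fin n))) (1 : G)
    (hφ _ hx) (hf 1)
  have h2 := mfderiv_comp (I := 𝓡 n) (I' := 𝓘(ℝ, EuclideanSpace ℝ (Fin n)))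
    (I'' := 𝓘(ℝ, EuclideanSpace ℝ (Fin n))) (1 : G)
    (g := F) (f := extChartAt (𝓡 n) (1 : G)) hF.mdifferentiableAt
    (hφ 1 (mem_extChartAt_source 1))
  have h3 : (F ∘ extChartAt (𝓡 n) (1 : G)) =ᶠ[𝓝 1] (extChartAt (𝓡 n) (1 : G)) ∘ f := by
    filter_upwards [extChartAt_source_mem_nhds (I := 𝓡 n) (1 : G)] with x hx using hFf x hx
  rw [h3.mfderiv_eq, h1, mfderiv_eq_fderiv] at h2
  exact h2.symm

lemma extChartAt_symm_pullback (v : GroupLieAlgebra (𝓡 n) G)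
    {a : EuclideanSpace ℝ (Fin n)} (ha : a ∈ (extChartAt (𝓡 n) (1 : G)).target) :
    mpullbackWithin 𝓘(ℝ, EuclideanSpace ℝ (Fin n)) (𝓡 n) (extChartAt (𝓡 n) (1 : G)).symm
      (mulInvariantVectorField v) (range (𝓡 n)) a =
    chartDeriv n ((extChartAt (𝓡 n) (1 : G)).symm a)
      (modelDeriv (fun x : G => (extChartAt (𝓡 n) (1 : G)).symm a * x) 1 v) := by
  have := isManifold_one_of_lieGroup n G
  have h1 := mfderiv_extChartAt_comp_mfderivWithin_extChartAt_symm (I := 𝓡 n) (x := (1 : G)) ha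
  have h2 := mfderivWithin_extChartAt_symm_comp_mfderiv_extChartAt (I := 𝓡 n) (x := (1 : G)) ha
  have h3 := ContinuousLinearMap.inverse_eq h2 h1
  unfold mpullbackWithin
  rw [h3]
  rfl

/-- The differential of multiplication at `(a, 1)`, read in the chart at `1`, in the direction of
the second factor. -/
def chartMulRight (n : ℕ) (G : Type*) [TopologicalSpace G]
    [ChartedSpace (EuclideanSpace ℝ (Fin n)) G] [Group G] (a : EuclideanSpace ℝ (Fin n)) :
    EuclideanSpace ℝ (Fin n) →L[ℝ] EuclideanSpace ℝ (Fin n) :=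
  (fderiv ℝ (chartMul n G) (a, extChartAt (𝓡 n) (1 : G) 1)).comp
    (ContinuousLinearMap.inr ℝ (EuclideanSpace ℝ (Fin n)) (EuclideanSpace ℝ (Fin n)))

/-- The differential of multiplication at `(1, a)`, read in the chart at `1`, in the direction of
the first factor. -/
def chartMulLeft (n : ℕ) (G : Type*) [TopologicalSpace G]
    [ChartedSpace (EuclideanSpace ℝ (Fin n)) G] [Group G] (a : EuclideanSpace ℝ (Fin n)) :
    EuclideanSpace ℝ (Fin n) →L[ℝ] EuclideanSpace ℝ (Fin n) :=
  (fderiv ℝ (chartMul n G) (extChartAt (𝓡 n) (1 : G) 1, a)).comp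
    (ContinuousLinearMap.inl ℝ (EuclideanSpace ℝ (Fin n)) (EuclideanSpace ℝ (Fin n)))

variable (n G) in
lemma eventually_differentiableAt_chartMul :
    ∀ᶠ z in 𝓝 (extChartAt (𝓡 n) (1 : G) 1, extChartAt (𝓡 n) (1 : G) 1),
      DifferentiableAt ℝ (chartMul n G) z := by
  have h := (contDiffAt_chartMul (n := n) (G := G)).of_le (m := 1) (by simp)
  filter_upwards [h.eventually (by simp)] with z hz using hz.differentiableAt (by simp)

variable (n G) in
lemma differentiableAt_fderiv_chartMul :
    DifferentiableAt ℝ (fderiv ℝ (chartMul n G))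
      (extChartAt (𝓡 n) (1 : G) 1, extChartAt (𝓡 n) (1 : G) 1) := by
  have h := (contDiffAt_chartMul (n := n) (G := G)).fderiv_right (m := 1) (by norm_cast)
  exact h.differentiableAt (by simp)

variable (n G) in
/-- The mixed second derivative of multiplication at `(1, 1)`, read in the chart at `1`. -/
lemma hasFDerivAt_chartMulRight (w : EuclideanSpace ℝ (Fin n)) :
  HasFDerivAt (fun a => chartMulRight n G a w)
    (((fderiv ℝ (fderiv ℝ (chartMul n G))
      (extChartAt (𝓡 n) (1 : G) 1, extChartAt (𝓡 n) (1 : G) 1)).comp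
      (ContinuousLinearMap.inl ℝ _ _)).flip (0, w)) (extChartAt (𝓡 n) (1 : G) 1) := by
  have h := (differentiableAt_fderiv_chartMul n G).hasFDerivAt
  have h1 : HasFDerivAt (fun a : EuclideanSpace ℝ (Fin n) => (a, extChartAt (𝓡 n) (1 : G) 1))
    (ContinuousLinearMap.inl ℝ _ _) (extChartAt (𝓡 n) (1 : G) 1) :=
    hasFDerivAt_prodMk_left _ _
  have h2 := HasFDerivAt.comp (f := fun a => (a, extChartAt (𝓡 n) (1 : G) 1))
    (extChartAt (𝓡 n) (1 : G) 1) h h1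
  have h3 := h2.clm_apply (hasFDerivAt_const (0, w) _)
  convert! h3 using 1
  ext v
  simp

variable (n G) in
lemma hasFDerivAt_chartMulLeft (w : EuclideanSpace ℝ (Fin n)) :
  HasFDerivAt (fun a => chartMulLeft n G a w)
    (((fderiv ℝ (fderiv ℝ (chartMul n G))
      (extChartAt (𝓡 n) (1 : G) 1, extChartAt (𝓡 n) (1 : G) 1)).comp
      (ContinuousLinearMap.inr ℝ _ _)).flip (w, 0)) (extChartAt (𝓡 n) (1 : G) 1) := by
  have h := (differentiableAt_fderiv_chartMul n G).hasFDerivAt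
  have h1 : HasFDerivAt (fun a : EuclideanSpace ℝ (Fin n) => (extChartAt (𝓡 n) (1 : G) 1, a))
    (ContinuousLinearMap.inr ℝ _ _) (extChartAt (𝓡 n) (1 : G) 1) :=
    hasFDerivAt_prodMk_right _ _
  have h2 := HasFDerivAt.comp (extChartAt (𝓡 n) (1 : G) 1) h h1
  have h3 := h2.clm_apply (hasFDerivAt_const (w, 0) _)
  convert! h3 using 1
  ext v
  simp

variable (n G) in
lemma eventually_chartMulRight :
    ∀ᶠ a in 𝓝 (extChartAt (𝓡 n) (1 : G) 1), chartMulRight n G a =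
      (chartDeriv n ((extChartAt (𝓡 n) (1 : G)).symm a)).comp
        (modelDeriv (fun x : G => (extChartAt (𝓡 n) (1 : G)).symm a * x) 1) := by
  have h1 : Tendsto (fun a => (a, extChartAt (𝓡 n) (1 : G) 1)) (𝓝 (extChartAt (𝓡 n) (1 : G) 1))
      (𝓝 (extChartAt (𝓡 n) (1 : G) 1, extChartAt (𝓡 n) (1 : G) 1)) :=
    (Continuous.prodMk_left _).tendsto _
  filter_upwards [h1.eventually (eventually_differentiableAt_chartMul n G),
    (isOpen_extChartAt_target (1 : G)).mem_nhds (mem_extChartAt_target (I := 𝓡 n) (1 : G))]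
    with a ha hat
  have h2 := chartDeriv_comp_modelDeriv
    (mdifferentiable_leftMul (n := n) ((extChartAt (𝓡 n) (1 : G)).symm a))
    (by simpa using (extChartAt (𝓡 n) (1 : G)).map_target hat)
    (F := fun b => chartMul n G (a, b))
    (ha.comp _ (hasFDerivAt_prodMk_right _ _).differentiableAt)
    (fun x hx => by simp only [chartMul]; rw [(extChartAt (𝓡 n) (1 : G)).left_inv hx])
  have h3 := (ha.hasFDerivAt.comp (extChartAt (𝓡 n) (1 : G) 1)
    (hasFDerivAt_prodMk_right (𝕜 := ℝ) a (extChartAt (𝓡 n) (1 : G) 1))).fderiv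
  rw [chartDeriv_one] at h2
  simp only [mul_one] at h2
  rw [← h2, ContinuousLinearMap.comp_id]
  exact h3.symm

variable (n G) in
lemma eventually_chartMulLeft :
    ∀ᶠ a in 𝓝 (extChartAt (𝓡 n) (1 : G) 1), chartMulLeft n G a =
      (chartDeriv n ((extChartAt (𝓡 n) (1 : G)).symm a)).comp
        (modelDeriv (fun x : G => x * (extChartAt (𝓡 n) (1 : G)).symm a) 1) := by
  have h1 : Tendsto (fun a => (extChartAt (𝓡 n) (1 : G) 1, a)) (𝓝 (extChartAt (𝓡 n) (1 : G) 1))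
      (𝓝 (extChartAt (𝓡 n) (1 : G) 1, extChartAt (𝓡 n) (1 : G) 1)) :=
    (Continuous.prodMk_right _).tendsto _
  filter_upwards [h1.eventually (eventually_differentiableAt_chartMul n G),
    (isOpen_extChartAt_target (1 : G)).mem_nhds (mem_extChartAt_target (I := 𝓡 n) (1 : G))]
    with a ha hat
  have h2 := chartDeriv_comp_modelDeriv
    (mdifferentiable_rightMul (n := n) ((extChartAt (𝓡 n) (1 : G)).symm a))
    (by simpa using (extChartAt (𝓡 n) (1 : G)).map_target hat)
    (F := fun b => chartMul n G (b, a))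
    (DifferentiableAt.comp (g := chartMul n G) (f := fun b => (b, a)) _ ha
      (hasFDerivAt_prodMk_left _ _).differentiableAt)
    (fun x hx => by simp only [chartMul]; rw [(extChartAt (𝓡 n) (1 : G)).left_inv hx])
  have h3 := (ha.hasFDerivAt.comp (extChartAt (𝓡 n) (1 : G) 1)
    (hasFDerivAt_prodMk_left (𝕜 := ℝ) (extChartAt (𝓡 n) (1 : G) 1) a)).fderiv
  rw [chartDeriv_one] at h2
  simp only [one_mul] at h2
  rw [← h2, ContinuousLinearMap.comp_id]
  exact h3.symm

variable (n G) in
lemma chartMulRight_one : chartMulRight n G (extChartAt (𝓡 n) (1 : G) 1) =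
    ContinuousLinearMap.id ℝ _ := by
  rw [(eventually_chartMulRight n G).self_of_nhds, extChartAt_to_inv, chartDeriv_one]
  have : (fun x : G => 1 * x) = id := by ext x; simp
  rw [this]
  exact mfderiv_id

variable (n G) in
lemma chartMulLeft_one : chartMulLeft n G (extChartAt (𝓡 n) (1 : G) 1) =
    ContinuousLinearMap.id ℝ _ := by
  rw [(eventually_chartMulLeft n G).self_of_nhds, extChartAt_to_inv, chartDeriv_one]
  have : (fun x : G => x * 1) = id := by ext x; simp
  rw [this]
  exact mfderiv_id

/-- The Lie bracket on the model space. -/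
def modelLie (n : ℕ) (G : Type*) [TopologicalSpace G]
    [ChartedSpace (EuclideanSpace ℝ (Fin n)) G] [Group G] (v w : GroupLieAlgebra (𝓡 n) G) :
    EuclideanSpace ℝ (Fin n) :=
  (⁅v, w⁆ : GroupLieAlgebra (𝓡 n) G)

/-- The left-invariant vector field of `v`, read in the chart at `1`. -/
def chartField (n : ℕ) (G : Type*) [TopologicalSpace G]
    [ChartedSpace (EuclideanSpace ℝ (Fin n)) G] [Group G] (v : GroupLieAlgebra (𝓡 n) G) :
    EuclideanSpace ℝ (Fin n) → EuclideanSpace ℝ (Fin n) :=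
  mpullbackWithin 𝓘(ℝ, EuclideanSpace ℝ (Fin n)) (𝓡 n) (extChartAt (𝓡 n) (1 : G)).symm
    (mulInvariantVectorField v) (range (𝓡 n))

variable (n G) in
/-- In the chart at `1`, the left-invariant vector field of `v` is `a ↦ ∂₂m(a, 1) v`, so the bracket
is the skew-symmetrization of the mixed second derivative of the multiplication `m`. -/
lemma modelLie_eq_chartMul (v w : EuclideanSpace ℝ (Fin n)) :
    modelLie n G v w =
      fderiv ℝ (fderiv ℝ (chartMul n G))
        (extChartAt (𝓡 n) (1 : G) 1, extChartAt (𝓡 n) (1 : G) 1) (v, 0) (0, w) -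
      fderiv ℝ (fderiv ℝ (chartMul n G))
        (extChartAt (𝓡 n) (1 : G) 1, extChartAt (𝓡 n) (1 : G) 1) (w, 0) (0, v) := by
  have hV : ∀ v : EuclideanSpace ℝ (Fin n),
      chartField n G v =ᶠ[𝓝 (extChartAt (𝓡 n) (1 : G) 1)]
      fun a => chartMulRight n G a v := by
    intro v
    filter_upwards [eventually_chartMulRight n G,
      (isOpen_extChartAt_target (1 : G)).mem_nhds (mem_extChartAt_target (I := 𝓡 n) (1 : G))]
      with a ha hat
    rw [ha]
    exact extChartAt_symm_pullback (G := G) v hat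
  have h1 : (mfderiv (𝓡 n) 𝓘(ℝ, EuclideanSpace ℝ (Fin n)) (extChartAt (𝓡 n) (1 : G)) 1).inverse =
      ContinuousLinearMap.id ℝ (EuclideanSpace ℝ (Fin n)) := by
    have := chartDeriv_one (n := n) (G := G)
    unfold chartDeriv at this
    exact (congrArg ContinuousLinearMap.inverse this).trans ContinuousLinearMap.inverse_id
  have h2 : modelLie n G v w =
      lieBracketWithin ℝ
      (chartField n G v)
      (chartField n G w)
      ((extChartAt (𝓡 n) (1 : G)).symm ⁻¹' univ ∩ range (𝓡 n)) (extChartAt (𝓡 n) (1 : G) 1) :=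
    DFunLike.congr_fun h1 _
  have h3 : ((extChartAt (𝓡 n) (1 : G)).symm ⁻¹' univ ∩ range (𝓡 n)) = univ := by simp
  rw [h2, h3, lieBracketWithin_univ, lieBracket_eq]
  simp only
  rw [(hV v).fderiv_eq, (hV w).fderiv_eq, (hV v).self_of_nhds, (hV w).self_of_nhds,
    (hasFDerivAt_chartMulRight n G v).fderiv, (hasFDerivAt_chartMulRight n G w).fderiv]
  simp only [chartMulRight_one]
  rfl

variable (n G) in
lemma differentiableAt_chartMulLeft :
    DifferentiableAt ℝ (chartMulLeft n G) (extChartAt (𝓡 n) (1 : G) 1) := by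
  have h := (differentiableAt_fderiv_chartMul n G)
  have h1 : DifferentiableAt ℝ (fun a : EuclideanSpace ℝ (Fin n) => (extChartAt (𝓡 n) (1 : G) 1, a))
    (extChartAt (𝓡 n) (1 : G) 1) := (hasFDerivAt_prodMk_right _ _).differentiableAt
  exact (DifferentiableAt.comp (f := fun a => (extChartAt (𝓡 n) (1 : G) 1, a)) _ h h1).clm_comp
    (differentiableAt_const _)

variable (n G) in
lemma differentiableAt_chartMulRight :
    DifferentiableAt ℝ (chartMulRight n G) (extChartAt (𝓡 n) (1 : G) 1) := by
  have h := (differentiableAt_fderiv_chartMul n G)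
  have h1 : DifferentiableAt ℝ (fun a : EuclideanSpace ℝ (Fin n) => (a, extChartAt (𝓡 n) (1 : G) 1))
    (extChartAt (𝓡 n) (1 : G) 1) := (hasFDerivAt_prodMk_left _ _).differentiableAt
  exact (DifferentiableAt.comp (f := fun a => (a, extChartAt (𝓡 n) (1 : G) 1)) _ h h1).clm_comp
    (differentiableAt_const _)

variable (n G) in
lemma eventually_chartMulLeft_comp_modelAd :
    ∀ᶠ a in 𝓝 (extChartAt (𝓡 n) (1 : G) 1),
      (chartMulLeft n G a).comp (modelAd ((extChartAt (𝓡 n) (1 : G)).symm a)) =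
        chartMulRight n G a := by
  filter_upwards [eventually_chartMulLeft n G, eventually_chartMulRight n G] with a h1 h2
  rw [h1, h2, ContinuousLinearMap.comp_assoc, ← modelDeriv_mul_left_eq]

variable (n G) in
lemma eventually_modelAd_eq :
    (fun a => modelAd (n := n) ((extChartAt (𝓡 n) (1 : G)).symm a))
      =ᶠ[𝓝 (extChartAt (𝓡 n) (1 : G) 1)]
      fun a => (Ring.inverse (chartMulLeft n G a)).comp (chartMulRight n G a) := by
  have hc := (differentiableAt_chartMulLeft n G).continuousAt
  have hu : ∀ᶠ a in 𝓝 (extChartAt (𝓡 n) (1 : G) 1), IsUnit (chartMulLeft n G a) := by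
    refine hc.eventually (Units.isOpen.mem_nhds ?_)
    rw [chartMulLeft_one]
    exact isUnit_one
  filter_upwards [hu, eventually_chartMulLeft_comp_modelAd n G] with a h1 h2
  rw [← h2, ← ContinuousLinearMap.comp_assoc]
  have := Ring.inverse_mul_cancel _ h1
  rw [ContinuousLinearMap.mul_def] at this
  rw [this]
  rfl

variable (n G) in
/-- The differential of the adjoint representation at `1` is the Lie bracket. -/
lemma exists_hasFDerivAt_modelAd :
    ∃ D : EuclideanSpace ℝ (Fin n) →L[ℝ] EuclideanSpace ℝ (Fin n) →L[ℝ] EuclideanSpace ℝ (Fin n),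
      HasFDerivAt (fun a => modelAd (n := n) ((extChartAt (𝓡 n) (1 : G)).symm a)) D
        (extChartAt (𝓡 n) (1 : G) 1) ∧
      ∀ v w, D v w = modelLie n G v w := by
  have hd : DifferentiableAt ℝ (fun a => modelAd (n := n) ((extChartAt (𝓡 n) (1 : G)).symm a))
      (extChartAt (𝓡 n) (1 : G) 1) := by
    refine DifferentiableAt.congr_of_eventuallyEq ?_ (eventually_modelAd_eq n G)
    refine DifferentiableAt.clm_comp ?_ (differentiableAt_chartMulRight n G)
    refine DifferentiableAt.comp (g := Ring.inverse) _ ?_ (differentiableAt_chartMulLeft n G)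
    rw [chartMulLeft_one]
    exact (hasFDerivAt_ringInverse (𝕜 := ℝ)
      (1 : (EuclideanSpace ℝ (Fin n) →L[ℝ] EuclideanSpace ℝ (Fin n))ˣ)).differentiableAt
  refine ⟨_, hd.hasFDerivAt, fun v w => ?_⟩
  have hs : IsSymmSndFDerivAt ℝ (chartMul n G)
      (extChartAt (𝓡 n) (1 : G) 1, extChartAt (𝓡 n) (1 : G) 1) :=
    (contDiffAt_chartMul (n := n) (G := G)).isSymmSndFDerivAt
      (by rw [minSmoothness_of_isRCLikeNormedField]; exact ENat.LEInfty.out)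
  have h1 := (differentiableAt_chartMulLeft n G).hasFDerivAt.clm_apply
    (hd.hasFDerivAt.clm_apply (hasFDerivAt_const (𝕜 := ℝ) (w : EuclideanSpace ℝ (Fin n)) _))
  have h2 : (fun a => chartMulLeft n G a (modelAd ((extChartAt (𝓡 n) (1 : G)).symm a) w))
      =ᶠ[𝓝 (extChartAt (𝓡 n) (1 : G) 1)] fun a => chartMulRight n G a w := by
    filter_upwards [eventually_chartMulLeft_comp_modelAd n G] with a ha
    rw [← ha]
    rfl
  have h3 := h1.unique ((hasFDerivAt_chartMulRight n G w).congr_of_eventuallyEq h2)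
  have h4 := DFunLike.congr_fun h3 v
  have h5 := ((differentiableAt_chartMulLeft n G).hasFDerivAt.clm_apply
    (hasFDerivAt_const (𝕜 := ℝ) (w : EuclideanSpace ℝ (Fin n)) _)).unique
      (hasFDerivAt_chartMulLeft n G w)
  have h6 := DFunLike.congr_fun h5 v
  simp only [_root_.add_apply, ContinuousLinearMap.comp_apply,
    ContinuousLinearMap.flip_apply, ContinuousLinearMap.comp_zero, zero_add, chartMulLeft_one,
    ContinuousLinearMap.inl_apply, ContinuousLinearMap.inr_apply, ContinuousLinearMap.id_apply,
    extChartAt_to_inv, modelAd_one] at h4 h6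
  rw [modelLie_eq_chartMul, hs.eq (w, 0) (0, v), ← h6, ← h4]
  simp

end AdjointRepresentation

/-! ### One-parameter subgroups -/

section OneParameterSubgroups

open Filter Topology Set VectorField

variable {n : ℕ} {G : Type*} [TopologicalSpace G] [ChartedSpace (EuclideanSpace ℝ (Fin n)) G]
  [Group G] [LieGroup (𝓡 n) ∞ G]

/-- The adjoint representation of the Lie algebra on the model space, as the differential of the
adjoint representation of the group. -/
def modelad (n : ℕ) (G : Type*) [TopologicalSpace G]
    [ChartedSpace (EuclideanSpace ℝ (Fin n)) G] [Group G] [LieGroup (𝓡 n) ∞ G] :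
    EuclideanSpace ℝ (Fin n) →L[ℝ] EuclideanSpace ℝ (Fin n) →L[ℝ] EuclideanSpace ℝ (Fin n) :=
  (exists_hasFDerivAt_modelAd n G).choose

lemma hasFDerivAt_modelAd :
    HasFDerivAt (fun a => modelAd (n := n) ((extChartAt (𝓡 n) (1 : G)).symm a)) (modelad n G)
        (extChartAt (𝓡 n) (1 : G) 1) :=
  (exists_hasFDerivAt_modelAd n G).choose_spec.1

lemma modelad_apply (v w : EuclideanSpace ℝ (Fin n)) : modelad n G v w = modelLie n G v w :=
  (exists_hasFDerivAt_modelAd n G).choose_spec.2 v w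

variable (n G) in
lemma continuous_modelAd : Continuous (modelAd (n := n) : G → _) := by
  have : ContinuousMul G := (topologicalGroup_of_lieGroup (𝓡 n) ∞ (G := G)).toContinuousMul
  have h1 : ContinuousAt (modelAd (n := n) : G → _) 1 := by
    refine ContinuousAt.congr_of_eventuallyEq ?_ modelAd_eventuallyEq
    exact ContinuousAt.comp (f := extChartAt (𝓡 n) (1 : G))
      (g := fun a => modelAd (n := n) ((extChartAt (𝓡 n) (1 : G)).symm a))
      (hasFDerivAt_modelAd (n := n) (G := G)).continuousAt (continuousAt_extChartAt (1 : G))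
  rw [continuous_iff_continuousAt]
  intro h
  have e : (modelAd (n := n) : G → _) = fun g => (modelAd h).comp (modelAd (h⁻¹ * g)) := by
    ext1 g
    rw [← modelAd_mul, mul_inv_cancel_left]
  rw [e]
  refine continuousAt_const.clm_comp ?_
  refine ContinuousAt.comp (g := modelAd) (f := fun g => h⁻¹ * g) ?_
    (continuous_const_mul h⁻¹).continuousAt
  simpa using h1

/-- Along a one-parameter subgroup `γ` generated by `X`, the adjoint representation solves
`A' = A (ad X)`. -/
lemma hasDerivAt_modelAd {γ : ℝ → G} {X : GroupLieAlgebra (𝓡 n) G}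
    (hγ : IsMIntegralCurve (I := 𝓡 n) γ (mulInvariantVectorField X)) (s : ℝ) :
    HasDerivAt (fun s => modelAd (n := n) (γ s)) ((modelAd (γ s)).comp (modelad n G X)) s := by
  have hM := isManifold_one_of_lieGroup n G
  have h1 : HasMFDerivAt (𝓡 n) (𝓡 n) (fun x : G => (γ s)⁻¹ * x) (γ s)
      (modelDeriv (n := n) (fun x : G => (γ s)⁻¹ * x) (γ s)) :=
    (mdifferentiable_leftMul (n := n) (γ s)⁻¹ (γ s)).hasMFDerivAt
  have h2 := HasMFDerivAt.comp s h1 (hγ s)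
  have h3 : HasMFDerivAt (𝓡 n) 𝓘(ℝ, EuclideanSpace ℝ (Fin n)) (extChartAt (𝓡 n) (1 : G))
      ((γ s)⁻¹ * γ s) (chartDeriv n ((γ s)⁻¹ * γ s)) :=
    (mdifferentiableAt_extChartAt (by simp)).hasMFDerivAt
  have h4 := HasMFDerivAt.comp s h3 h2
  have h5 : HasFDerivAt (fun t => extChartAt (𝓡 n) (1 : G) ((γ s)⁻¹ * γ t))
      ((chartDeriv n ((γ s)⁻¹ * γ s)).comp
        ((modelDeriv (n := n) (fun x : G => (γ s)⁻¹ * x) (γ s)).comp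
          ((1 : ℝ →L[ℝ] ℝ).smulRight (modelDeriv (n := n) (fun x : G => γ s * x) 1 X)))) s :=
    h4.hasFDerivAt
  have h6 : (modelDeriv (n := n) (fun x : G => (γ s)⁻¹ * x) (γ s)).comp
      (modelDeriv (n := n) (fun x : G => γ s * x) 1) = ContinuousLinearMap.id ℝ _ := by
    rw [← modelDeriv_comp (mdifferentiable_leftMul _) (mdifferentiable_leftMul _) (mul_one _)]
    have : (fun x : G => (γ s)⁻¹ * x) ∘ (fun x => γ s * x) = id := by ext x; simp
    rw [this]
    exact mfderiv_id
  have h7 : HasDerivAt (fun t => extChartAt (𝓡 n) (1 : G) ((γ s)⁻¹ * γ t))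
      (X : EuclideanSpace ℝ (Fin n)) s := by
    have := h5.hasDerivAt
    rw [inv_mul_cancel, chartDeriv_one] at this
    have h8 : modelDeriv (n := n) (fun x : G => (γ s)⁻¹ * x) (γ s)
        (modelDeriv (n := n) (fun x : G => γ s * x) 1 X) = X := DFunLike.congr_fun h6 X
    simp only [ContinuousLinearMap.comp_apply, ContinuousLinearMap.smulRight_apply,
      one_apply_eq_self, one_smul, h8] at this
    exact this
  have e : (fun t => modelAd (n := n) (γ t)) =ᶠ[𝓝 s] fun t => (modelAd (γ s)).comp
      (modelAd ((extChartAt (𝓡 n) (1 : G)).symm (extChartAt (𝓡 n) (1 : G) ((γ s)⁻¹ * γ t)))) := by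
    have hc : Tendsto (fun t => (γ s)⁻¹ * γ t) (𝓝 s) (𝓝 1) := by
      have := h2.continuousAt
      unfold ContinuousAt at this
      simpa [Function.comp_def] using this
    filter_upwards [hc.eventually (modelAd_eventuallyEq (n := n) (G := G))] with t ht
    rw [← ht, ← modelAd_mul, mul_inv_cancel_left]
  refine HasDerivAt.congr_of_eventuallyEq ?_ e
  have h9 : HasFDerivAt (fun a => modelAd (n := n) ((extChartAt (𝓡 n) (1 : G)).symm a))
      (modelad n G)
        (extChartAt (𝓡 n) (1 : G) ((γ s)⁻¹ * γ s)) := by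
    rw [inv_mul_cancel]; exact hasFDerivAt_modelAd
  have h10 := h9.comp_hasDerivAt s h7
  have h11 := (hasDerivAt_const s (modelAd (n := n) (γ s))).clm_comp h10
  simpa using! h11

lemma isMIntegralCurveOn_mul_left {γ : ℝ → G} {X : GroupLieAlgebra (𝓡 n) G} {S : Set ℝ}
    (hγ : IsMIntegralCurveOn (I := 𝓡 n) γ (mulInvariantVectorField X) S) (x : G) :
    IsMIntegralCurveOn (I := 𝓡 n) (fun s => x * γ s) (mulInvariantVectorField X) S := by
  intro s hs
  have h1 : HasMFDerivAt (𝓡 n) (𝓡 n) (fun y : G => x * y) (γ s)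
      (modelDeriv (n := n) (fun y : G => x * y) (γ s)) :=
    (mdifferentiable_leftMul (n := n) x (γ s)).hasMFDerivAt
  have h2 := HasMFDerivAt.comp_hasMFDerivWithinAt s h1 (hγ s hs)
  have h3 : (modelDeriv (n := n) (fun y : G => x * y) (γ s)).comp
      (modelDeriv (n := n) (fun y : G => γ s * y) 1) = modelDeriv (fun y : G => x * γ s * y) 1 := by
    rw [← modelDeriv_comp (mdifferentiable_leftMul _) (mdifferentiable_leftMul _) (mul_one _)]
    congr 1
    ext y
    simp [mul_assoc]
  have h4 : (modelDeriv (n := n) (fun y : G => x * y) (γ s)).comp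
      ((1 : ℝ →L[ℝ] ℝ).smulRight (modelDeriv (n := n) (fun y : G => γ s * y) 1 X)) =
      (1 : ℝ →L[ℝ] ℝ).smulRight (modelDeriv (n := n) (fun y : G => x * γ s * y) 1 X) := by
    rw [← h3]
    ext1
    simp only [ContinuousLinearMap.comp_apply, ContinuousLinearMap.smulRight_apply,
      one_apply_eq_self, one_smul]
    rfl
  exact h2.congr_mfderiv h4

variable [T2Space G]

/-- Left-invariant vector fields are complete. -/
lemma exists_isMIntegralCurve (X : GroupLieAlgebra (𝓡 n) G) :
    ∃ γ : ℝ → G, γ 0 = 1 ∧ IsMIntegralCurve (I := 𝓡 n) γ (mulInvariantVectorField X) := by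
  have hM := isManifold_one_of_lieGroup n G
  have hv := (contMDiff_mulInvariantVectorField (I := 𝓡 n) (G := G) X).of_le (m := 1)
    (by rw [minSmoothness_of_isRCLikeNormedField]; norm_num)
  obtain ⟨γ, h0, hγ⟩ := exists_isMIntegralCurveAt_of_contMDiffAt_boundaryless 0
    (hv.contMDiffAt (x := 1))
  rw [isMIntegralCurveAt_iff'] at hγ
  obtain ⟨ε, hε, hγ⟩ := hγ
  rw [Real.ball_eq_Ioo, zero_sub, zero_add] at hγ
  exact exists_isMIntegralCurve_of_isMIntegralCurveOn hv hε
    (fun x => ⟨fun s => x * γ s, by simp [h0], isMIntegralCurveOn_mul_left hγ x⟩) 1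

end OneParameterSubgroups

/-! ### Invariant tensors and closed subgroups -/

section InvariantTensors

open Filter Topology Set VectorField

lemma LinearMap.BilinForm.hasDerivAt {E : Type*} [NormedAddCommGroup E] [NormedSpace ℝ E]
    [FiniteDimensional ℝ E] (Q : LinearMap.BilinForm ℝ E) {f g : ℝ → E} {f' g' : E} {s : ℝ}
    (hf : HasDerivAt f f' s) (hg : HasDerivAt g g' s) :
    HasDerivAt (fun s => Q (f s) (g s)) (Q f' (g s) + Q (f s) g') s := by
  let Qc : E →L[ℝ] E →L[ℝ] ℝ := LinearMap.toContinuousLinearMap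
    ((LinearMap.toContinuousLinearMap : (E →ₗ[ℝ] ℝ) ≃ₗ[ℝ] _).toLinearMap ∘ₗ Q)
  have h1 : HasDerivAt (fun s => Qc (f s)) (Qc f') s := Qc.hasFDerivAt.comp_hasDerivAt s hf
  exact h1.clm_apply hg

/-- A solution of `A' = A D` with `A 0 = 1` is `exp (s D)`, and so commutes with what commutes
with `D`. -/
lemma commute_of_hasDerivAt_mul {R : Type*} [NormedRing R] [NormedAlgebra ℝ R] [CompleteSpace R]
    {A : ℝ → R} {D S : R} (hA : ∀ s, HasDerivAt A (A s * D) s) (h0 : A 0 = 1)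
    (hS : Commute D S) (s : ℝ) : Commute (A s) S := by
  have h1 : ∀ s, HasDerivAt (fun s : ℝ => A s * NormedSpace.exp (s • -D)) 0 s := by
    intro s
    have h4 := (hA s).mul (hasDerivAt_exp_smul_const' (𝕂 := ℝ) (-D) s)
    convert! h4 using 1
    rw [mul_assoc, ← mul_add, neg_mul, add_neg_cancel, mul_zero]
  have h5 := is_const_of_deriv_eq_zero (fun s => (h1 s).differentiableAt)
    (fun s => (h1 s).deriv) s 0
  simp only [h0, zero_smul, neg_zero, NormedSpace.exp_zero, mul_one, smul_neg] at h5
  have : NormedAlgebra ℚ R := NormedAlgebra.restrictScalars ℚ ℝ R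
  have h6 : NormedSpace.exp (-(s • D)) * NormedSpace.exp (s • D) = 1 := by
    rw [← NormedSpace.exp_add_of_commute (Commute.neg_left (Commute.refl _)), neg_add_cancel,
      NormedSpace.exp_zero]
  rw [← mul_one (A s), ← h6, ← mul_assoc, h5, one_mul]
  exact (hS.smul_left s).exp_left

variable {n : ℕ} {G : Type*} [TopologicalSpace G] [ChartedSpace (EuclideanSpace ℝ (Fin n)) G]
  [Group G] [LieGroup (𝓡 n) ∞ G]

/-- `γ` is an integral curve of the left-invariant vector field defined by the vector `X` of the
model space. -/
def IsInvariantCurve (γ : ℝ → G) (X : EuclideanSpace ℝ (Fin n)) : Prop :=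
  IsMIntegralCurve (I := 𝓡 n) γ (mulInvariantVectorField (G := G) X)

lemma IsInvariantCurve.hasDerivAt {γ : ℝ → G} {X : EuclideanSpace ℝ (Fin n)}
    (hγ : IsInvariantCurve γ X) (s : ℝ) :
    HasDerivAt (fun s => modelAd (n := n) (γ s)) (modelAd (γ s) * modelad n G X) s :=
  hasDerivAt_modelAd hγ s

lemma IsInvariantCurve.hasDerivAt_apply {γ : ℝ → G} {X : EuclideanSpace ℝ (Fin n)}
    (hγ : IsInvariantCurve γ X) (Y : EuclideanSpace ℝ (Fin n)) (s : ℝ) :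
    HasDerivAt (fun s => modelAd (n := n) (γ s) Y) (modelAd (γ s) (modelLie n G X Y)) s := by
  have h := (hγ.hasDerivAt s).clm_apply (hasDerivAt_const s Y)
  simp only [mul_apply_eq_comp, map_zero, add_zero, modelad_apply] at h
  exact h

lemma IsInvariantCurve.hasDerivAt_apply_zero {γ : ℝ → G} {X : EuclideanSpace ℝ (Fin n)}
    (hγ : IsInvariantCurve γ X) (h0 : γ 0 = 1) (Y : EuclideanSpace ℝ (Fin n)) :
    HasDerivAt (fun s => modelAd (n := n) (γ s) Y) (modelLie n G X Y) 0 := by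
  have h := hγ.hasDerivAt_apply Y 0
  rw [h0, modelAd_one] at h
  exact h

/-- What commutes with the generator of a one-parameter subgroup commutes with its adjoint
action. -/
lemma IsInvariantCurve.commute {γ : ℝ → G} {X : EuclideanSpace ℝ (Fin n)}
    (hγ : IsInvariantCurve γ X) (h0 : γ 0 = 1)
    {S : EuclideanSpace ℝ (Fin n) →L[ℝ] EuclideanSpace ℝ (Fin n)}
    (hS : Commute (modelad n G X) S) (s : ℝ) : Commute (modelAd (n := n) (γ s)) S :=
  commute_of_hasDerivAt_mul (A := fun s => modelAd (n := n) (γ s)) hγ.hasDerivAt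
    (by rw [h0]; exact modelAd_one) hS s

lemma lie_skew_of_Ad_invariant {L : Subgroup G} {X : GroupLieAlgebra (𝓡 n) G}
    (hX : X ∈ lieAlgebraCarrier L) {Q : LinearMap.BilinForm ℝ (GroupLieAlgebra (𝓡 n) G)}
    (hQ : ∀ h ∈ L, ∀ X Y, Q (Ad h X) (Ad h Y) = Q X Y) (Y Z : GroupLieAlgebra (𝓡 n) G) :
    Q ⁅X, Y⁆ Z + Q Y ⁅X, Z⁆ = 0 := by
  obtain ⟨γ, hγ', h0, hL⟩ := hX
  have hγ : IsInvariantCurve γ X := hγ'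
  have h1 := LinearMap.BilinForm.hasDerivAt (E := EuclideanSpace ℝ (Fin n)) Q
    (hγ.hasDerivAt_apply_zero h0 Y) (hγ.hasDerivAt_apply_zero h0 Z)
  simp only [h0, modelAd_one] at h1
  have h2 : (fun s => Q (modelAd (n := n) (γ s) Y) (modelAd (n := n) (γ s) Z)) = fun _ => Q Y Z :=
    funext fun s => hQ (γ s) (hL s) Y Z
  exact h1.unique (h2 ▸ hasDerivAt_const 0 (Q Y Z))

/-- The subgroup of the elements whose adjoint action commutes with the endomorphism `σ` and
preserves the bilinear form `B`. -/
def adCentralizer (σ : GroupLieAlgebra (𝓡 n) G →ₗ[ℝ] GroupLieAlgebra (𝓡 n) G)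
    (B : LinearMap.BilinForm ℝ (GroupLieAlgebra (𝓡 n) G)) : Subgroup G where
  carrier := {h | (∀ Y, Ad h (σ Y) = σ (Ad h Y)) ∧ ∀ Y Z, B (Ad h Y) (Ad h Z) = B Y Z}
  one_mem' := by
    have h : ∀ Y : GroupLieAlgebra (𝓡 n) G, Ad (1 : G) Y = Y := fun Y =>
      DFunLike.congr_fun (modelAd_one (n := n) (G := G)) Y
    exact ⟨fun Y => by rw [h, h], fun Y Z => by rw [h, h]⟩
  mul_mem' := by
    intro a b ha hb
    have h : ∀ Y : GroupLieAlgebra (𝓡 n) G, Ad (a * b) Y = Ad a (Ad b Y) := fun Y =>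
      DFunLike.congr_fun (modelAd_mul (n := n) a b) Y
    exact ⟨fun Y => by rw [h, h, hb.1, ha.1], fun Y Z => by rw [h, h, ha.2, hb.2]⟩
  inv_mem' := by
    intro a ha
    have h : ∀ Y : GroupLieAlgebra (𝓡 n) G, Ad a (Ad a⁻¹ Y) = Y := fun Y => by
      have := DFunLike.congr_fun (modelAd_mul (n := n) a a⁻¹) Y
      rw [mul_inv_cancel, modelAd_one] at this
      exact this.symm
    have h' : ∀ Y : GroupLieAlgebra (𝓡 n) G, Ad a⁻¹ (Ad a Y) = Y := fun Y => by
      have := DFunLike.congr_fun (modelAd_mul (n := n) a⁻¹ a) Y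
      rw [inv_mul_cancel, modelAd_one] at this
      exact this.symm
    refine ⟨fun Y => ?_, fun Y Z => by rw [← ha.2, h, h]⟩
    rw [← h' (σ (Ad a⁻¹ Y)), ha.1, h]

lemma isClosed_adCentralizer (σ : GroupLieAlgebra (𝓡 n) G →ₗ[ℝ] GroupLieAlgebra (𝓡 n) G)
    (B : LinearMap.BilinForm ℝ (GroupLieAlgebra (𝓡 n) G)) :
    IsClosed (adCentralizer σ B : Set G) := by
  have hc : ∀ Y, Continuous fun h : G => modelAd (n := n) h Y := fun Y =>
    (continuous_modelAd n G).clm_apply continuous_const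
  let E := EuclideanSpace ℝ (Fin n)
  let σc : E →L[ℝ] E := LinearMap.toContinuousLinearMap (E := E) (F' := E) σ
  let Bc : E →L[ℝ] E →L[ℝ] ℝ := LinearMap.toContinuousLinearMap
    ((LinearMap.toContinuousLinearMap : (E →ₗ[ℝ] ℝ) ≃ₗ[ℝ] _).toLinearMap ∘ₗ B)
  have h1 : IsClosed {h : G | ∀ Y, modelAd (n := n) h (σc Y) = σc (modelAd h Y)} := by
    simp only [ofPred_forall]
    exact isClosed_iInter fun Y => isClosed_eq (hc (σc Y)) (σc.continuous.comp (hc Y))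
  have h2 : IsClosed {h : G | ∀ Y Z, Bc (modelAd (n := n) h Y) (modelAd h Z) = Bc Y Z} := by
    simp only [ofPred_forall]
    exact isClosed_iInter fun Y => isClosed_iInter fun Z => isClosed_eq
      ((Bc.continuous.comp (hc Y)).clm_apply (hc Z)) continuous_const
  exact h1.inter h2

/-- The Lie algebra of the group of the elements that commute with `σ` and preserve `B`. -/
lemma lieAlgebraCarrier_adCentralizer [T2Space G]
    (σ : GroupLieAlgebra (𝓡 n) G →ₗ[ℝ] GroupLieAlgebra (𝓡 n) G)
    (B : LinearMap.BilinForm ℝ (GroupLieAlgebra (𝓡 n) G))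
    (hB : ∀ X Y Z : GroupLieAlgebra (𝓡 n) G, B ⁅X, Y⁆ Z + B Y ⁅X, Z⁆ = 0)
    (X : GroupLieAlgebra (𝓡 n) G) :
    X ∈ lieAlgebraCarrier (adCentralizer σ B) ↔ ∀ Y, ⁅X, σ Y⁆ = σ ⁅X, Y⁆ := by
  let E := EuclideanSpace ℝ (Fin n)
  let σc : E →L[ℝ] E := LinearMap.toContinuousLinearMap (E := E) (F' := E) σ
  constructor
  · rintro ⟨γ, hγ', h0, hL⟩ Y
    have hγ : IsInvariantCurve γ X := hγ'
    have h1 := hγ.hasDerivAt_apply_zero h0 (σ Y)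
    have h2 : HasDerivAt (fun s => σc (modelAd (n := n) (γ s) Y)) (σc (modelLie n G X Y)) 0 :=
      σc.hasFDerivAt.comp_hasDerivAt 0 (hγ.hasDerivAt_apply_zero h0 Y)
    have h3 : (fun s => σc (modelAd (n := n) (γ s) Y)) = fun s => modelAd (n := n) (γ s) (σ Y) :=
      funext fun s => ((hL s).1 Y).symm
    rw [h3] at h2
    exact h1.unique h2
  · intro h
    obtain ⟨γ, h0, hγ'⟩ := exists_isMIntegralCurve X
    have hγ : IsInvariantCurve γ X := hγ'
    have hcomm : Commute (modelad n G X) σc := by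
      refine ContinuousLinearMap.ext fun Y => ?_
      exact (modelad_apply X (σc Y)).trans ((h Y).trans (congrArg σc (modelad_apply X Y).symm))
    refine ⟨γ, hγ', h0, fun s => ⟨fun Y => ?_, fun Y Z => ?_⟩⟩
    · exact DFunLike.congr_fun (hγ.commute h0 hcomm s) Y
    · have h1 : ∀ s Y, modelAd (n := n) (γ s) (modelLie n G X Y) =
          modelLie n G X (modelAd (γ s) Y) := by
        intro s Y
        have := DFunLike.congr_fun (hγ.commute h0 (Commute.refl _) s) (Y : EuclideanSpace ℝ (Fin n))
        exact (congrArg _ (modelad_apply X Y).symm).trans (this.trans (modelad_apply X _))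
      have h2 : ∀ s, HasDerivAt
          (fun s => B (modelAd (n := n) (γ s) Y) (modelAd (n := n) (γ s) Z)) 0 s := by
        intro s
        have := LinearMap.BilinForm.hasDerivAt (E := EuclideanSpace ℝ (Fin n)) B
          (hγ.hasDerivAt_apply Y s) (hγ.hasDerivAt_apply Z s)
        rw [h1, h1] at this
        convert! this using 1
        exact (hB X _ _).symm
      have h3 := is_const_of_deriv_eq_zero (fun s => (h2 s).differentiableAt)
        (fun s => (h2 s).deriv) s 0
      simp only [h0, modelAd_one] at h3
      exact h3

/-- On a compact group, `ad X` has imaginary eigenvalues: if `a + i b` is an eigenvector with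
eigenvalue `p + i q`, then `p = 0`, as `Ad (exp (s X))` is bounded. -/
lemma re_eigenvalue_eq_zero [T2Space G] [CompactSpace G] {X a b : GroupLieAlgebra (𝓡 n) G} {p q : ℝ}
    (ha : ⁅X, a⁆ = p • a - q • b) (hb : ⁅X, b⁆ = q • a + p • b) (hab : a ≠ 0 ∨ b ≠ 0) : p = 0 := by
  obtain ⟨γ, h0, hγ'⟩ := exists_isMIntegralCurve X
  have hγ : IsInvariantCurve γ X := hγ'
  let E := EuclideanSpace ℝ (Fin n)
  let A : ℝ → E →L[ℝ] E := fun s => modelAd (γ s)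
  let a' : E := a
  let b' : E := b
  have dA : ∀ s, HasDerivAt (fun s => A s a') (p • A s a' - q • A s b') s := by
    intro s
    have h := hγ.hasDerivAt_apply a s
    have e : modelLie n G X a = p • a' - q • b' := ha
    rw [e, map_sub, map_smul, map_smul] at h
    exact h
  have dB : ∀ s, HasDerivAt (fun s => A s b') (q • A s a' + p • A s b') s := by
    intro s
    have h := hγ.hasDerivAt_apply b s
    have e : modelLie n G X b = q • a' + p • b' := hb
    rw [e, map_add, map_smul, map_smul] at h
    exact h
  let N : ℝ → ℝ := fun s => inner ℝ (A s a') (A s a') + inner ℝ (A s b') (A s b')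
  have dN : ∀ s, HasDerivAt N (2 * p * N s) s := by
    intro s
    have := ((dA s).inner ℝ (dA s)).add ((dB s).inner ℝ (dB s))
    convert! this using 1
    simp only [N, inner_sub_left, inner_sub_right, inner_add_left, inner_add_right,
      real_inner_smul_left, real_inner_smul_right, real_inner_comm (A s a') (A s b')]
    ring
  have hN : ∀ s, N s * Real.exp (-(2 * p * s)) = N 0 := by
    have : ∀ s, HasDerivAt (fun s => N s * Real.exp (-(2 * p * s))) 0 s := by
      intro s
      have h1 : HasDerivAt (fun s : ℝ => -(2 * p * s)) (-(2 * p)) s := by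
        simpa using! ((hasDerivAt_id s).const_mul (2 * p)).neg
      have := (dN s).mul h1.exp
      convert! this using 1
      ring
    intro s
    have := is_const_of_deriv_eq_zero (fun s => (this s).differentiableAt)
        (fun s => (this s).deriv) s 0
    simpa using this
  have hpos : 0 < N 0 := by
    have e : A 0 = ContinuousLinearMap.id ℝ _ := by simp only [A, h0, modelAd_one]; rfl
    simp only [N, e, ContinuousLinearMap.id_apply, real_inner_self_eq_norm_sq]
    rcases hab with h | h
    · have : 0 < ‖a'‖ := norm_pos_iff.2 h
      positivity
    · have : 0 < ‖b'‖ := norm_pos_iff.2 h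
      positivity
  obtain ⟨C, hC⟩ : ∃ C, ∀ s, N s ≤ C := by
    have hc : Continuous fun h : G => (inner ℝ (modelAd (n := n) h a') (modelAd (n := n) h a') +
        inner ℝ (modelAd (n := n) h b') (modelAd (n := n) h b') : ℝ) := by
      have := fun Y => (continuous_modelAd n G).clm_apply (continuous_const (y := Y))
      exact ((this a').inner (this a')).add ((this b').inner (this b'))
    obtain ⟨C, hC⟩ := (isCompact_range hc).bddAbove
    exact ⟨C, fun s => hC ⟨γ s, rfl⟩⟩
  by_contra hp
  -- `N` grows exponentially, by the choice of the sign and size of `s`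
  have h1 := hN ((C / N 0) / (2 * p))
  have h2 : 2 * p * ((C / N 0) / (2 * p)) = C / N 0 := by field_simp
  rw [h2] at h1
  have h3 : N ((C / N 0) / (2 * p)) = N 0 * Real.exp (C / N 0) := by

    calc _ = N ((C / N 0) / (2 * p)) * (Real.exp (-(C / N 0)) * Real.exp (C / N 0)) := by
          rw [← Real.exp_add, neg_add_cancel, Real.exp_zero, mul_one]
      _ = _ := by rw [← mul_assoc, h1]
  have h4 := hC ((C / N 0) / (2 * p))
  rw [h3] at h4
  have h5 := Real.add_one_le_exp (C / N 0)
  have h6 : N 0 * (C / N 0 + 1) ≤ C := (mul_le_mul_of_nonneg_left h5 hpos.le).trans h4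
  rw [mul_add, mul_div_cancel₀ _ hpos.ne'] at h6
  linarith

end InvariantTensors

/-! ### Naturally reductive metrics and endomorphisms -/

section Reduction

variable {n : ℕ} {G : Type*} [TopologicalSpace G] [ChartedSpace (EuclideanSpace ℝ (Fin n)) G]
  [Group G] [LieGroup (𝓡 n) ∞ G]

/-- The complement `𝔐` is the graph `{(σ V, σ V - V)}` of an endomorphism `σ` of `𝔤` such that
`σ V - V ∈ 𝔩`. As `𝔩` acts by skew-symmetric endomorphisms, natural reductivity says that
`V ↦ [U, σ V]` is skew-symmetric for all `U`. -/
lemma IsNaturallyReductive.exists_endomorphism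
    {Q : LinearMap.BilinForm ℝ (GroupLieAlgebra (𝓡 n) G)} {L : Subgroup G}
    (h : IsNaturallyReductive Q L) :
    ∃ σ : GroupLieAlgebra (𝓡 n) G →ₗ[ℝ] GroupLieAlgebra (𝓡 n) G,
      (∀ V W Z : GroupLieAlgebra (𝓡 n) G, Q ⁅σ V - V, W⁆ Z + Q W ⁅σ V - V, Z⁆ = 0) ∧
      (∀ U V W : GroupLieAlgebra (𝓡 n) G, Q ⁅U, σ V⁆ W + Q V ⁅U, σ W⁆ = 0) := by
  obtain ⟨l, hl, hQ, M, hbot, hsup, -, hM⟩ := h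
  let δ : M →ₗ[ℝ] GroupLieAlgebra (𝓡 n) G :=
    (LinearMap.fst ℝ _ _ - LinearMap.snd ℝ _ _) ∘ₗ M.subtype
  have hML : ∀ U ∈ M, U.2 ∈ l := by
    intro U hU
    have : U ∈ Submodule.prod ⊤ l.toSubmodule := hsup ▸ Submodule.mem_sup_right hU
    exact this.2
  have hδ : Function.Bijective δ := by
    constructor
    · rw [← LinearMap.ker_eq_bot, LinearMap.ker_eq_bot']
      rintro ⟨U, hU⟩ h
      have h1 : U.1 = U.2 := sub_eq_zero.1 h
      have h2 : U ∈ Submodule.map (LinearMap.prod LinearMap.id LinearMap.id) l.toSubmodule ⊓ M :=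
        ⟨⟨U.2, hML U hU, Prod.ext h1.symm rfl⟩, hU⟩
      rw [hbot, Submodule.mem_bot] at h2
      exact Subtype.ext h2
    · intro V
      have h1 : ((V, 0) : GroupLieAlgebra (𝓡 n) G × GroupLieAlgebra (𝓡 n) G) ∈
          Submodule.map (LinearMap.prod LinearMap.id LinearMap.id) l.toSubmodule ⊔ M := by
        rw [hsup]
        exact ⟨trivial, l.zero_mem⟩
      obtain ⟨_, ⟨X, hX, rfl⟩, U, hU, h2⟩ := Submodule.mem_sup.1 h1
      refine ⟨⟨U, hU⟩, ?_⟩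
      have h3 : X + U.1 = V := congrArg Prod.fst h2
      have h4 : X + U.2 = 0 := congrArg Prod.snd h2
      change U.1 - U.2 = V
      rw [← h3, ← sub_zero (X + U.1), ← h4]
      abel
  let e := LinearEquiv.ofBijective δ hδ
  let σ : GroupLieAlgebra (𝓡 n) G →ₗ[ℝ] GroupLieAlgebra (𝓡 n) G :=
    LinearMap.fst ℝ _ _ ∘ₗ M.subtype ∘ₗ e.symm.toLinearMap
  have hσ : ∀ V, (σ V, σ V - V) ∈ M := by
    intro V
    have h1 : (e.symm V).1.1 - (e.symm V).1.2 = V := e.apply_symm_apply V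
    have h2 : (σ V, σ V - V) = (e.symm V).1 := by
      refine Prod.ext rfl ?_
      change (e.symm V).1.1 - V = _
      nth_rewrite 2 [← h1]
      abel
    rw [h2]
    exact (e.symm V).2
  have h1 : ∀ V W Z : GroupLieAlgebra (𝓡 n) G, Q ⁅σ V - V, W⁆ Z + Q W ⁅σ V - V, Z⁆ = 0 := by
    intro V W Z
    have : σ V - V ∈ (l : Set (GroupLieAlgebra (𝓡 n) G)) := hML _ (hσ V)
    rw [hl] at this
    exact lie_skew_of_Ad_invariant this hQ W Z
  refine ⟨σ, h1, fun U V W => ?_⟩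
  have h2 := hM _ (hσ U) _ (hσ V) _ (hσ W)
  have h3 : ∀ V, ⁅σ U, σ V⁆ - ⁅σ U - U, σ V - V⁆ = ⁅σ U - U, V⁆ + ⁅U, σ V⁆ := by
    intro V
    simp only [sub_lie, lie_sub]
    abel
  have h4 : ∀ V, σ V - (σ V - V) = V := fun V => by abel
  change Q (⁅σ U, σ V⁆ - ⁅σ U - U, σ V - V⁆) (σ W - (σ W - W)) +
    Q (σ V - (σ V - V)) (⁅σ U, σ W⁆ - ⁅σ U - U, σ W - W⁆) = 0 at h2
  rw [h3, h3, h4, h4, map_add, LinearMap.add_apply, map_add] at h2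
  linarith [h1 U V W]

/-- If `Q = r κ(σ ·, ·)` with `κ` the Killing form and if the image of `σ - 1` commutes with `σ`,
then `𝔐 = {(σ V, σ V - V)}` is the complement that shows that the metric is naturally reductive with
respect to the group of all elements that commute with `σ`. -/
lemma exists_isNaturallyReductive [T2Space G]
    {Q : LinearMap.BilinForm ℝ (GroupLieAlgebra (𝓡 n) G)}
    (σ : GroupLieAlgebra (𝓡 n) G →ₗ[ℝ] GroupLieAlgebra (𝓡 n) G) (r : ℝ)
    (hQ : ∀ X Y, Q X Y = r * killingForm ℝ (GroupLieAlgebra (𝓡 n) G) (σ X) Y)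
    (hσ : ∀ X Y, killingForm ℝ (GroupLieAlgebra (𝓡 n) G) (σ X) Y =
      killingForm ℝ (GroupLieAlgebra (𝓡 n) G) X (σ Y))
    (hl : ∀ V W : GroupLieAlgebra (𝓡 n) G, σ ⁅σ V - V, W⁆ = ⁅σ V - V, σ W⁆) :
    ∃ L : Subgroup G, IsClosed (L : Set G) ∧ IsNaturallyReductive Q L := by
  let B := killingForm ℝ (GroupLieAlgebra (𝓡 n) G)
  have hB : ∀ X Y Z : GroupLieAlgebra (𝓡 n) G, B ⁅X, Y⁆ Z + B Y ⁅X, Z⁆ = 0 := by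
    intro X Y Z
    have h1 : B ⁅X, Y⁆ Z = - B ⁅Y, X⁆ Z := by rw [← lie_skew, map_neg, LinearMap.neg_apply]
    have h2 : B ⁅Y, X⁆ Z = B Y ⁅X, Z⁆ := LieModule.traceForm_apply_lie_apply ℝ _ _ Y X Z
    rw [h1, h2, neg_add_cancel]
  let l : LieSubalgebra ℝ (GroupLieAlgebra (𝓡 n) G) :=
    { carrier := {X | ∀ Y, ⁅X, σ Y⁆ = σ ⁅X, Y⁆}
      add_mem' := fun {a b} ha hb Y => by rw [add_lie, add_lie, ha, hb, map_add]
      zero_mem' := fun Y => by rw [zero_lie, zero_lie, map_zero]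
      smul_mem' := fun r a ha Y => by rw [smul_lie, smul_lie, ha, map_smul]
      lie_mem' := fun {a b} ha hb Y => by
        have ha' : ∀ Y, ⁅a, σ Y⁆ = σ ⁅a, Y⁆ := ha
        have hb' : ∀ Y, ⁅b, σ Y⁆ = σ ⁅b, Y⁆ := hb
        rw [lie_lie, hb', ha', ha', hb', ← map_sub, lie_lie] }
  have hτ : ∀ V, σ V - V ∈ l := fun V W => (hl V W).symm
  refine ⟨adCentralizer σ B, isClosed_adCentralizer σ B, l, ?_, ?_, ?_⟩
  · ext X
    exact (lieAlgebraCarrier_adCentralizer σ B hB X).symm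
  · intro h hh X Y
    rw [hQ, hQ, ← hh.1]
    exact congrArg (r * ·) (hh.2 _ _)
  refine ⟨LinearMap.range (LinearMap.prod σ (σ - LinearMap.id)), ?_, ?_, ?_, ?_⟩
  · rw [eq_bot_iff]
    rintro _ ⟨⟨X, -, rfl⟩, V, hV⟩
    have h1 : σ V = X := congrArg Prod.fst hV
    have h2 : σ V - V = X := congrArg Prod.snd hV
    have h3 : V = 0 := by rwa [h1, sub_eq_self] at h2
    rw [Submodule.mem_bot, ← hV, h3, map_zero]
  · refine le_antisymm (sup_le ?_ ?_) ?_
    · rintro _ ⟨X, hX, rfl⟩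
      exact ⟨trivial, hX⟩
    · rintro _ ⟨V, rfl⟩
      exact ⟨trivial, hτ V⟩
    · rintro ⟨X, Y⟩ ⟨-, hY⟩
      refine Submodule.mem_sup.2 ⟨(Y - (σ (X - Y) - (X - Y)), Y - (σ (X - Y) - (X - Y))),
        ⟨_, l.sub_mem hY (hτ (X - Y)), rfl⟩, _, ⟨X - Y, rfl⟩, ?_⟩
      refine Prod.ext ?_ ?_
      · change Y - (σ (X - Y) - (X - Y)) + σ (X - Y) = X
        abel
      · change Y - (σ (X - Y) - (X - Y)) + (σ (X - Y) - (X - Y)) = Y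
        abel
  · rintro h hh _ ⟨V, rfl⟩
    refine ⟨Ad h V, Prod.ext (hh.1 V).symm ?_⟩
    change σ (Ad h V) - Ad h V = Ad h (σ V - V)
    rw [← hh.1, map_sub]
  · rintro _ ⟨U, rfl⟩ _ ⟨V, rfl⟩ _ ⟨W, rfl⟩
    change Q (⁅σ U, σ V⁆ - ⁅σ U - U, σ V - V⁆) (σ W - (σ W - W)) +
      Q (σ V - (σ V - V)) (⁅σ U, σ W⁆ - ⁅σ U - U, σ W - W⁆) = 0
    have h3 : ∀ V, ⁅σ U, σ V⁆ - ⁅σ U - U, σ V - V⁆ = ⁅σ U - U, V⁆ + ⁅U, σ V⁆ := by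
      intro V
      simp only [sub_lie, lie_sub]
      abel
    have h4 : ∀ V, σ V - (σ V - V) = V := fun V => by abel
    have h5 : ∀ W, B ⁅U, σ V⁆ (σ W) + B (σ V) ⁅U, σ W⁆ = 0 := fun W => hB U (σ V) (σ W)
    have h6 : B ⁅σ U - U, σ V⁆ W + B (σ V) ⁅σ U - U, W⁆ = 0 := hB _ _ _
    have h7 : B ⁅σ U - U, V⁆ (σ W) = B ⁅σ U - U, σ V⁆ W := by rw [← hl]; exact (hσ _ _).symm
    have h8 := h5 W
    rw [h3, h3, h4, h4, hQ, hQ, ← mul_add, hσ, map_add, LinearMap.add_apply, map_add]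
    change r * (B ⁅σ U - U, V⁆ (σ W) + B ⁅U, σ V⁆ (σ W) +
      (B (σ V) ⁅σ U - U, W⁆ + B (σ V) ⁅U, σ W⁆)) = 0
    rw [h7]
    linear_combination r * h6 + r * h8

end Reduction

/-! ### Arithmetic of the coefficient vectors of roots -/

namespace TypeIIb3

/-- The number `⟨α, αⱼ^∨⟩` for `α = ∑ᵢ fᵢ αᵢ`. -/
def pairing (c : TypeIIb3) (f : Fin c.rank → ℤ) (j : Fin c.rank) : ℤ :=
  ∑ i, f i * c.cartan i j

/-- The reflection in the simple root `αⱼ`, on coefficient vectors. -/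
def refl (c : TypeIIb3) (j : Fin c.rank) (f : Fin c.rank → ℤ) : Fin c.rank → ℤ :=
  fun i => if i = j then f i - c.pairing f j else f i

/-- The squared lengths of the simple roots, divided by two and normalized such that the short
roots have value `1`. -/
def halfLength : (c : TypeIIb3) → Fin c.rank → ℤ
  | F4_2 => (![2, 2, 1, 1] : Fin 4 → ℤ)
  | E7_5 => fun _ => 1
  | E8_2 => fun _ => 1
  | E7_3 => fun _ => 1

/-- The invariant quadratic form on the root lattice. -/
def form (c : TypeIIb3) (f : Fin c.rank → ℤ) : ℤ :=
  ∑ j, c.halfLength j * f j * c.pairing f j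

/-- The largest value of `form` on a root. -/
def maxForm : TypeIIb3 → ℤ
  | F4_2 => 4
  | E7_5 => 2
  | E8_2 => 2
  | E7_3 => 2

lemma cartan_symmetrizable (c : TypeIIb3) (i j : Fin c.rank) :
    c.cartan i j * c.halfLength j = c.cartan j i * c.halfLength i := by
  cases c <;> revert i j <;> decide +kernel

lemma cartan_diag (c : TypeIIb3) (i : Fin c.rank) : c.cartan i i = 2 := by
  cases c <;> revert i <;> decide +kernel

lemma two_mul_halfLength_pos_and_le (c : TypeIIb3) (i : Fin c.rank) :
    0 < 2 * c.halfLength i ∧ 2 * c.halfLength i ≤ c.maxForm := by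
  cases c <;> revert i <;> decide +kernel

lemma refl_eq (c : TypeIIb3) (j : Fin c.rank) (f : Fin c.rank → ℤ) :
    c.refl j f = f - c.pairing f j • Pi.single j 1 := by
  ext i
  by_cases h : i = j
  · subst h
    simp [refl]
  · simp [refl, h]

lemma pairing_add (c : TypeIIb3) (f g : Fin c.rank → ℤ) (j : Fin c.rank) :
    c.pairing (f + g) j = c.pairing f j + c.pairing g j := by
  simp [pairing, add_mul, Finset.sum_add_distrib]

lemma pairing_sub (c : TypeIIb3) (f g : Fin c.rank → ℤ) (j : Fin c.rank) :
    c.pairing (f - g) j = c.pairing f j - c.pairing g j := by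
  simp [pairing, sub_mul, Finset.sum_sub_distrib]

lemma pairing_neg (c : TypeIIb3) (f : Fin c.rank → ℤ) (j : Fin c.rank) :
    c.pairing (-f) j = -c.pairing f j := by
  simp [pairing]

lemma pairing_smul (c : TypeIIb3) (r : ℤ) (f : Fin c.rank → ℤ) (j : Fin c.rank) :
    c.pairing (r • f) j = r * c.pairing f j := by
  simp [pairing, Finset.mul_sum, mul_assoc]

lemma pairing_single (c : TypeIIb3) (i j : Fin c.rank) :
    c.pairing (Pi.single i 1) j = c.cartan i j := by
  simp [pairing, Pi.single_apply]

lemma form_single (c : TypeIIb3) (i : Fin c.rank) :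
    c.form (Pi.single i 1) = 2 * c.halfLength i := by
  simp [form, pairing_single, Pi.single_apply, cartan_diag, mul_comm]

lemma form_neg (c : TypeIIb3) (f : Fin c.rank → ℤ) : c.form (-f) = c.form f := by
  simp [form, pairing_neg]

lemma form_refl (c : TypeIIb3) (j : Fin c.rank) (f : Fin c.rank → ℤ) :
    c.form (c.refl j f) = c.form f := by
  have h1 : ∀ k, c.pairing (c.refl j f) k = c.pairing f k - c.pairing f j * c.cartan j k := by
    intro k
    rw [refl_eq, pairing_sub, pairing_smul, pairing_single]
  have h2 : ∑ k, c.halfLength k * f k * c.cartan j k = c.halfLength j * c.pairing f j := by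
    rw [pairing, Finset.mul_sum]
    refine Finset.sum_congr rfl fun k _ => ?_
    linear_combination (f k) * c.cartan_symmetrizable j k
  have h3 : ∀ k, c.halfLength k * c.refl j f k * c.pairing (c.refl j f) k =
      c.halfLength k * f k * c.pairing f k
      - c.pairing f j * (c.halfLength k * f k * c.cartan j k)
      - (if k = j then c.halfLength j * c.pairing f j * (c.pairing f j - c.pairing f j * 2)
        else 0) := by
    intro k
    rw [h1]
    by_cases h : k = j
    · subst h
      simp only [refl, if_true, cartan_diag]
      ring
    · simp only [refl, h, if_false]
      ring
  simp only [form, h3, Finset.sum_sub_distrib, ← Finset.mul_sum, h2, Finset.sum_ite_eq',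
    Finset.mem_univ, if_true]
  ring

/-- The coefficient vector that the simple reflections in `w` make out of the painted root. -/
def word (c : TypeIIb3) (w : List (Fin c.rank)) : Fin c.rank → ℤ :=
  w.foldl (fun f j => c.refl j f) (Pi.single c.node 1)

/-- There is a root `α` of level `1` such that `α + αᵢ₀`, for the painted node `i₀`, is a root of
level `2` that is not orthogonal to the second component of the diagram, nor, for `E₇(3)`, to the
first one. -/
lemma exists_word_level_one (c : TypeIIb3) : ∃ w, c.word w c.node = 1 ∧
    c.pairing (c.word w) c.node = -1 ∧
    (∃ j ∈ c.nodes₂, c.pairing (c.refl c.node (c.word w)) j ≠ 0) ∧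
    (c = E7_3 → ∃ j ∈ c.nodes₁, c.pairing (c.refl c.node (c.word w)) j ≠ 0) := by
  cases c
  · refine ⟨([0, 2] : List (Fin 4)), ?_, ?_, ?_, fun h => nomatch h⟩ <;> decide +kernel
  · refine ⟨([0, 3, 1, 4, 3] : List (Fin 7)), ?_, ?_, ?_, fun h => nomatch h⟩ <;> decide +kernel
  · refine ⟨([5, 4, 3, 1, 2, 3, 4, 5, 7] : List (Fin 8)), ?_, ?_, ?_, fun h => nomatch h⟩ <;>
      decide +kernel
  · refine ⟨([3, 1, 2, 3, 5] : List (Fin 7)), ?_, ?_, ?_, fun _ => ?_⟩ <;> decide +kernel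

/-- There is a root `α` of level `2` such that `α + αᵢ₀`, for the painted node `i₀`, is a root of
level `3` that is not orthogonal to the first component of the diagram. -/
lemma exists_word_level_two (c : TypeIIb3) : ∃ w, c.word w c.node = 2 ∧
    c.pairing (c.word w) c.node = -1 ∧
    (∃ j ∈ c.nodes₁, c.pairing (c.refl c.node (c.word w)) j ≠ 0) := by
  cases c
  · refine ⟨([0, 2, 1, 3, 2] : List (Fin 4)), ?_, ?_, ?_⟩ <;> decide +kernel
  · refine ⟨([0, 3, 1, 4, 3, 2, 5, 4, 3, 1, 6, 5, 4, 3] : List (Fin 7)), ?_, ?_, ?_⟩ <;>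
      decide +kernel
  · refine ⟨([5, 4, 3, 1, 2, 0, 3, 2, 4, 3, 1, 5, 4, 3, 2, 0, 7, 6, 5, 4, 3, 1, 2, 3, 4, 5] :
      List (Fin 8)), ?_, ?_, ?_⟩ <;> decide +kernel
  · refine ⟨([3, 1, 2, 0, 3, 2, 5, 4, 3, 6, 5] : List (Fin 7)), ?_, ?_, ?_⟩ <;> decide +kernel

lemma pairing_F4_2 (f : Fin 4 → ℤ) : F4_2.pairing f =
    (![2 * f 0 - f 1, 2 * f 1 - f 0 - f 2, 2 * f 2 - 2 * f 1 - f 3, 2 * f 3 - f 2] :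
      Fin 4 → ℤ) := by
  funext (j : Fin 4)
  change ∑ i, f i * CartanMatrix.F₄ i j = _
  fin_cases j <;> simp [CartanMatrix.F₄, Fin.sum_univ_succ] <;> ring

lemma pairing_E7 (f : Fin 7 → ℤ) (j : Fin 7) : ∑ i, f i * CartanMatrix.E₇ i j =
    (![2 * f 0 - f 2, 2 * f 1 - f 3, 2 * f 2 - f 0 - f 3, 2 * f 3 - f 1 - f 2 - f 4,
      2 * f 4 - f 3 - f 5, 2 * f 5 - f 4 - f 6, 2 * f 6 - f 5] : Fin 7 → ℤ) j := by
  fin_cases j <;> simp [CartanMatrix.E₇, Fin.sum_univ_succ] <;> ring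

lemma pairing_E7_5 (f : Fin 7 → ℤ) : E7_5.pairing f =
    (![2 * f 0 - f 2, 2 * f 1 - f 3, 2 * f 2 - f 0 - f 3, 2 * f 3 - f 1 - f 2 - f 4,
      2 * f 4 - f 3 - f 5, 2 * f 5 - f 4 - f 6, 2 * f 6 - f 5] : Fin 7 → ℤ) :=
  funext fun j => pairing_E7 f j

lemma pairing_E7_3 (f : Fin 7 → ℤ) : E7_3.pairing f =
    (![2 * f 0 - f 2, 2 * f 1 - f 3, 2 * f 2 - f 0 - f 3, 2 * f 3 - f 1 - f 2 - f 4,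
      2 * f 4 - f 3 - f 5, 2 * f 5 - f 4 - f 6, 2 * f 6 - f 5] : Fin 7 → ℤ) :=
  funext fun j => pairing_E7 f j

lemma pairing_E8_2 (f : Fin 8 → ℤ) : E8_2.pairing f =
    (![2 * f 0 - f 2, 2 * f 1 - f 3, 2 * f 2 - f 0 - f 3, 2 * f 3 - f 1 - f 2 - f 4,
      2 * f 4 - f 3 - f 5, 2 * f 5 - f 4 - f 6, 2 * f 6 - f 5 - f 7, 2 * f 7 - f 6] :
      Fin 8 → ℤ) := by
  funext (j : Fin 8)
  change ∑ i, f i * CartanMatrix.E₈ i j = _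
  fin_cases j <;> simp [CartanMatrix.E₈, Fin.sum_univ_succ] <;> ring

/-- The invariant form as a sum of squares, completed from the ends of the diagram towards the
painted node, whose coefficient is left as the last term. -/
lemma form_F4_2 (f : Fin 4 → ℤ) : 6 * F4_2.form f = 6 * (2 * f 0 - f 1) ^ 2 +
    3 * (2 * f 3 - f 2) ^ 2 + (3 * f 2 - 4 * f 1) ^ 2 + 2 * f 1 ^ 2 := by
  change 6 * ∑ j : Fin 4, (![2, 2, 1, 1] : Fin 4 → ℤ) j * f j * F4_2.pairing f j = _
  rw [pairing_F4_2]
  simp [Fin.sum_univ_succ]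
  ring

/-- The sum of squares as for `form_F4_2`. -/
lemma form_E7_5 (f : Fin 7 → ℤ) : 12 * E7_5.form f = 6 * (2 * f 0 - f 2) ^ 2 +
    6 * (2 * f 1 - f 3) ^ 2 + 6 * (2 * f 6 - f 5) ^ 2 + 2 * (3 * f 5 - 2 * f 4) ^ 2 +
    (4 * f 4 - 3 * f 3) ^ 2 + (3 * f 3 - 4 * f 2) ^ 2 + 2 * f 2 ^ 2 := by
  change 12 * ∑ j : Fin 7, 1 * f j * E7_5.pairing f j = _
  rw [pairing_E7_5]
  simp [Fin.sum_univ_succ]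
  ring

/-- The sum of squares as for `form_F4_2`. -/
lemma form_E7_3 (f : Fin 7 → ℤ) : 30 * E7_3.form f = 15 * (2 * f 0 - f 2) ^ 2 +
    5 * (3 * f 2 - 2 * f 3) ^ 2 + 15 * (2 * f 1 - f 3) ^ 2 + (5 * f 3 - 6 * f 4) ^ 2 +
    15 * (2 * f 6 - f 5) ^ 2 + 5 * (3 * f 5 - 2 * f 4) ^ 2 + 4 * f 4 ^ 2 := by
  change 30 * ∑ j : Fin 7, 1 * f j * E7_3.pairing f j = _
  rw [pairing_E7_3]
  simp [Fin.sum_univ_succ]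
  ring

/-- The sum of squares as for `form_F4_2`. -/
lemma form_E8_2 (f : Fin 8 → ℤ) : 60 * E8_2.form f = 30 * (2 * f 7 - f 6) ^ 2 +
    30 * (2 * f 0 - f 2) ^ 2 + 10 * (3 * f 2 - 2 * f 3) ^ 2 + 30 * (2 * f 1 - f 3) ^ 2 +
    2 * (5 * f 3 - 6 * f 4) ^ 2 + 3 * (4 * f 4 - 5 * f 5) ^ 2 + 5 * (3 * f 5 - 4 * f 6) ^ 2 +
    10 * f 6 ^ 2 := by
  change 60 * ∑ j : Fin 8, 1 * f j * E8_2.pairing f j = _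
  rw [pairing_E8_2]
  simp [Fin.sum_univ_succ]
  ring

/-- The inference by which an integer in a sum of squares that is bounded is zero, since its square
is less than `1`. -/
lemma eq_zero_of_mul_sq_le {k t b : ℤ} (h : k * t ^ 2 ≤ b) (hb : b < k) (hk : 0 ≤ b) :
    t = 0 := by
  by_contra ht
  have h1 : 0 < t ^ 2 := by positivity
  nlinarith

/-- The roots have coefficient at most `3` at the painted node. -/
lemma abs_apply_node_le {c : TypeIIb3} {f : Fin c.rank → ℤ} (hf : c.form f ≤ c.maxForm) :
    |f c.node| ≤ 3 := by
  have key : ∀ t : ℤ, t ^ 2 ≤ 15 → |t| ≤ 3 := fun t ht => by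
    rw [abs_le]
    constructor <;> nlinarith
  cases c <;> apply key
  · have h := form_F4_2 f
    change F4_2.form f ≤ 4 at hf
    change (f (1 : Fin 4)) ^ 2 ≤ 15
    linarith [sq_nonneg (2 * f (0 : Fin 4) - f (1 : Fin 4)),
      sq_nonneg (2 * f (3 : Fin 4) - f (2 : Fin 4)),
      sq_nonneg (3 * f (2 : Fin 4) - 4 * f (1 : Fin 4))]
  · have h := form_E7_5 f
    change E7_5.form f ≤ 2 at hf
    change (f (2 : Fin 7)) ^ 2 ≤ 15
    linarith [sq_nonneg (2 * f (0 : Fin 7) - f (2 : Fin 7)),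
      sq_nonneg (2 * f (1 : Fin 7) - f (3 : Fin 7)),
      sq_nonneg (2 * f (6 : Fin 7) - f (5 : Fin 7)),
      sq_nonneg (3 * f (5 : Fin 7) - 2 * f (4 : Fin 7)),
      sq_nonneg (4 * f (4 : Fin 7) - 3 * f (3 : Fin 7)),
      sq_nonneg (3 * f (3 : Fin 7) - 4 * f (2 : Fin 7))]
  · have h := form_E8_2 f
    change E8_2.form f ≤ 2 at hf
    change (f (6 : Fin 8)) ^ 2 ≤ 15
    linarith [sq_nonneg (2 * f (7 : Fin 8) - f (6 : Fin 8)),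
      sq_nonneg (2 * f (0 : Fin 8) - f (2 : Fin 8)),
      sq_nonneg (3 * f (2 : Fin 8) - 2 * f (3 : Fin 8)),
      sq_nonneg (2 * f (1 : Fin 8) - f (3 : Fin 8)),
      sq_nonneg (5 * f (3 : Fin 8) - 6 * f (4 : Fin 8)),
      sq_nonneg (4 * f (4 : Fin 8) - 5 * f (5 : Fin 8)),
      sq_nonneg (3 * f (5 : Fin 8) - 4 * f (6 : Fin 8))]
  · have h := form_E7_3 f
    change E7_3.form f ≤ 2 at hf
    change (f (4 : Fin 7)) ^ 2 ≤ 15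
    linarith [sq_nonneg (2 * f (0 : Fin 7) - f (2 : Fin 7)),
      sq_nonneg (3 * f (2 : Fin 7) - 2 * f (3 : Fin 7)),
      sq_nonneg (2 * f (1 : Fin 7) - f (3 : Fin 7)),
      sq_nonneg (5 * f (3 : Fin 7) - 6 * f (4 : Fin 7)),
      sq_nonneg (2 * f (6 : Fin 7) - f (5 : Fin 7)),
      sq_nonneg (3 * f (5 : Fin 7) - 2 * f (4 : Fin 7))]

lemma nodes₂_F4_2 : nodes₂ F4_2 = ({2, 3} : Finset (Fin 4)) :=
  (by decide : ((insert 1 {0})ᶜ : Finset (Fin 4)) = {2, 3})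

lemma forall_mem_nodes₂_F4_2 {P : Fin 4 → Prop} (h2 : P 2) (h3 : P 3) :
    ∀ j ∈ nodes₂ F4_2, P j := by
  have h : ∀ j : Fin 4, j ∈ ({2, 3} : Finset (Fin 4)) → j = 2 ∨ j = 3 := by decide
  intro j hj
  rw [nodes₂_F4_2] at hj
  rcases h j hj with rfl | rfl <;> assumption

lemma nodes₂_E7_5 : nodes₂ E7_5 = ({1, 3, 4, 5, 6} : Finset (Fin 7)) :=
  (by decide : ((insert 2 {0})ᶜ : Finset (Fin 7)) = {1, 3, 4, 5, 6})

lemma forall_mem_nodes₂_E7_5 {P : Fin 7 → Prop} (h1 : P 1) (h3 : P 3) (h4 : P 4) (h5 : P 5)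
    (h6 : P 6) : ∀ j ∈ nodes₂ E7_5, P j := by
  have h : ∀ j : Fin 7, j ∈ ({1, 3, 4, 5, 6} : Finset (Fin 7)) →
      j = 1 ∨ j = 3 ∨ j = 4 ∨ j = 5 ∨ j = 6 := by decide
  intro j hj
  rw [nodes₂_E7_5] at hj
  rcases h j hj with rfl | rfl | rfl | rfl | rfl <;> assumption

lemma nodes₂_E8_2 : nodes₂ E8_2 = ({0, 1, 2, 3, 4, 5} : Finset (Fin 8)) :=
  (by decide : ((insert 6 {7})ᶜ : Finset (Fin 8)) = {0, 1, 2, 3, 4, 5})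

lemma forall_mem_nodes₂_E8_2 {P : Fin 8 → Prop} (h0 : P 0) (h1 : P 1) (h2 : P 2) (h3 : P 3)
    (h4 : P 4) (h5 : P 5) : ∀ j ∈ nodes₂ E8_2, P j := by
  have h : ∀ j : Fin 8, j ∈ ({0, 1, 2, 3, 4, 5} : Finset (Fin 8)) →
      j = 0 ∨ j = 1 ∨ j = 2 ∨ j = 3 ∨ j = 4 ∨ j = 5 := by decide
  intro j hj
  rw [nodes₂_E8_2] at hj
  rcases h j hj with rfl | rfl | rfl | rfl | rfl | rfl <;> assumption

lemma nodes₂_E7_3 : nodes₂ E7_3 = ({5, 6} : Finset (Fin 7)) :=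
  (by decide : ((insert 4 {0, 1, 2, 3})ᶜ : Finset (Fin 7)) = {5, 6})

lemma forall_mem_nodes₂_E7_3 {P : Fin 7 → Prop} (h5 : P 5) (h6 : P 6) :
    ∀ j ∈ nodes₂ E7_3, P j := by
  have h : ∀ j : Fin 7, j ∈ ({5, 6} : Finset (Fin 7)) → j = 5 ∨ j = 6 := by decide
  intro j hj
  rw [nodes₂_E7_3] at hj
  rcases h j hj with rfl | rfl <;> assumption

/-- Unless the diagram is `E₇(3)`, the roots with coefficient `±2` at the painted node are
orthogonal to the first component of the diagram. -/
lemma pairing_nodes₁_eq_zero {c : TypeIIb3} (hc : c ≠ E7_3) {f : Fin c.rank → ℤ}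
    (hf : c.form f ≤ c.maxForm) (h2 : |f c.node| = 2) : ∀ j ∈ c.nodes₁, c.pairing f j = 0 := by
  have key : ∀ s t : ℤ, |s| = 2 → 6 * (2 * t - s) ^ 2 + 2 * s ^ 2 ≤ 24 → 2 * t - s = 0 := by
    intro s t hs h
    rcases eq_or_eq_neg_of_abs_eq hs with rfl | rfl
    · have : 2 * t - 2 = 2 * (t - 1) := by ring
      have : t - 1 = 0 := eq_zero_of_mul_sq_le (k := 24) (b := 16) (by nlinarith)
        (by norm_num) (by norm_num)
      omega
    · have : t + 1 = 0 := eq_zero_of_mul_sq_le (k := 24) (b := 16) (by nlinarith)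
        (by norm_num) (by norm_num)
      omega
  cases c
  · intro (j : Fin 4) hj
    obtain rfl : j = 0 := Finset.mem_singleton.1 hj
    refine (congrFun (pairing_F4_2 f) _).trans ?_
    have h := form_F4_2 f
    change F4_2.form f ≤ 4 at hf
    refine key (f (1 : Fin 4)) (f (0 : Fin 4)) h2 ?_
    linarith [sq_nonneg (2 * f (3 : Fin 4) - f (2 : Fin 4)),
      sq_nonneg (3 * f (2 : Fin 4) - 4 * f (1 : Fin 4))]
  · intro (j : Fin 7) hj
    obtain rfl : j = 0 := Finset.mem_singleton.1 hj
    refine (congrFun (pairing_E7_5 f) _).trans ?_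
    have h := form_E7_5 f
    change E7_5.form f ≤ 2 at hf
    refine key (f (2 : Fin 7)) (f (0 : Fin 7)) h2 ?_
    linarith [sq_nonneg (2 * f (1 : Fin 7) - f (3 : Fin 7)),
      sq_nonneg (2 * f (6 : Fin 7) - f (5 : Fin 7)),
      sq_nonneg (3 * f (5 : Fin 7) - 2 * f (4 : Fin 7)),
      sq_nonneg (4 * f (4 : Fin 7) - 3 * f (3 : Fin 7)),
      sq_nonneg (3 * f (3 : Fin 7) - 4 * f (2 : Fin 7))]
  · intro (j : Fin 8) hj
    obtain rfl : j = 7 := Finset.mem_singleton.1 hj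
    refine (congrFun (pairing_E8_2 f) _).trans ?_
    have h := form_E8_2 f
    change E8_2.form f ≤ 2 at hf
    refine key (f (6 : Fin 8)) (f (7 : Fin 8)) h2 ?_
    linarith [sq_nonneg (2 * f (0 : Fin 8) - f (2 : Fin 8)),
      sq_nonneg (3 * f (2 : Fin 8) - 2 * f (3 : Fin 8)),
      sq_nonneg (2 * f (1 : Fin 8) - f (3 : Fin 8)),
      sq_nonneg (5 * f (3 : Fin 8) - 6 * f (4 : Fin 8)),
      sq_nonneg (4 * f (4 : Fin 8) - 5 * f (5 : Fin 8)),
      sq_nonneg (3 * f (5 : Fin 8) - 4 * f (6 : Fin 8)), sq_nonneg (f (6 : Fin 8))]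
  · exact absurd rfl hc

/-- The roots with coefficient `±3` at the painted node are orthogonal to the second component of
the diagram. -/
lemma pairing_nodes₂_eq_zero {c : TypeIIb3} {f : Fin c.rank → ℤ}
    (hf : c.form f ≤ c.maxForm) (h3 : |f c.node| = 3) : ∀ j ∈ c.nodes₂, c.pairing f j = 0 := by
  obtain ⟨e, he, hfe⟩ : ∃ e : ℤ, e ^ 2 = 1 ∧ f c.node = 3 * e := by
    rcases eq_or_eq_neg_of_abs_eq h3 with h | h
    · exact ⟨1, by norm_num, by rw [h]; norm_num⟩
    · exact ⟨-1, by norm_num, by rw [h]; norm_num⟩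
  clear h3
  cases c
  · have h : 6 * F4_2.form f = _ := form_F4_2 f
    change F4_2.form f ≤ 4 at hf
    change f (1 : Fin 4) = 3 * e at hfe
    generalize F4_2.form f = q at h hf
    have hp := fun j : Fin 4 => congrFun (pairing_F4_2 f) j
    change Fin 4 → ℤ at f
    rw [hfe] at h
    have h2 : f 2 = 4 * e := sub_eq_zero.1 <| eq_zero_of_mul_sq_le (k := 9) (b := 6)
      (by linarith [sq_nonneg (2 * f 0 - 3 * e), sq_nonneg (2 * f 3 - f 2)]) (by norm_num)
      (by norm_num)
    rw [h2] at h
    have h3 : f 3 = 2 * e := sub_eq_zero.1 <| eq_zero_of_mul_sq_le (k := 12) (b := 6)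
      (by linarith [sq_nonneg (2 * f 0 - 3 * e)]) (by norm_num) (by norm_num)
    refine forall_mem_nodes₂_F4_2 (P := fun j => F4_2.pairing f j = 0) ?_ ?_
    · refine (hp 2).trans ?_
      change 2 * f 2 - 2 * f 1 - f 3 = 0
      linarith
    · refine (hp 3).trans ?_
      change 2 * f 3 - f 2 = 0
      linarith
  · have h : 12 * E7_5.form f = _ := form_E7_5 f
    change E7_5.form f ≤ 2 at hf
    change f (2 : Fin 7) = 3 * e at hfe
    generalize E7_5.form f = q at h hf
    have hp := fun j : Fin 7 => congrFun (pairing_E7_5 f) j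
    change Fin 7 → ℤ at f
    rw [hfe] at h
    have h3 : f 3 = 4 * e := sub_eq_zero.1 <| eq_zero_of_mul_sq_le (k := 9) (b := 6)
      (by linarith [sq_nonneg (2 * f 0 - 3 * e), sq_nonneg (2 * f 1 - f 3),
        sq_nonneg (2 * f 6 - f 5), sq_nonneg (3 * f 5 - 2 * f 4),
        sq_nonneg (4 * f 4 - 3 * f 3)]) (by norm_num) (by norm_num)
    rw [h3] at h
    have h1 : f 1 = 2 * e := sub_eq_zero.1 <| eq_zero_of_mul_sq_le (k := 24) (b := 6)
      (by linarith [sq_nonneg (2 * f 0 - 3 * e),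
        sq_nonneg (2 * f 6 - f 5), sq_nonneg (3 * f 5 - 2 * f 4),
        sq_nonneg (4 * f 4 - 3 * (4 * e))]) (by norm_num) (by norm_num)
    have h4 : f 4 = 3 * e := sub_eq_zero.1 <| eq_zero_of_mul_sq_le (k := 16) (b := 6)
      (by linarith [sq_nonneg (2 * f 0 - 3 * e), sq_nonneg (2 * f 1 - 4 * e),
        sq_nonneg (2 * f 6 - f 5), sq_nonneg (3 * f 5 - 2 * f 4)]) (by norm_num) (by norm_num)
    rw [h4] at h
    have h5 : f 5 = 2 * e := sub_eq_zero.1 <| eq_zero_of_mul_sq_le (k := 18) (b := 6)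
      (by linarith [sq_nonneg (2 * f 0 - 3 * e), sq_nonneg (2 * f 1 - 4 * e),
        sq_nonneg (2 * f 6 - f 5)]) (by norm_num) (by norm_num)
    rw [h5] at h
    have h6 : f 6 = e := sub_eq_zero.1 <| eq_zero_of_mul_sq_le (k := 24) (b := 6)
      (by linarith [sq_nonneg (2 * f 0 - 3 * e), sq_nonneg (2 * f 1 - 4 * e)]) (by norm_num)
      (by norm_num)
    refine forall_mem_nodes₂_E7_5 (P := fun j => E7_5.pairing f j = 0) ?_ ?_ ?_ ?_ ?_
    · refine (hp 1).trans ?_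
      change 2 * f 1 - f 3 = 0
      linarith
    · refine (hp 3).trans ?_
      change 2 * f 3 - f 1 - f 2 - f 4 = 0
      linarith
    · refine (hp 4).trans ?_
      change 2 * f 4 - f 3 - f 5 = 0
      linarith
    · refine (hp 5).trans ?_
      change 2 * f 5 - f 4 - f 6 = 0
      linarith
    · refine (hp 6).trans ?_
      change 2 * f 6 - f 5 = 0
      linarith
  · have h : 60 * E8_2.form f = _ := form_E8_2 f
    change E8_2.form f ≤ 2 at hf
    change f (6 : Fin 8) = 3 * e at hfe
    generalize E8_2.form f = q at h hf
    have hp := fun j : Fin 8 => congrFun (pairing_E8_2 f) j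
    change Fin 8 → ℤ at f
    rw [hfe] at h
    have h5 : f 5 = 4 * e := sub_eq_zero.1 <| eq_zero_of_mul_sq_le (k := 45) (b := 30)
      (by linarith [sq_nonneg (2 * f 7 - 3 * e), sq_nonneg (2 * f 0 - f 2),
        sq_nonneg (3 * f 2 - 2 * f 3), sq_nonneg (2 * f 1 - f 3), sq_nonneg (5 * f 3 - 6 * f 4),
        sq_nonneg (4 * f 4 - 5 * f 5)]) (by norm_num) (by norm_num)
    rw [h5] at h
    have h4 : f 4 = 5 * e := sub_eq_zero.1 <| eq_zero_of_mul_sq_le (k := 48) (b := 30)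
      (by linarith [sq_nonneg (2 * f 7 - 3 * e), sq_nonneg (2 * f 0 - f 2),
        sq_nonneg (3 * f 2 - 2 * f 3), sq_nonneg (2 * f 1 - f 3),
        sq_nonneg (5 * f 3 - 6 * f 4)]) (by norm_num) (by norm_num)
    rw [h4] at h
    have h3 : f 3 = 6 * e := sub_eq_zero.1 <| eq_zero_of_mul_sq_le (k := 50) (b := 30)
      (by linarith [sq_nonneg (2 * f 7 - 3 * e), sq_nonneg (2 * f 0 - f 2),
        sq_nonneg (3 * f 2 - 2 * f 3), sq_nonneg (2 * f 1 - f 3)]) (by norm_num) (by norm_num)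
    rw [h3] at h
    have h1 : f 1 = 3 * e := sub_eq_zero.1 <| eq_zero_of_mul_sq_le (k := 120) (b := 30)
      (by linarith [sq_nonneg (2 * f 7 - 3 * e), sq_nonneg (2 * f 0 - f 2),
        sq_nonneg (3 * f 2 - 2 * (6 * e))]) (by norm_num) (by norm_num)
    have h2 : f 2 = 4 * e := sub_eq_zero.1 <| eq_zero_of_mul_sq_le (k := 90) (b := 30)
      (by linarith [sq_nonneg (2 * f 7 - 3 * e), sq_nonneg (2 * f 0 - f 2),
        sq_nonneg (2 * f 1 - 6 * e)]) (by norm_num) (by norm_num)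
    rw [h2] at h
    have h0 : f 0 = 2 * e := sub_eq_zero.1 <| eq_zero_of_mul_sq_le (k := 120) (b := 30)
      (by linarith [sq_nonneg (2 * f 7 - 3 * e), sq_nonneg (2 * f 1 - 6 * e)]) (by norm_num)
      (by norm_num)
    refine forall_mem_nodes₂_E8_2 (P := fun j => E8_2.pairing f j = 0) ?_ ?_ ?_ ?_ ?_ ?_
    · refine (hp 0).trans ?_
      change 2 * f 0 - f 2 = 0
      linarith
    · refine (hp 1).trans ?_
      change 2 * f 1 - f 3 = 0
      linarith
    · refine (hp 2).trans ?_
      change 2 * f 2 - f 0 - f 3 = 0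
      linarith
    · refine (hp 3).trans ?_
      change 2 * f 3 - f 1 - f 2 - f 4 = 0
      linarith
    · refine (hp 4).trans ?_
      change 2 * f 4 - f 3 - f 5 = 0
      linarith
    · refine (hp 5).trans ?_
      change 2 * f 5 - f 4 - f 6 = 0
      linarith
  · have h : 30 * E7_3.form f = _ := form_E7_3 f
    change E7_3.form f ≤ 2 at hf
    change f (4 : Fin 7) = 3 * e at hfe
    generalize E7_3.form f = q at h hf
    have hp := fun j : Fin 7 => congrFun (pairing_E7_3 f) j
    change Fin 7 → ℤ at f
    rw [hfe] at h
    have h5 : f 5 = 2 * e := sub_eq_zero.1 <| eq_zero_of_mul_sq_le (k := 45) (b := 24)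
      (by linarith [sq_nonneg (2 * f 0 - f 2), sq_nonneg (3 * f 2 - 2 * f 3),
        sq_nonneg (2 * f 1 - f 3), sq_nonneg (5 * f 3 - 6 * (3 * e)),
        sq_nonneg (2 * f 6 - f 5)]) (by norm_num) (by norm_num)
    rw [h5] at h
    have h6 : f 6 = e := sub_eq_zero.1 <| eq_zero_of_mul_sq_le (k := 60) (b := 24)
      (by linarith [sq_nonneg (2 * f 0 - f 2), sq_nonneg (3 * f 2 - 2 * f 3),
        sq_nonneg (2 * f 1 - f 3), sq_nonneg (5 * f 3 - 6 * (3 * e))]) (by norm_num) (by norm_num)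
    refine forall_mem_nodes₂_E7_3 (P := fun j => E7_3.pairing f j = 0) ?_ ?_
    · refine (hp 5).trans ?_
      change 2 * f 5 - f 4 - f 6 = 0
      linarith
    · refine (hp 6).trans ?_
      change 2 * f 6 - f 5 = 0
      linarith

lemma node_notMem_nodes₁ (c : TypeIIb3) : c.node ∉ c.nodes₁ := by
  cases c <;> decide +kernel

lemma node_notMem_nodes₂ (c : TypeIIb3) : c.node ∉ c.nodes₂ := by
  simp [nodes₂]

lemma mem_nodes₁_or_mem_nodes₂ (c : TypeIIb3) {j : Fin c.rank} (hj : j ≠ c.node) :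
    j ∈ c.nodes₁ ∨ j ∈ c.nodes₂ := by
  by_cases h : j ∈ c.nodes₁ <;> simp [nodes₂, h, hj]

lemma notMem_nodes₂ {c : TypeIIb3} {j : Fin c.rank} (hj : j ∈ c.nodes₁) : j ∉ c.nodes₂ := by
  simp [nodes₂, hj]

lemma cartan_nodes₁_nodes₂ (c : TypeIIb3) : ∀ i ∈ c.nodes₁, ∀ j ∈ c.nodes₂,
    c.cartan i j = 0 ∧ c.cartan j i = 0 := by
  have h : ∀ p : Fin c.rank × Fin c.rank, p.1 ∈ c.nodes₁ ∧ p.2 ∈ c.nodes₂ →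
      c.cartan p.1 p.2 = 0 ∧ c.cartan p.2 p.1 = 0 := by
    cases c <;> decide +kernel
  exact fun i hi j hj => h (i, j) ⟨hi, hj⟩

/-- A root with coefficient zero at the painted node is supported on one of the two components. -/
lemma support_subset {c : TypeIIb3} {f : Fin c.rank → ℤ} (hf : c.form f ≤ c.maxForm)
    (h0 : f c.node = 0) : (∀ j ∈ c.nodes₂, f j = 0) ∨ (∀ j ∈ c.nodes₁, f j = 0) := by
  have key : ∀ {t : ℤ}, t ≠ 0 → 1 ≤ t ^ 2 := fun h => Int.add_one_le_of_lt (sq_pos_iff.2 h)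
  cases c
  · have h : 6 * F4_2.form f = _ := form_F4_2 f
    change F4_2.form f ≤ 4 at hf
    change f (1 : Fin 4) = 0 at h0
    generalize F4_2.form f = q at h hf
    change Fin 4 → ℤ at f
    rw [h0] at h
    by_cases h1 : f 0 = 0
    · refine Or.inr fun (j : Fin 4) hj => ?_
      obtain rfl : j = 0 := Finset.mem_singleton.1 hj
      exact h1
    · have h1' := key h1
      have h2 : f 2 = 0 := eq_zero_of_mul_sq_le (k := 9) (b := 0)
        (by linarith [sq_nonneg (2 * f 3 - f 2)]) (by norm_num) (by norm_num)
      rw [h2] at h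
      have h3 : f 3 = 0 := eq_zero_of_mul_sq_le (k := 12) (b := 0) (by linarith) (by norm_num)
        (by norm_num)
      exact Or.inl (forall_mem_nodes₂_F4_2 (P := fun j => f j = 0) h2 h3)
  · have h : 12 * E7_5.form f = _ := form_E7_5 f
    change E7_5.form f ≤ 2 at hf
    change f (2 : Fin 7) = 0 at h0
    generalize E7_5.form f = q at h hf
    change Fin 7 → ℤ at f
    rw [h0] at h
    by_cases h1 : f 0 = 0
    · refine Or.inr fun (j : Fin 7) hj => ?_
      obtain rfl : j = 0 := Finset.mem_singleton.1 hj
      exact h1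
    · have h1' := key h1
      have h3 : f 3 = 0 := eq_zero_of_mul_sq_le (k := 9) (b := 0)
        (by linarith [sq_nonneg (2 * f 1 - f 3), sq_nonneg (2 * f 6 - f 5),
          sq_nonneg (3 * f 5 - 2 * f 4), sq_nonneg (4 * f 4 - 3 * f 3)])
        (by norm_num) (by norm_num)
      rw [h3] at h
      have h1 : f 1 = 0 := eq_zero_of_mul_sq_le (k := 24) (b := 0)
        (by linarith [sq_nonneg (2 * f 6 - f 5), sq_nonneg (3 * f 5 - 2 * f 4), sq_nonneg (f 4)])
        (by norm_num) (by norm_num)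
      have h4 : f 4 = 0 := eq_zero_of_mul_sq_le (k := 16) (b := 0)
        (by linarith [sq_nonneg (2 * f 6 - f 5), sq_nonneg (3 * f 5 - 2 * f 4), sq_nonneg (f 1)])
        (by norm_num) (by norm_num)
      rw [h4] at h
      have h5 : f 5 = 0 := eq_zero_of_mul_sq_le (k := 18) (b := 0)
        (by linarith [sq_nonneg (2 * f 6 - f 5), sq_nonneg (f 1)]) (by norm_num) (by norm_num)
      rw [h5] at h
      have h6 : f 6 = 0 := eq_zero_of_mul_sq_le (k := 24) (b := 0)
        (by linarith [sq_nonneg (f 1)]) (by norm_num) (by norm_num)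
      exact Or.inl (forall_mem_nodes₂_E7_5 (P := fun j => f j = 0) h1 h3 h4 h5 h6)
  · have h : 60 * E8_2.form f = _ := form_E8_2 f
    change E8_2.form f ≤ 2 at hf
    change f (6 : Fin 8) = 0 at h0
    generalize E8_2.form f = q at h hf
    change Fin 8 → ℤ at f
    rw [h0] at h
    by_cases h1 : f 7 = 0
    · refine Or.inr fun (j : Fin 8) hj => ?_
      obtain rfl : j = 7 := Finset.mem_singleton.1 hj
      exact h1
    · have h1' := key h1
      have h5 : f 5 = 0 := eq_zero_of_mul_sq_le (k := 45) (b := 0)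
        (by linarith [sq_nonneg (2 * f 0 - f 2), sq_nonneg (3 * f 2 - 2 * f 3),
          sq_nonneg (2 * f 1 - f 3), sq_nonneg (5 * f 3 - 6 * f 4), sq_nonneg (4 * f 4 - 5 * f 5)])
        (by norm_num) (by norm_num)
      rw [h5] at h
      have h4 : f 4 = 0 := eq_zero_of_mul_sq_le (k := 48) (b := 0)
        (by linarith [sq_nonneg (2 * f 0 - f 2), sq_nonneg (3 * f 2 - 2 * f 3),
          sq_nonneg (2 * f 1 - f 3), sq_nonneg (5 * f 3 - 6 * f 4)]) (by norm_num) (by norm_num)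
      rw [h4] at h
      have h3 : f 3 = 0 := eq_zero_of_mul_sq_le (k := 50) (b := 0)
        (by linarith [sq_nonneg (2 * f 0 - f 2), sq_nonneg (3 * f 2 - 2 * f 3),
          sq_nonneg (2 * f 1 - f 3)]) (by norm_num) (by norm_num)
      rw [h3] at h
      have h1 : f 1 = 0 := eq_zero_of_mul_sq_le (k := 120) (b := 0)
        (by linarith [sq_nonneg (2 * f 0 - f 2), sq_nonneg (f 2)]) (by norm_num) (by norm_num)
      have h2 : f 2 = 0 := eq_zero_of_mul_sq_le (k := 90) (b := 0)
        (by linarith [sq_nonneg (2 * f 0 - f 2), sq_nonneg (f 1)]) (by norm_num) (by norm_num)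
      rw [h2] at h
      have h0 : f 0 = 0 := eq_zero_of_mul_sq_le (k := 120) (b := 0)
        (by linarith [sq_nonneg (f 1)]) (by norm_num) (by norm_num)
      exact Or.inl (forall_mem_nodes₂_E8_2 (P := fun j => f j = 0) h0 h1 h2 h3 h4 h5)
  · have h : 30 * E7_3.form f = _ := form_E7_3 f
    change E7_3.form f ≤ 2 at hf
    change f (4 : Fin 7) = 0 at h0
    generalize E7_3.form f = q at h hf
    change Fin 7 → ℤ at f
    rw [h0] at h
    obtain ⟨r, hr⟩ : ∃ r, r = f 6 ^ 2 + f 5 ^ 2 - f 6 * f 5 := ⟨_, rfl⟩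
    have hr' : 60 * r = 15 * (2 * f 6 - f 5) ^ 2 + 45 * f 5 ^ 2 := by rw [hr]; ring
    by_cases h1 : r = 0
    · have h5 : f 5 = 0 := eq_zero_of_mul_sq_le (k := 45) (b := 0)
        (by linarith [sq_nonneg (2 * f 6 - f 5)]) (by norm_num) (by norm_num)
      rw [h5] at hr'
      have h6 : f 6 = 0 := eq_zero_of_mul_sq_le (k := 60) (b := 0)
        (by linarith) (by norm_num) (by norm_num)
      exact Or.inl (forall_mem_nodes₂_E7_3 (P := fun j => f j = 0) h5 h6)
    · have h1' : 1 ≤ r := by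
        have : 0 ≤ r := by nlinarith [sq_nonneg (2 * f 6 - f 5), sq_nonneg (f 5)]
        omega
      have h3 : f 3 = 0 := eq_zero_of_mul_sq_le (k := 25) (b := 0)
        (by linarith [sq_nonneg (2 * f 0 - f 2), sq_nonneg (3 * f 2 - 2 * f 3),
          sq_nonneg (2 * f 1 - f 3)]) (by norm_num) (by norm_num)
      rw [h3] at h
      have h1 : f 1 = 0 := eq_zero_of_mul_sq_le (k := 60) (b := 0)
        (by linarith [sq_nonneg (2 * f 0 - f 2), sq_nonneg (f 2)]) (by norm_num) (by norm_num)
      have h2 : f 2 = 0 := eq_zero_of_mul_sq_le (k := 45) (b := 0)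
        (by linarith [sq_nonneg (2 * f 0 - f 2), sq_nonneg (f 1)]) (by norm_num) (by norm_num)
      rw [h2] at h
      have h0 : f 0 = 0 := eq_zero_of_mul_sq_le (k := 60) (b := 0)
        (by linarith [sq_nonneg (f 1)]) (by norm_num) (by norm_num)
      refine Or.inr fun (j : Fin 7) hj => ?_
      have hj' : ∀ j : Fin 7, j ∈ ({0, 1, 2, 3} : Finset (Fin 7)) → j = 0 ∨ j = 1 ∨ j = 2 ∨ j = 3 :=
        by decide
      rcases hj' j hj with rfl | rfl | rfl | rfl <;> assumption

/-- An integral multiple of the fundamental coweight of the painted node, in terms of the simple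
coroots. -/
lemma exists_coweight (c : TypeIIb3) : ∃ (m : Fin c.rank → ℤ) (d : ℤ), d ≠ 0 ∧ m c.node ≠ 0 ∧
    ∀ k, ∑ j, m j * c.cartan k j = if k = c.node then d else 0 := by
  cases c
  · exact ⟨(![3, 6, 4, 2] : Fin 4 → ℤ), 1, by decide, by decide +kernel, by decide +kernel⟩
  · exact ⟨(![3, 4, 6, 8, 6, 4, 2] : Fin 7 → ℤ), 1, by decide, by decide +kernel,
      by decide +kernel⟩
  · exact ⟨(![4, 6, 8, 12, 10, 8, 6, 3] : Fin 8 → ℤ), 1, by decide, by decide +kernel,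
      by decide +kernel⟩
  · exact ⟨(![6, 9, 12, 18, 15, 10, 5] : Fin 7 → ℤ), 2, by decide, by decide +kernel,
      by decide +kernel⟩

/-- The Dynkin diagram is connected. -/
lemma eq_of_forall_cartan_neg {c : TypeIIb3} {T : Type*} (γ : Fin c.rank → T)
    (h : ∀ i j, c.cartan i j < 0 → γ i = γ j) (i j : Fin c.rank) : γ i = γ j := by
  suffices H : ∀ i, γ i = γ c.node by rw [H i, H j]
  clear i j
  cases c
  · have h01 : γ (0 : Fin 4) = γ (1 : Fin 4) := h (0 : Fin 4) (1 : Fin 4) (by decide +kernel)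
    have h12 : γ (1 : Fin 4) = γ (2 : Fin 4) := h (1 : Fin 4) (2 : Fin 4) (by decide +kernel)
    have h23 : γ (2 : Fin 4) = γ (3 : Fin 4) := h (2 : Fin 4) (3 : Fin 4) (by decide +kernel)
    intro (i : Fin 4)
    change γ i = γ (1 : Fin 4)
    fin_cases i <;> simp_all
  · have h02 : γ (0 : Fin 7) = γ (2 : Fin 7) := h (0 : Fin 7) (2 : Fin 7) (by decide +kernel)
    have h23 : γ (2 : Fin 7) = γ (3 : Fin 7) := h (2 : Fin 7) (3 : Fin 7) (by decide +kernel)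
    have h34 : γ (3 : Fin 7) = γ (4 : Fin 7) := h (3 : Fin 7) (4 : Fin 7) (by decide +kernel)
    have h45 : γ (4 : Fin 7) = γ (5 : Fin 7) := h (4 : Fin 7) (5 : Fin 7) (by decide +kernel)
    have h56 : γ (5 : Fin 7) = γ (6 : Fin 7) := h (5 : Fin 7) (6 : Fin 7) (by decide +kernel)
    have h13 : γ (1 : Fin 7) = γ (3 : Fin 7) := h (1 : Fin 7) (3 : Fin 7) (by decide +kernel)
    intro (i : Fin 7)
    change γ i = γ (2 : Fin 7)
    fin_cases i <;> simp_all
  · have h02 : γ (0 : Fin 8) = γ (2 : Fin 8) := h (0 : Fin 8) (2 : Fin 8) (by decide +kernel)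
    have h23 : γ (2 : Fin 8) = γ (3 : Fin 8) := h (2 : Fin 8) (3 : Fin 8) (by decide +kernel)
    have h34 : γ (3 : Fin 8) = γ (4 : Fin 8) := h (3 : Fin 8) (4 : Fin 8) (by decide +kernel)
    have h45 : γ (4 : Fin 8) = γ (5 : Fin 8) := h (4 : Fin 8) (5 : Fin 8) (by decide +kernel)
    have h56 : γ (5 : Fin 8) = γ (6 : Fin 8) := h (5 : Fin 8) (6 : Fin 8) (by decide +kernel)
    have h67 : γ (6 : Fin 8) = γ (7 : Fin 8) := h (6 : Fin 8) (7 : Fin 8) (by decide +kernel)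
    have h13 : γ (1 : Fin 8) = γ (3 : Fin 8) := h (1 : Fin 8) (3 : Fin 8) (by decide +kernel)
    intro (i : Fin 8)
    change γ i = γ (6 : Fin 8)
    fin_cases i <;> simp_all
  · have h02 : γ (0 : Fin 7) = γ (2 : Fin 7) := h (0 : Fin 7) (2 : Fin 7) (by decide +kernel)
    have h23 : γ (2 : Fin 7) = γ (3 : Fin 7) := h (2 : Fin 7) (3 : Fin 7) (by decide +kernel)
    have h34 : γ (3 : Fin 7) = γ (4 : Fin 7) := h (3 : Fin 7) (4 : Fin 7) (by decide +kernel)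
    have h45 : γ (4 : Fin 7) = γ (5 : Fin 7) := h (4 : Fin 7) (5 : Fin 7) (by decide +kernel)
    have h56 : γ (5 : Fin 7) = γ (6 : Fin 7) := h (5 : Fin 7) (6 : Fin 7) (by decide +kernel)
    have h13 : γ (1 : Fin 7) = γ (3 : Fin 7) := h (1 : Fin 7) (3 : Fin 7) (by decide +kernel)
    intro (i : Fin 7)
    change γ i = γ (4 : Fin 7)
    fin_cases i <;> simp_all

end TypeIIb3

/-! ### The root system -/

namespace PaintedRootDatum

open LieAlgebra LieAlgebra.IsKilling LieModule

variable {c : TypeIIb3} {g : Type*} [LieRing g] [LieAlgebra ℝ g]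
  [Module.Finite ℝ g] [LieAlgebra.IsKilling ℝ g] (D : PaintedRootDatum c g)

/-- The simple coroot `αⱼ^∨`, an element of `𝔱^ℂ`. -/
def simpleCoroot (j : Fin c.rank) : D.tC := coroot (D.simpleRoot j : Weight ℂ D.tC (ℂ ⊗[ℝ] g))

variable {D}

lemma simpleRoot_simpleCoroot (i j : Fin c.rank) :
    (rootSystem D.tC).root (D.simpleRoot i) (D.simpleCoroot j) = (c.cartan i j : ℂ) := by
  have h := D.cartanMatrix_eq i j
  have h1 := D.base.algebraMap_cartanMatrixIn_apply ℤ (D.enum i) (D.enum j)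
  rw [← h]
  exact h1.symm

lemma HasCoeffs.apply_simpleCoroot {α : D.tC.root} {f : Fin c.rank → ℤ} (h : D.HasCoeffs α f)
    (j : Fin c.rank) : (rootSystem D.tC).root α (D.simpleCoroot j) = (c.pairing f j : ℂ) := by
  rw [h, LinearMap.sum_apply, TypeIIb3.pairing, Int.cast_sum]
  refine Finset.sum_congr rfl fun i _ => ?_
  rw [LinearMap.smul_apply, simpleRoot_simpleCoroot, zsmul_eq_mul, Int.cast_mul]

lemma linearIndependent_simpleRoot :
    LinearIndependent ℂ fun j => (rootSystem D.tC).root (D.simpleRoot j) :=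
  D.base.linearIndepOn_root.linearIndependent.comp D.enum D.enum.injective

lemma HasCoeffs.unique {α : D.tC.root} {f f' : Fin c.rank → ℤ} (h : D.HasCoeffs α f)
    (h' : D.HasCoeffs α f') : f = f' := by
  have h1 := linearIndependent_simpleRoot (D := D)
  rw [Fintype.linearIndependent_iff] at h1
  funext j
  have h2 := h1 (fun j => ((f j - f' j : ℤ) : ℂ)) (by
    simp only [Int.cast_smul_eq_zsmul, sub_smul, Finset.sum_sub_distrib]
    exact sub_eq_zero.2 (h.symm.trans h')) j
  exact sub_eq_zero.1 (by exact_mod_cast h2)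

lemma exists_hasCoeffs (α : D.tC.root) : ∃ f, D.HasCoeffs α f := by
  have h := D.base.root_mem_span_int α
  have h1 : (rootSystem D.tC).root '' D.base.support =
      Set.range fun j => (rootSystem D.tC).root (D.simpleRoot j) := by
    ext x
    constructor
    · rintro ⟨β, hβ, rfl⟩
      exact ⟨D.enum.symm ⟨β, hβ⟩, by simp [simpleRoot]⟩
    · rintro ⟨j, rfl⟩
      exact ⟨_, (D.enum j).2, rfl⟩
  rw [h1, Submodule.mem_span_range_iff_exists_fun] at h
  obtain ⟨f, hf⟩ := h
  exact ⟨f, hf.symm⟩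

lemma hasCoeffs_simpleRoot (j : Fin c.rank) : D.HasCoeffs (D.simpleRoot j) (Pi.single j 1) := by
  simp [HasCoeffs, Pi.single_apply]

lemma HasCoeffs.reflection {α : D.tC.root} {f : Fin c.rank → ℤ} (h : D.HasCoeffs α f)
    (j : Fin c.rank) :
    D.HasCoeffs ((rootSystem D.tC).reflectionPerm (D.simpleRoot j) α) (c.refl j f) := by
  have h1 := h.apply_simpleCoroot j
  rw [HasCoeffs, RootPairing.root_reflectionPerm, RootPairing.reflection_apply]
  change _ - ((rootSystem D.tC).root α (D.simpleCoroot j)) • _ = _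
  rw [h1, h, TypeIIb3.refl_eq]
  simp [sub_smul, Finset.sum_sub_distrib, Pi.single_apply, Int.cast_smul_eq_zsmul]

lemma HasCoeffs.neg {α : D.tC.root} {f : Fin c.rank → ℤ} (h : D.HasCoeffs α f) :
    D.HasCoeffs ((rootSystem D.tC).reflectionPerm α α) (-f) := by
  rw [HasCoeffs, RootPairing.root_reflectionPerm, RootPairing.reflection_apply_self, h]
  simp

lemma HasCoeffs.form_pos_and_le {α : D.tC.root} {f : Fin c.rank → ℤ} (h : D.HasCoeffs α f) :
    0 < c.form f ∧ c.form f ≤ c.maxForm := by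
  revert f
  refine D.base.induction_reflect α (p := fun α => ∀ {f}, D.HasCoeffs α f →
    0 < c.form f ∧ c.form f ≤ c.maxForm) ?_ ?_ ?_
  · intro α hα f hf
    obtain ⟨f', hf'⟩ := exists_hasCoeffs α
    rw [hf.unique hf'.neg, TypeIIb3.form_neg]
    exact hα hf'
  · intro α hα f hf
    obtain ⟨j, hj⟩ : ∃ j, α = D.simpleRoot j := ⟨D.enum.symm ⟨α, hα⟩, by simp [simpleRoot]⟩
    rw [hj] at hf
    rw [hf.unique (hasCoeffs_simpleRoot j), TypeIIb3.form_single]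
    exact TypeIIb3.two_mul_halfLength_pos_and_le c j
  · intro α β hα hβ f hf
    obtain ⟨j, rfl⟩ : ∃ j, β = D.simpleRoot j := ⟨D.enum.symm ⟨β, hβ⟩, by simp [simpleRoot]⟩
    obtain ⟨f', hf'⟩ := exists_hasCoeffs α
    rw [hf.unique (hf'.reflection j), TypeIIb3.form_refl]
    exact hα hf'

lemma exists_hasCoeffs_word (w : List (Fin c.rank)) : ∃ α, D.HasCoeffs α (c.word w) := by
  suffices H : ∀ (w : List (Fin c.rank)) (f : Fin c.rank → ℤ), (∃ α, D.HasCoeffs α f) →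
      ∃ α, D.HasCoeffs α (w.foldl (fun f j => c.refl j f) f) from
    H w _ ⟨_, hasCoeffs_simpleRoot c.node⟩
  intro w
  induction w with
  | nil => exact fun f h => h
  | cons j w ih => exact fun f ⟨α, hα⟩ => ih _ ⟨_, hα.reflection j⟩

end PaintedRootDatum

/-! ### Root vectors -/

lemma killingForm_lie {R L : Type*} [CommRing R] [LieRing L] [LieAlgebra R L] (x y z : L) :
    killingForm R L ⁅x, y⁆ z = killingForm R L x ⁅y, z⁆ :=
  LieModule.traceForm_apply_lie_apply R _ _ x y z

lemma killingForm_comm {R L : Type*} [CommRing R] [LieRing L] [LieAlgebra R L] (x y : L) :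
    killingForm R L x y = killingForm R L y x :=
  LieModule.traceForm_comm R _ _ x y

namespace PaintedRootDatum

open LieAlgebra LieAlgebra.IsKilling LieModule

variable {c : TypeIIb3} {g : Type*} [LieRing g] [LieAlgebra ℝ g]
  [Module.Finite ℝ g] [LieAlgebra.IsKilling ℝ g] (D : PaintedRootDatum c g)

/-- The linear form `∑ⱼ fⱼ αⱼ` on `𝔱^ℂ`. -/
def eval (f : Fin c.rank → ℤ) : Module.Dual ℂ D.tC :=
  ∑ j, f j • (rootSystem D.tC).root (D.simpleRoot j)

/-- The root vectors for the root with coefficients `f`. This set is empty if there is no such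
root; otherwise it is the root space, `0` included. -/
def rootVectors (f : Fin c.rank → ℤ) : Set (ℂ ⊗[ℝ] g) :=
  {x | ∃ α, D.HasCoeffs α f ∧ x ∈ rootSpace D.tC (α : Weight ℂ D.tC (ℂ ⊗[ℝ] g))}

variable {D}

lemma HasCoeffs.coe_eq {α : D.tC.root} {f : Fin c.rank → ℤ} (h : D.HasCoeffs α f) :
    ((α : Weight ℂ D.tC (ℂ ⊗[ℝ] g)) : D.tC → ℂ) = D.eval f := by
  have h1 : (rootSystem D.tC).root α = D.eval f := h
  rw [← h1]
  rfl

lemma mem_rootSpace_eval {f : Fin c.rank → ℤ} {x : ℂ ⊗[ℝ] g} (hx : x ∈ D.rootVectors f) :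
    x ∈ rootSpace D.tC (D.eval f) := by
  obtain ⟨α, hα, hx⟩ := hx
  rwa [← hα.coe_eq]

lemma eval_add (f f' : Fin c.rank → ℤ) : D.eval (f + f') = D.eval f + D.eval f' := by
  simp [eval, add_smul, Finset.sum_add_distrib]

lemma eval_neg (f : Fin c.rank → ℤ) : D.eval (-f) = -D.eval f := by
  simp [eval]

lemma eval_eq_zero {f : Fin c.rank → ℤ} (h : D.eval f = 0) : f = 0 := by
  have h1 := linearIndependent_simpleRoot (D := D)
  rw [Fintype.linearIndependent_iff] at h1
  funext j
  have h2 := h1 (fun j => (f j : ℂ)) (by simpa only [Int.cast_smul_eq_zsmul, eval] using h) j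
  exact_mod_cast h2

lemma eval_simpleCoroot (f : Fin c.rank → ℤ) (j : Fin c.rank) :
    D.eval f (D.simpleCoroot j) = (c.pairing f j : ℂ) := by
  rw [eval, LinearMap.sum_apply, TypeIIb3.pairing, Int.cast_sum]
  refine Finset.sum_congr rfl fun i _ => ?_
  rw [LinearMap.smul_apply, simpleRoot_simpleCoroot, zsmul_eq_mul, Int.cast_mul]

lemma lie_rootVector {f : Fin c.rank → ℤ} {x : ℂ ⊗[ℝ] g} (hx : x ∈ D.rootVectors f)
    (H : D.tC) : ⁅(H : ℂ ⊗[ℝ] g), x⁆ = D.eval f H • x :=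
  lie_eq_smul_of_mem_rootSpace (mem_rootSpace_eval hx) H

lemma lie_eq_zero_of_mem_tC (H H' : D.tC) : ⁅(H : ℂ ⊗[ℝ] g), (H' : ℂ ⊗[ℝ] g)⁆ = 0 := by
  have h : ⁅H, H'⁆ = 0 := trivial_lie_zero _ _ _ _
  exact congrArg Subtype.val h

lemma lie_mem_rootVectors {f f' : Fin c.rank → ℤ} {x y : ℂ ⊗[ℝ] g} (hx : x ∈ D.rootVectors f)
    (hy : y ∈ D.rootVectors f') (h0 : f + f' ≠ 0) (h : ⁅x, y⁆ ≠ 0) :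
    ⁅x, y⁆ ∈ D.rootVectors (f + f') := by
  have h1 := lie_mem_genWeightSpace_of_mem_genWeightSpace (mem_rootSpace_eval hx)
    (mem_rootSpace_eval hy)
  have h2 : (D.eval f : D.tC → ℂ) + D.eval f' = D.eval (f + f') := by rw [eval_add]; rfl
  rw [h2] at h1
  let γ : Weight ℂ D.tC (ℂ ⊗[ℝ] g) := ⟨D.eval (f + f'), fun h3 => h (by
    change ⁅x, y⁆ ∈ genWeightSpace (ℂ ⊗[ℝ] g) _ at h1
    rwa [h3, LieSubmodule.mem_bot] at h1)⟩
  have hγ : γ.IsNonZero := fun h3 => h0 (eval_eq_zero (D := D) (by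
    ext H
    exact congrFun (show (γ : D.tC → ℂ) = 0 from h3) H))
  refine ⟨⟨γ, by simpa using hγ⟩, ?_, h1⟩
  ext H
  rfl

lemma form_pos_of_mem_rootVectors {f : Fin c.rank → ℤ} {x : ℂ ⊗[ℝ] g}
    (hx : x ∈ D.rootVectors f) : 0 < c.form f := by
  obtain ⟨α, hα, -⟩ := hx
  exact hα.form_pos_and_le.1

lemma form_le_of_mem_rootVectors {f : Fin c.rank → ℤ} {x : ℂ ⊗[ℝ] g}
    (hx : x ∈ D.rootVectors f) : c.form f ≤ c.maxForm := by
  obtain ⟨α, hα, -⟩ := hx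
  exact hα.form_pos_and_le.2

lemma ne_zero_of_mem_rootVectors {f : Fin c.rank → ℤ} {x : ℂ ⊗[ℝ] g}
    (hx : x ∈ D.rootVectors f) : f ≠ 0 := by
  rintro rfl
  have := form_pos_of_mem_rootVectors hx
  simp [TypeIIb3.form] at this

lemma killingForm_rootVectors {f f' : Fin c.rank → ℤ} {x y : ℂ ⊗[ℝ] g}
    (hx : x ∈ D.rootVectors f) (hy : y ∈ D.rootVectors f') (h : f + f' ≠ 0) :
    killingForm ℂ (ℂ ⊗[ℝ] g) x y = 0 := by
  refine killingForm_apply_eq_zero_of_mem_rootSpace_of_add_ne_zero ℂ _ D.tC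
    (mem_rootSpace_eval hx) (mem_rootSpace_eval hy) fun h1 => h (eval_eq_zero (D := D) ?_)
  ext H
  rw [eval_add]
  exact congrFun h1 H

lemma killingForm_tC_rootVector {f : Fin c.rank → ℤ} {x : ℂ ⊗[ℝ] g}
    (hx : x ∈ D.rootVectors f) (H : D.tC) : killingForm ℂ (ℂ ⊗[ℝ] g) H x = 0 := by
  have h0 : (H : ℂ ⊗[ℝ] g) ∈ rootSpace D.tC (0 : D.tC → ℂ) := by
    rw [rootSpace_zero_eq]
    exact H.2
  refine killingForm_apply_eq_zero_of_mem_rootSpace_of_add_ne_zero ℂ _ D.tC h0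
    (mem_rootSpace_eval hx) fun h1 => ne_zero_of_mem_rootVectors hx (eval_eq_zero (D := D) ?_)
  ext H
  rw [zero_add] at h1
  exact congrFun h1 H

/-- Every root is part of an `𝔰𝔩₂`-triple. -/
lemma HasCoeffs.exists_isSl2Triple {α : D.tC.root} {f : Fin c.rank → ℤ} (h : D.HasCoeffs α f) :
    ∃ x ∈ D.rootVectors f, ∃ y ∈ D.rootVectors (-f),
      IsSl2Triple ((coroot (α : Weight ℂ D.tC (ℂ ⊗[ℝ] g)) : D.tC) : ℂ ⊗[ℝ] g) x y := by
  have hα := LieSubalgebra.isNonZero_coe_root α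
  obtain ⟨h', x, y, ht, hx, hy⟩ := exists_isSl2Triple_of_weight_isNonZero hα
  have hh := IsSl2Triple.h_eq_coroot hα ht hx hy
  refine ⟨x, ⟨α, h, hx⟩, y, ⟨_, h.neg, ?_⟩, hh ▸ ht⟩
  have h1 := h.neg.coe_eq
  rw [h1, eval_neg]
  have h2 : (-(α : Weight ℂ D.tC (ℂ ⊗[ℝ] g)) : D.tC → ℂ) = (-D.eval f : Module.Dual ℂ D.tC) := by
    rw [h.coe_eq]
    rfl
  rwa [← h2]

lemma span_simpleCoroot : Submodule.span ℂ (Set.range D.simpleCoroot) = ⊤ := by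
  have h := D.base.span_coroot_support
  have h1 : (rootSystem D.tC).coroot '' D.base.support = Set.range D.simpleCoroot := by
    ext x
    constructor
    · rintro ⟨β, hβ, rfl⟩
      exact ⟨D.enum.symm ⟨β, hβ⟩, by simp [simpleCoroot, simpleRoot]⟩
    · rintro ⟨j, rfl⟩
      exact ⟨_, (D.enum j).2, rfl⟩
  rw [← h1, h]
  exact RootPairing.IsRootSystem.span_coroot_eq_top

/-- `𝔤^ℂ` is spanned by `𝔱^ℂ` and the root vectors. -/
lemma span_tC_union_rootVectors :
    Submodule.span ℂ ((D.tC : Set (ℂ ⊗[ℝ] g)) ∪ ⋃ f, D.rootVectors f) = ⊤ := by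
  rw [eq_top_iff]
  rintro x -
  have hx : x ∈ ⨆ χ : Weight ℂ D.tC (ℂ ⊗[ℝ] g), genWeightSpace (ℂ ⊗[ℝ] g) χ := by
    rw [iSup_genWeightSpace_eq_top' ℂ D.tC (ℂ ⊗[ℝ] g)]
    trivial
  induction hx using LieSubmodule.iSup_induction' with
  | mem χ y hy =>
    refine Submodule.subset_span ?_
    by_cases hχ : χ.IsZero
    · left
      have h0 : y ∈ rootSpace D.tC (0 : D.tC → ℂ) := by
        rwa [show (χ : D.tC → ℂ) = 0 from hχ] at hy
      rw [rootSpace_zero_eq] at h0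
      exact h0
    · right
      obtain ⟨f, hf⟩ := exists_hasCoeffs (D := D) ⟨χ, by simpa using hχ⟩
      exact Set.mem_iUnion.2 ⟨f, _, hf, hy⟩
  | zero => exact zero_mem _
  | add => exact add_mem ‹_› ‹_›

/-- If `⟨β, αⱼ^∨⟩ < 0` then `[𝔤^{αⱼ}, 𝔤^β] ≠ 0`. -/
lemma lie_ne_zero {f : Fin c.rank → ℤ} {j : Fin c.rank} {x h e y : ℂ ⊗[ℝ] g}
    (hx : x ∈ D.rootVectors f) (hx0 : x ≠ 0) (hp : c.pairing f j < 0)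
    (ht : IsSl2Triple h e y) (hh : h = D.simpleCoroot j) : ⁅e, x⁆ ≠ 0 := by
  intro h0
  have P : IsSl2Triple.HasPrimitiveVectorWith ht x (c.pairing f j : ℂ) :=
    ⟨hx0, by rw [hh, lie_rootVector hx, eval_simpleCoroot], h0⟩
  obtain ⟨n, hn⟩ := P.exists_nat
  have h1 : c.pairing f j = n := by exact_mod_cast hn
  omega

end PaintedRootDatum

/-! ### Bilinear forms with an alternating bracket contraction -/

namespace PaintedRootDatum

open LieAlgebra LieAlgebra.IsKilling LieModule

variable {c : TypeIIb3} {g : Type*} [LieRing g] [LieAlgebra ℝ g]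
  [Module.Finite ℝ g] [LieAlgebra.IsKilling ℝ g] {D : PaintedRootDatum c g}

lemma exists_eval_ne_zero {f : Fin c.rank → ℤ} (hf : f ≠ 0) : ∃ H, D.eval f H ≠ 0 := by
  by_contra! h
  exact hf (eval_eq_zero (LinearMap.ext h))

lemma exists_eq_smul {f : Fin c.rank → ℤ} {x y : ℂ ⊗[ℝ] g} (hx : x ∈ D.rootVectors f)
    (hy : y ∈ D.rootVectors f) (hy0 : y ≠ 0) : ∃ t : ℂ, x = t • y := by
  obtain ⟨α, hα, hx⟩ := hx
  have hy' : y ∈ rootSpace D.tC (α : Weight ℂ D.tC (ℂ ⊗[ℝ] g)) := by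
    rw [hα.coe_eq]
    exact mem_rootSpace_eval hy
  obtain ⟨t, ht⟩ := (finrank_eq_one_iff_of_nonzero' (⟨y, hy'⟩ : rootSpace D.tC _)
    (by simpa using hy0)).1 (finrank_rootSpace_eq_one _ (LieSubalgebra.isNonZero_coe_root α))
    ⟨x, hx⟩
  exact ⟨t, (congrArg Subtype.val ht).symm⟩

/-- A linear map is determined by its values on `𝔱^ℂ` and on the root vectors. -/
lemma linearMap_eq_zero {N : Type*} [AddCommGroup N] [Module ℂ N] (φ : (ℂ ⊗[ℝ] g) →ₗ[ℂ] N)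
    (h0 : ∀ H : D.tC, φ H = 0) (h1 : ∀ f, ∀ x ∈ D.rootVectors f, φ x = 0) : φ = 0 := by
  refine LinearMap.ext_on (span_tC_union_rootVectors (D := D)) ?_
  rintro x (hx | hx)
  · exact h0 ⟨x, hx⟩
  · obtain ⟨f, hf⟩ := Set.mem_iUnion.1 hx
    exact h1 f x hf

lemma linearMap_tC_eq_zero {N : Type*} [AddCommGroup N] [Module ℂ N] (φ : D.tC →ₗ[ℂ] N)
    (h : ∀ j, φ (D.simpleCoroot j) = 0) : φ = 0 := by
  refine LinearMap.ext_on (span_simpleCoroot (D := D)) ?_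
  rintro _ ⟨j, rfl⟩
  exact h j

section Invariant

variable {b : LinearMap.BilinForm ℂ (ℂ ⊗[ℝ] g)}
  (hb : ∀ V W U : ℂ ⊗[ℝ] g, b V ⁅W, U⁆ + b W ⁅V, U⁆ = 0)

include hb

lemma bilin_tC_rootVector {f : Fin c.rank → ℤ} {x : ℂ ⊗[ℝ] g} (hx : x ∈ D.rootVectors f)
    (H : D.tC) : b H x = 0 := by
  have h : ∀ H H' : D.tC, D.eval f H' * b H x + D.eval f H * b H' x = 0 := by
    intro H H'
    have h1 := hb H H' x
    rwa [lie_rootVector hx, lie_rootVector hx, map_smul, map_smul, smul_eq_mul,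
      smul_eq_mul] at h1
  by_cases hH : D.eval f H = 0
  · obtain ⟨H', hH'⟩ := exists_eval_ne_zero (D := D) (ne_zero_of_mem_rootVectors hx)
    have h1 := h H H'
    rw [hH, zero_mul, add_zero] at h1
    exact (mul_eq_zero.1 h1).resolve_left hH'
  · have h1 := h H H
    have h2 : D.eval f H * b H x = 0 := by linear_combination h1 / 2
    exact (mul_eq_zero.1 h2).resolve_left hH

lemma bilin_rootVectors {f f' : Fin c.rank → ℤ} {x y : ℂ ⊗[ℝ] g}
    (hx : x ∈ D.rootVectors f) (hy : y ∈ D.rootVectors f') (h0 : f + f' ≠ 0) : b x y = 0 := by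
  obtain ⟨H, hH⟩ := exists_eval_ne_zero (D := D) (ne_zero_of_mem_rootVectors hy)
  have h1 := hb x H y
  have h2 : b H ⁅x, y⁆ = 0 := by
    by_cases h : ⁅x, y⁆ = 0
    · rw [h, map_zero]
    · exact bilin_tC_rootVector hb (lie_mem_rootVectors hx hy h0 h) H
  rw [h2, add_zero, lie_rootVector hy, map_smul, smul_eq_mul] at h1
  exact (mul_eq_zero.1 h1).resolve_left hH

lemma bilin_rootVector_tC {f : Fin c.rank → ℤ} {x : ℂ ⊗[ℝ] g} (hx : x ∈ D.rootVectors f)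
    (H : D.tC) : b x H = 0 := by
  suffices h : b x ∘ₗ D.tC.toSubmodule.subtype = 0 from LinearMap.congr_fun h H
  refine linearMap_tC_eq_zero (D := D) _ fun j => ?_
  obtain ⟨e, he, y, hy, ht⟩ := (hasCoeffs_simpleRoot (D := D) j).exists_isSl2Triple
  change b x ((D.simpleCoroot j : D.tC) : ℂ ⊗[ℝ] g) = 0
  have hh : ⁅e, y⁆ = ((D.simpleCoroot j : D.tC) : ℂ ⊗[ℝ] g) := ht.lie_e_f
  rw [← hh]
  by_cases hf : f = Pi.single j 1
  · subst hf
    obtain ⟨t, rfl⟩ := exists_eq_smul hx he ht.e_ne_zero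
    have h1 := hb e e y
    rw [LinearMap.map_smul, LinearMap.smul_apply, smul_eq_mul]
    linear_combination t * h1 / 2
  · have h1 := hb x e y
    have h2 : b e ⁅x, y⁆ = 0 := by
      by_cases h : ⁅x, y⁆ = 0
      · rw [h, map_zero]
      · refine bilin_rootVectors hb he (lie_mem_rootVectors hx hy (fun h3 => hf ?_) h) ?_
        · exact add_neg_eq_zero.1 h3
        · rw [add_comm f, add_neg_cancel_left]
          exact ne_zero_of_mem_rootVectors hx
    rwa [h2, add_zero] at h1

/-- The forms `b` with `b(V, [W, U])` alternating in `V` and `W` are the multiples of the Killing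
form. -/
lemma exists_eq_smul_killingForm (D : PaintedRootDatum c g) :
    ∃ r : ℂ, b = r • killingForm ℂ (ℂ ⊗[ℝ] g) := by
  set κ := killingForm ℂ (ℂ ⊗[ℝ] g) with hκ
  have hκn : ∀ x, (∀ y, κ x y = 0) → x = 0 := fun x hx => by
    have h1 : x ∈ LinearMap.ker κ := LinearMap.mem_ker.2 (LinearMap.ext hx)
    rwa [hκ, ker_killingForm_eq_bot, Submodule.mem_bot] at h1
  choose e he y hy ht using fun j => (hasCoeffs_simpleRoot (D := D) j).exists_isSl2Triple
  have hh : ∀ j, ⁅e j, y j⁆ = ((D.simpleCoroot j : D.tC) : ℂ ⊗[ℝ] g) := fun j => (ht j).lie_e_f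
  have h0 : ∀ j, κ (e j) (y j) ≠ 0 := by
    intro j h
    have h1 : ⁅e j, y j⁆ = 0 := by
      refine hκn _ fun x => ?_
      rw [hh]
      suffices h2 : κ ((D.simpleCoroot j : D.tC) : ℂ ⊗[ℝ] g) = 0 from LinearMap.congr_fun h2 x
      refine linearMap_eq_zero (D := D) _ (fun H => ?_) fun f x hx => killingForm_tC_rootVector hx _
      rw [hκ, killingForm_comm, ← hh, ← killingForm_lie, lie_rootVector (he j), map_smul,
        LinearMap.smul_apply, ← hκ, h, smul_zero]
    have h2 := (ht j).lie_h_e_smul ℂ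
    have h3 := (ht j).lie_e_f
    rw [← h3, h1, zero_lie] at h2
    exact (ht j).e_ne_zero ((smul_eq_zero.1 h2.symm).resolve_left two_ne_zero)
  -- `b` and `κ` are proportional on each simple root vector, by the vanishing of `b` elsewhere
  let r : Fin c.rank → ℂ := fun j => b (e j) (y j) / κ (e j) (y j)
  have h1 : ∀ j, b (e j) = r j • κ (e j) := by
    intro j
    rw [← sub_eq_zero]
    refine linearMap_eq_zero (D := D) _ (fun H => ?_) fun f x hx => ?_
    · rw [LinearMap.sub_apply, LinearMap.smul_apply, bilin_rootVector_tC hb (he j) H, hκ,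
        killingForm_comm, killingForm_tC_rootVector (he j), smul_zero, sub_zero]
    · rw [LinearMap.sub_apply, LinearMap.smul_apply]
      by_cases hf : Pi.single j 1 + f = 0
      · obtain rfl : f = -Pi.single j 1 := (neg_eq_of_add_eq_zero_right hf).symm
        obtain ⟨t, rfl⟩ := exists_eq_smul hx (hy j) (ht j).f_ne_zero
        rw [map_smul, map_smul, smul_eq_mul, smul_eq_mul, smul_eq_mul]
        have := h0 j
        simp only [r]
        field_simp
        ring
      · rw [bilin_rootVectors hb (he j) hx hf, hκ, killingForm_rootVectors (he j) hx hf, smul_zero,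
          sub_zero]
  -- for adjacent nodes, alternation applied to `[eᵢ, eⱼ] ≠ 0` gives the same factor
  have h2 : ∀ i j, r i = r j := by
    refine TypeIIb3.eq_of_forall_cartan_neg r fun i j hij => ?_
    have h3 : ⁅e j, e i⁆ ≠ 0 := by
      refine lie_ne_zero (he i) (ht i).e_ne_zero ?_ (ht j) rfl
      rwa [TypeIIb3.pairing_single]
    by_contra h4
    refine h3 (hκn _ fun x => ?_)
    have h5 := hb (e i) (e j) x
    rw [h1, h1, LinearMap.smul_apply, LinearMap.smul_apply, hκ, ← killingForm_lie,
      ← killingForm_lie, ← lie_skew, ← hκ, map_neg, LinearMap.neg_apply, smul_eq_mul,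
      smul_eq_mul] at h5
    have h6 : (r j - r i) * κ ⁅e j, e i⁆ x = 0 := by linear_combination h5
    exact (mul_eq_zero.1 h6).resolve_left (sub_ne_zero.2 (Ne.symm h4))
  refine ⟨r c.node, ?_⟩
  rw [← sub_eq_zero]
  -- the difference `b'` has the same property as `b`, and vanishes on the simple root vectors
  set b' := b - r c.node • κ with hb'
  have hb1 : ∀ V W U : ℂ ⊗[ℝ] g, b' V ⁅W, U⁆ + b' W ⁅V, U⁆ = 0 := by
    intro V W U
    have h3 := hb V W U
    have h4 : κ V ⁅W, U⁆ + κ W ⁅V, U⁆ = 0 := by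
      rw [hκ, ← killingForm_lie, ← killingForm_lie, ← lie_skew, map_neg, LinearMap.neg_apply,
        neg_add_cancel]
    simp only [hb', LinearMap.sub_apply, LinearMap.smul_apply, smul_eq_mul]
    linear_combination h3 - r c.node * h4
  have h3 : ∀ H : D.tC, b' H = 0 := by
    intro H
    refine linearMap_eq_zero (D := D) _ (fun H' => ?_) fun f x hx => bilin_tC_rootVector hb1 hx H
    suffices h : b' H ∘ₗ D.tC.toSubmodule.subtype = 0 from LinearMap.congr_fun h H'
    refine linearMap_tC_eq_zero (D := D) _ fun j => ?_
    change b' H ((D.simpleCoroot j : D.tC) : ℂ ⊗[ℝ] g) = 0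
    have h4 := hb1 H (e j) (y j)
    have h5 : b' (e j) = 0 := by
      rw [hb', LinearMap.sub_apply, LinearMap.smul_apply, h1, h2 j c.node, sub_self]
    rwa [h5, LinearMap.zero_apply, add_zero, hh] at h4
  refine linearMap_eq_zero (D := D) _ h3 fun f x hx => ?_
  refine linearMap_eq_zero (D := D) _ (bilin_rootVector_tC hb1 hx) fun f' z hz => ?_
  obtain ⟨H, hH⟩ := exists_eval_ne_zero (D := D) (ne_zero_of_mem_rootVectors hz)
  have h4 := hb1 x H z
  rw [h3, LinearMap.zero_apply, add_zero, lie_rootVector hz, map_smul, smul_eq_mul] at h4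
  exact (mul_eq_zero.1 h4).resolve_left hH

end Invariant

end PaintedRootDatum

/-! ### The complexified summands -/

namespace PaintedRootDatum

open LieAlgebra LieAlgebra.IsKilling LieModule

variable {c : TypeIIb3} {g : Type*} [LieRing g] [LieAlgebra ℝ g]
  [Module.Finite ℝ g] [LieAlgebra.IsKilling ℝ g] (D : PaintedRootDatum c g)

/-- The intersections of the complexified summands with `𝔱^ℂ`. -/
def torusPart : Fin 6 → Submodule ℂ D.tC :=
  ![⨅ (j : Fin c.rank) (_ : j ≠ c.node),
      LinearMap.ker ((rootSystem D.tC).root (D.simpleRoot j)),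
    Submodule.span ℂ (D.simpleCoroot '' c.nodes₁),
    Submodule.span ℂ (D.simpleCoroot '' c.nodes₂), ⊥, ⊥, ⊥]

variable (c) in
/-- The condition on the coefficients of a root for its root space to be part of the `i`-th
complexified summand. -/
def InSummand : Fin 6 → (Fin c.rank → ℤ) → Prop :=
  ![fun _ => False, fun f => ∀ j, j ∉ c.nodes₁ → f j = 0, fun f => ∀ j, j ∉ c.nodes₂ → f j = 0,
    fun f => |f c.node| = (1 : ℕ), fun f => |f c.node| = (2 : ℕ), fun f => |f c.node| = (3 : ℕ)]

/-- The complex subspaces of `𝔤^ℂ` whose real points are the summands of the decomposition. -/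
def summandC (i : Fin 6) : Submodule ℂ (ℂ ⊗[ℝ] g) :=
  Submodule.map D.tC.toSubmodule.subtype (D.torusPart i) ⊔ D.rootSpaceSum (InSummand c i)

/-- The absolute values of the coefficients at the painted node. -/
def level : Fin 6 → ℕ := ![0, 0, 0, 1, 2, 3]

/-- The trilinear form `κ([V, W], U)` is not zero on the three given summands. -/
def Linked (i j k : Fin 6) : Prop :=
  ∃ V ∈ D.summandC i, ∃ W ∈ D.summandC j, ∃ U ∈ D.summandC k,
    killingForm ℂ (ℂ ⊗[ℝ] g) ⁅V, W⁆ U ≠ 0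

variable {D}

lemma rootSpaceSum_false : D.rootSpaceSum (fun _ => False) = ⊥ := by
  simp [rootSpaceSum]

lemma realPoints_summandC (i : Fin 6) : realPoints (D.summandC i) = D.summand i := by
  fin_cases i
  · change realPoints (_ ⊔ D.rootSpaceSum fun _ => False) = _
    rw [rootSpaceSum_false, sup_bot_eq]
    rfl
  · rfl
  · rfl
  all_goals
    change realPoints (Submodule.map _ ⊥ ⊔ _) = _
    rw [Submodule.map_bot, bot_sup_eq]
    rfl

lemma mem_summandC_of_mem_torusPart {i : Fin 6} {H : D.tC} (hH : H ∈ D.torusPart i) :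
    (H : ℂ ⊗[ℝ] g) ∈ D.summandC i :=
  Submodule.mem_sup_left ⟨H, hH, rfl⟩

lemma mem_summandC_of_mem_rootVectors {i : Fin 6} {f : Fin c.rank → ℤ} {x : ℂ ⊗[ℝ] g}
    (hf : InSummand c i f) (hx : x ∈ D.rootVectors f) : x ∈ D.summandC i := by
  obtain ⟨α, hα, hx⟩ := hx
  exact Submodule.mem_sup_right (Submodule.mem_iSup_of_mem α
    (Submodule.mem_iSup_of_mem ⟨f, hα, hf⟩ hx))

/-- To vanish on a summand, it suffices for a linear map to vanish on its intersection with `𝔱^ℂ`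
and on its root vectors. -/
lemma linearMap_summandC_eq_zero {N : Type*} [AddCommGroup N] [Module ℂ N]
    (φ : (ℂ ⊗[ℝ] g) →ₗ[ℂ] N) {i : Fin 6} (h0 : ∀ H ∈ D.torusPart i, φ (H : ℂ ⊗[ℝ] g) = 0)
    (h1 : ∀ f, InSummand c i f → ∀ x ∈ D.rootVectors f, φ x = 0) {x : ℂ ⊗[ℝ] g}
    (hx : x ∈ D.summandC i) : φ x = 0 := by
  suffices h : D.summandC i ≤ LinearMap.ker φ from h hx
  refine sup_le ?_ (iSup₂_le fun α hα y hy => ?_)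
  · rintro _ ⟨H, hH, rfl⟩
    exact h0 H hH
  · obtain ⟨f, hf, hi⟩ := hα
    exact h1 f hi y ⟨α, hf, hy⟩

/-- Two summands commute if their generators do. -/
lemma lie_summandC_eq_zero {i j : Fin 6}
    (h₀₁ : ∀ H ∈ D.torusPart i, ∀ f, InSummand c j f → ∀ y ∈ D.rootVectors f,
      ⁅(H : ℂ ⊗[ℝ] g), y⁆ = 0)
    (h₁₀ : ∀ H ∈ D.torusPart j, ∀ f, InSummand c i f → ∀ x ∈ D.rootVectors f,
      ⁅(H : ℂ ⊗[ℝ] g), x⁆ = 0)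
    (h₁₁ : ∀ f, InSummand c i f → ∀ x ∈ D.rootVectors f, ∀ f', InSummand c j f' →
      ∀ y ∈ D.rootVectors f', ⁅x, y⁆ = 0)
    {x y : ℂ ⊗[ℝ] g} (hx : x ∈ D.summandC i) (hy : y ∈ D.summandC j) : ⁅x, y⁆ = 0 := by
  refine linearMap_summandC_eq_zero (ad ℂ _ x) (fun H hH => ?_) (fun f' hf' y hy => ?_) hy
  · change ⁅x, (H : ℂ ⊗[ℝ] g)⁆ = 0
    rw [← lie_skew, neg_eq_zero]
    exact linearMap_summandC_eq_zero (ad ℂ (ℂ ⊗[ℝ] g) H) (fun H' _ => lie_eq_zero_of_mem_tC _ _)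
      (h₁₀ H hH) hx
  · change ⁅x, y⁆ = 0
    rw [← lie_skew, neg_eq_zero]
    refine linearMap_summandC_eq_zero (ad ℂ (ℂ ⊗[ℝ] g) y) (fun H hH => ?_) (fun f hf x hx => ?_) hx
    · change ⁅y, (H : ℂ ⊗[ℝ] g)⁆ = 0
      rw [← lie_skew, neg_eq_zero]
      exact h₀₁ H hH f' hf' y hy
    · change ⁅y, x⁆ = 0
      rw [← lie_skew, neg_eq_zero]
      exact h₁₁ f hf x hx f' hf' y hy

lemma eval_eq_of_mem_torusPart_zero {H : D.tC} (hH : H ∈ D.torusPart 0) (f : Fin c.rank → ℤ) :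
    D.eval f H = f c.node * (rootSystem D.tC).root (D.simpleRoot c.node) H := by
  have h1 : ∀ j ≠ c.node, (rootSystem D.tC).root (D.simpleRoot j) H = 0 := fun j hj =>
    LinearMap.mem_ker.1 ((Submodule.mem_iInf _).1 ((Submodule.mem_iInf _).1 hH j) hj)
  rw [eval, LinearMap.sum_apply, Finset.sum_eq_single c.node]
  · rw [LinearMap.smul_apply, zsmul_eq_mul]
  · intro j _ hj
    rw [LinearMap.smul_apply, h1 j hj, smul_zero]
  · simp

lemma eval_eq_zero_of_mem_span {S : Finset (Fin c.rank)} {H : D.tC}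
    (hH : H ∈ Submodule.span ℂ (D.simpleCoroot '' S)) {f : Fin c.rank → ℤ}
    (hf : ∀ j ∈ S, c.pairing f j = 0) : D.eval f H = 0 := by
  suffices h : Submodule.span ℂ (D.simpleCoroot '' S) ≤ LinearMap.ker (D.eval f) from h hH
  rw [Submodule.span_le]
  rintro _ ⟨j, hj, rfl⟩
  change D.eval f _ = 0
  rw [eval_simpleCoroot, hf j hj, Int.cast_zero]

lemma form_eq_zero {S : Finset (Fin c.rank)} {f : Fin c.rank → ℤ} (h0 : ∀ j ∉ S, f j = 0)
    (h1 : ∀ j ∈ S, c.pairing f j = 0) : c.form f = 0 := by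
  refine Finset.sum_eq_zero fun j _ => ?_
  by_cases hj : j ∈ S
  · rw [h1 j hj, mul_zero]
  · rw [h0 j hj, mul_zero, zero_mul]

/-- The centre of `𝔨` commutes with the root vectors with coefficient `0` at the painted node. -/
lemma lie_summandC_zero {H : D.tC} (hH : H ∈ D.torusPart 0) {f : Fin c.rank → ℤ}
    (hf : f c.node = 0) {x : ℂ ⊗[ℝ] g} (hx : x ∈ D.rootVectors f) :
    ⁅(H : ℂ ⊗[ℝ] g), x⁆ = 0 := by
  rw [lie_rootVector hx, eval_eq_of_mem_torusPart_zero hH, hf, Int.cast_zero, zero_mul, zero_smul]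

/-- Root vectors commute if the first root `α` is supported on a set `S` of nodes, and the second
root `β` is orthogonal to `S`, provided that a root `α + β` would be orthogonal to `S` as well: then
so would be `α`. -/
lemma lie_rootVectors_eq_zero {S : Finset (Fin c.rank)} {f f' : Fin c.rank → ℤ} {x y : ℂ ⊗[ℝ] g}
    (hx : x ∈ D.rootVectors f) (hy : y ∈ D.rootVectors f') (hf : ∀ j ∉ S, f j = 0)
    (hf' : ∀ j ∈ S, c.pairing f' j = 0) (h0 : f + f' ≠ 0)
    (h : c.form (f + f') ≤ c.maxForm → ∀ j ∈ S, c.pairing (f + f') j = 0) : ⁅x, y⁆ = 0 := by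
  by_contra hxy
  have h1 := lie_mem_rootVectors hx hy h0 hxy
  have h2 := h (form_le_of_mem_rootVectors h1)
  have h3 : ∀ j ∈ S, c.pairing f j = 0 := fun j hj => by
    have := h2 j hj
    rwa [TypeIIb3.pairing_add, hf' j hj, add_zero] at this
  exact (form_pos_of_mem_rootVectors hx).ne' (form_eq_zero hf h3)

/-- Pairs of summands that commute. The proposition `P` stands for the condition that the diagram is
not `E₇(3)`. -/
def Commuting (P : Prop) (i j : Fin 6) : Prop :=
  (i, j) = (0, 1) ∨ (i, j) = (0, 2) ∨ (i, j) = (1, 2) ∨ (i, j) = (2, 5) ∨ (P ∧ (i, j) = (1, 4))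

instance (P : Prop) [Decidable P] (i j : Fin 6) : Decidable (Commuting P i j) :=
  inferInstanceAs (Decidable (_ ∨ _))

/-- The ideal of `𝔨` defined by a set `S` of nodes commutes with a summand `𝔭ₘ` if all the roots of
level `m` are orthogonal to `S`. -/
lemma lie_ideal_summandC {i k : Fin 6} {m : ℕ} {S : Finset (Fin c.rank)} (hS : c.node ∉ S)
    (hi : D.torusPart i = Submodule.span ℂ (D.simpleCoroot '' S))
    (hi' : ∀ f, InSummand c i f → ∀ j ∉ S, f j = 0)
    (hk : D.torusPart k = ⊥) (hk' : ∀ f, InSummand c k f → |f c.node| = m) (hm : m ≠ 0)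
    (h : ∀ f : Fin c.rank → ℤ, c.form f ≤ c.maxForm → |f c.node| = m →
      ∀ j ∈ S, c.pairing f j = 0)
    {x y : ℂ ⊗[ℝ] g} (hx : x ∈ D.summandC i) (hy : y ∈ D.summandC k) : ⁅x, y⁆ = 0 := by
  refine lie_summandC_eq_zero (fun H hH f' hf' y hy => ?_) (fun H hH f hf x hx => ?_)
    (fun f hf x hx f' hf' y hy => ?_) hx hy
  · rw [lie_rootVector hy, eval_eq_zero_of_mem_span (hi ▸ hH)
      (h f' (form_le_of_mem_rootVectors hy) (hk' f' hf')), zero_smul]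
  · rw [hk, Submodule.mem_bot] at hH
    rw [hH, ZeroMemClass.coe_zero, zero_lie]
  · have hn : (f + f') c.node = f' c.node := by
      rw [Pi.add_apply, hi' f hf _ hS, zero_add]
    refine lie_rootVectors_eq_zero hx hy (hi' f hf) (h f' (form_le_of_mem_rootVectors hy)
      (hk' f' hf')) (fun h0 => ?_) fun hle => ?_
    · have h1 := hk' f' hf'
      rw [← hn, h0, Pi.zero_apply, abs_zero] at h1
      omega
    · exact h _ hle (by rw [hn]; exact hk' f' hf')

lemma pairing_eq_zero_of_support {S S' : Finset (Fin c.rank)}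
    (h : ∀ i ∈ S', ∀ j ∈ S, c.cartan i j = 0) {f : Fin c.rank → ℤ}
    (hf : ∀ j ∉ S', f j = 0) : ∀ j ∈ S, c.pairing f j = 0 := by
  intro j hj
  refine Finset.sum_eq_zero fun i _ => ?_
  by_cases hi : i ∈ S'
  · rw [h i hi j hj, mul_zero]
  · rw [hf i hi, zero_mul]

lemma lie_nodes₁_nodes₂ {x y : ℂ ⊗[ℝ] g} (hx : x ∈ D.summandC 1) (hy : y ∈ D.summandC 2) :
    ⁅x, y⁆ = 0 := by
  have hS1 : ∀ f : Fin c.rank → ℤ, (∀ j ∉ c.nodes₁, f j = 0) → ∀ j ∈ c.nodes₂, c.pairing f j = 0 :=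
    fun f => pairing_eq_zero_of_support fun i hi j hj => (c.cartan_nodes₁_nodes₂ i hi j hj).1
  have hS2 : ∀ f : Fin c.rank → ℤ, (∀ j ∉ c.nodes₂, f j = 0) → ∀ j ∈ c.nodes₁, c.pairing f j = 0 :=
    fun f => pairing_eq_zero_of_support fun i hi j hj => (c.cartan_nodes₁_nodes₂ j hj i hi).2
  refine lie_summandC_eq_zero (fun H hH f' hf' y hy => ?_) (fun H hH f hf x hx => ?_)
    (fun f hf x hx f' hf' y hy => ?_) hx hy
  · rw [lie_rootVector hy, eval_eq_zero_of_mem_span hH (hS2 f' hf'), zero_smul]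
  · rw [lie_rootVector hx, eval_eq_zero_of_mem_span hH (hS1 f hf), zero_smul]
  · have hf : ∀ j ∉ c.nodes₁, f j = 0 := hf
    have hf' : ∀ j ∉ c.nodes₂, f' j = 0 := hf'
    have h0 : f c.node = 0 := hf _ c.node_notMem_nodes₁
    have h0' : f' c.node = 0 := hf' _ c.node_notMem_nodes₂
    have hne : ∀ j ∈ c.nodes₁, (f + f') j = f j := fun j hj => by
      rw [Pi.add_apply, hf' j (TypeIIb3.notMem_nodes₂ hj), add_zero]
    have hne' : ∀ j ∈ c.nodes₂, (f + f') j = f' j := fun j hj => by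
      rw [Pi.add_apply, hf j (fun h => TypeIIb3.notMem_nodes₂ h hj), zero_add]
    have hz : (∀ j ∈ c.nodes₁, f j = 0) → False := fun h =>
      ne_zero_of_mem_rootVectors hx (funext fun j => by
        by_cases hj : j ∈ c.nodes₁
        exacts [h j hj, hf j hj])
    have hz' : (∀ j ∈ c.nodes₂, f' j = 0) → False := fun h =>
      ne_zero_of_mem_rootVectors hy (funext fun j => by
        by_cases hj : j ∈ c.nodes₂
        exacts [h j hj, hf' j hj])
    by_contra h
    have h1 := lie_mem_rootVectors hx hy (fun h2 => hz fun j hj => by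
      rw [← hne j hj, h2, Pi.zero_apply]) h
    rcases TypeIIb3.support_subset (form_le_of_mem_rootVectors h1)
      (by rw [Pi.add_apply, h0, h0', add_zero]) with h2 | h2
    · exact hz' fun j hj => by rw [← hne' j hj, h2 j hj]
    · exact hz fun j hj => by rw [← hne j hj, h2 j hj]

lemma lie_torusPart_zero {i : Fin 6} (hi : ∀ f, InSummand c i f → f c.node = 0)
    {x y : ℂ ⊗[ℝ] g} (hx : x ∈ D.summandC 0) (hy : y ∈ D.summandC i) : ⁅x, y⁆ = 0 :=
  lie_summandC_eq_zero (fun _ hH f' hf' _ hy => lie_summandC_zero hH (hi f' hf') hy)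
    (fun _ _ _ hf => False.elim hf) (fun _ hf => False.elim hf) hx hy

lemma Commuting.lie_eq_zero {i j : Fin 6} (h : Commuting (c ≠ TypeIIb3.E7_3) i j) {x y : ℂ ⊗[ℝ] g}
    (hx : x ∈ D.summandC i) (hy : y ∈ D.summandC j) : ⁅x, y⁆ = 0 := by
  rcases h with h | h | h | h | ⟨hc, h⟩ <;> obtain ⟨rfl, rfl⟩ := Prod.mk.inj h
  · exact lie_torusPart_zero (i := 1) (fun f (hf : ∀ j, j ∉ c.nodes₁ → f j = 0) =>
      hf _ c.node_notMem_nodes₁) hx hy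
  · exact lie_torusPart_zero (i := 2) (fun f (hf : ∀ j, j ∉ c.nodes₂ → f j = 0) =>
      hf _ c.node_notMem_nodes₂) hx hy
  · exact lie_nodes₁_nodes₂ hx hy
  · exact lie_ideal_summandC (i := 2) (k := 5) (m := 3) c.node_notMem_nodes₂ rfl
      (fun f hf => hf) rfl
      (fun f hf => hf) (by norm_num) (fun f hf h => TypeIIb3.pairing_nodes₂_eq_zero hf h) hx hy
  · exact lie_ideal_summandC (i := 1) (k := 4) (m := 2) c.node_notMem_nodes₁ rfl
      (fun f hf => hf) rfl
      (fun f hf => hf) (by norm_num) (fun f hf h => TypeIIb3.pairing_nodes₁_eq_zero hc hf h) hx hy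

/-! ### Vanishing and nonvanishing of the trilinear form on the summands -/

/-- The fundamental coweight of the painted node spans the centre of `𝔨^ℂ`. Together with the other
simple coroots it spans `𝔱^ℂ`. -/
lemma exists_fundamentalCoweight (D : PaintedRootDatum c g) :
    ∃ Z ∈ D.torusPart 0, (∀ f, D.eval f Z = f c.node) ∧
      D.simpleCoroot c.node ∈
        Submodule.span ℂ {Z} ⊔ Submodule.span ℂ (D.simpleCoroot '' {c.node}ᶜ) := by
  obtain ⟨m, d, hd, hm, h⟩ := c.exists_coweight
  have hd' : (d : ℂ) ≠ 0 := by exact_mod_cast hd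
  have hm' : (m c.node : ℂ) ≠ 0 := by exact_mod_cast hm
  let Z : D.tC := (d : ℂ)⁻¹ • ∑ j, (m j : ℂ) • D.simpleCoroot j
  have hZ : ∀ k, (rootSystem D.tC).root (D.simpleRoot k) Z = if k = c.node then 1 else 0 := by
    intro k
    have h1 : ∑ j, (m j : ℂ) * (c.cartan k j : ℂ) = if k = c.node then (d : ℂ) else 0 := by
      have := congrArg (Int.cast : ℤ → ℂ) (h k)
      push_cast at this
      rw [this]
    simp only [Z, map_smul, map_sum, simpleRoot_simpleCoroot, smul_eq_mul]
    rw [h1]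
    split_ifs
    · exact inv_mul_cancel₀ hd'
    · exact mul_zero _
  have hZ0 : Z ∈ D.torusPart 0 := by
    refine (Submodule.mem_iInf _).2 fun j => (Submodule.mem_iInf _).2 fun hj => ?_
    rw [LinearMap.mem_ker, hZ, if_neg hj]
  refine ⟨Z, hZ0, fun f => ?_, ?_⟩
  · rw [eval_eq_of_mem_torusPart_zero hZ0, hZ, if_pos rfl, mul_one]
  · have h1 : (d : ℂ) • Z = (m c.node : ℂ) • D.simpleCoroot c.node +
        ∑ j ∈ Finset.univ.erase c.node, (m j : ℂ) • D.simpleCoroot j := by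
      rw [Finset.add_sum_erase _ (fun j => (m j : ℂ) • D.simpleCoroot j) (Finset.mem_univ _)]
      simp only [Z]
      rw [smul_inv_smul₀ hd']
    have h2 : D.simpleCoroot c.node = (m c.node : ℂ)⁻¹ • ((d : ℂ) • Z -
        ∑ j ∈ Finset.univ.erase c.node, (m j : ℂ) • D.simpleCoroot j) := by
      rw [h1, add_sub_cancel_right, inv_smul_smul₀ hm']
    rw [h2]
    refine Submodule.smul_mem _ _ (Submodule.sub_mem _ (Submodule.mem_sup_left
      (Submodule.smul_mem _ _ (Submodule.mem_span_singleton_self Z)))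
      (Submodule.mem_sup_right (Submodule.sum_mem _ fun j hj => Submodule.smul_mem _ _
        (Submodule.subset_span ⟨j, ?_, rfl⟩))))
    exact (Finset.mem_erase.1 hj).1

lemma InSummand.abs_eq_level {i : Fin 6} {f : Fin c.rank → ℤ} (h : InSummand c i f) :
    |f c.node| = level i := by
  fin_cases i
  · exact False.elim h
  · have h0 : f c.node = 0 := h _ c.node_notMem_nodes₁
    rw [h0]; rfl
  · have h0 : f c.node = 0 := h _ c.node_notMem_nodes₂
    rw [h0]; rfl
  all_goals exact h

/-- The summands are sums of eigenspaces for the fundamental coweight. -/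
lemma linearMap_eq_zero_of_eigenvectors {N : Type*} [AddCommGroup N] [Module ℂ N] {i : Fin 6}
    {Z : D.tC} (hZ : ∀ f, D.eval f Z = f c.node) (φ : (ℂ ⊗[ℝ] g) →ₗ[ℂ] N)
    (h : ∀ n : ℤ, |n| = level i → ∀ x, ⁅(Z : ℂ ⊗[ℝ] g), x⁆ = (n : ℂ) • x → φ x = 0)
    {x : ℂ ⊗[ℝ] g} (hx : x ∈ D.summandC i) : φ x = 0 := by
  refine linearMap_summandC_eq_zero φ (fun H hH => ?_) (fun f hf x hx => ?_) hx
  · by_cases hi : level i = 0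
    · refine h 0 (by rw [hi]; rfl) _ ?_
      rw [Int.cast_zero, zero_smul, lie_eq_zero_of_mem_tC]
    · have h0 : D.torusPart i = ⊥ := by
        fin_cases i
        exacts [absurd rfl hi, absurd rfl hi, absurd rfl hi, rfl, rfl, rfl]
      rw [h0, Submodule.mem_bot] at hH
      rw [hH, ZeroMemClass.coe_zero, map_zero]
  · exact h (f c.node) hf.abs_eq_level x (by rw [lie_rootVector hx, hZ])

lemma killingForm_lie_rotate {R L : Type*} [CommRing R] [LieRing L] [LieAlgebra R L] (x y z : L) :
    killingForm R L ⁅x, y⁆ z = killingForm R L ⁅y, z⁆ x := by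
  rw [killingForm_lie, killingForm_comm]

lemma killingForm_lie_swap {R L : Type*} [CommRing R] [LieRing L] [LieAlgebra R L] (x y z : L) :
    killingForm R L ⁅y, x⁆ z = -killingForm R L ⁅x, y⁆ z := by
  rw [← lie_skew, map_neg, LinearMap.neg_apply]

lemma killingForm_lie_eq_zero_of_level {i j k : Fin 6} (h₁ : level i ≠ level j + level k)
    (h₂ : level j ≠ level i + level k) (h₃ : level k ≠ level i + level j) {V W U : ℂ ⊗[ℝ] g}
    (hV : V ∈ D.summandC i) (hW : W ∈ D.summandC j) (hU : U ∈ D.summandC k) :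
    killingForm ℂ (ℂ ⊗[ℝ] g) ⁅V, W⁆ U = 0 := by
  obtain ⟨Z, -, hZ, -⟩ := exists_fundamentalCoweight D
  refine linearMap_eq_zero_of_eigenvectors hZ (killingForm ℂ (ℂ ⊗[ℝ] g) ⁅V, W⁆)
    (fun n hn U hU => ?_) hU
  rw [killingForm_lie_rotate]
  refine linearMap_eq_zero_of_eigenvectors hZ (killingForm ℂ (ℂ ⊗[ℝ] g) ⁅W, U⁆)
    (fun l hl V hV => ?_) hV
  rw [killingForm_lie_rotate]
  refine linearMap_eq_zero_of_eigenvectors hZ (killingForm ℂ (ℂ ⊗[ℝ] g) ⁅U, V⁆)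
    (fun m hm W hW => ?_) hW
  rw [killingForm_lie_rotate]
  have h4 : killingForm ℂ (ℂ ⊗[ℝ] g) ⁅(Z : ℂ ⊗[ℝ] g), ⁅V, W⁆⁆ U =
      -killingForm ℂ (ℂ ⊗[ℝ] g) ⁅V, W⁆ ⁅(Z : ℂ ⊗[ℝ] g), U⁆ := by
    rw [← killingForm_lie, ← killingForm_lie_swap]
  have h5 : ⁅(l : ℂ) • V, W⁆ = (l : ℂ) • ⁅V, W⁆ := by
    rw [← lie_skew, lie_smul, ← smul_neg, lie_skew]
  have h6 : ⁅V, (m : ℂ) • W⁆ = (m : ℂ) • ⁅V, W⁆ := (ad ℂ (ℂ ⊗[ℝ] g) V).map_smul _ W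
  rw [leibniz_lie, hV, hW, hU, h5, h6, map_add, map_smul, map_smul, map_smul,
    LinearMap.add_apply, LinearMap.smul_apply, LinearMap.smul_apply, smul_eq_mul, smul_eq_mul,
    smul_eq_mul] at h4
  have h7 : ((l + m + n : ℤ) : ℂ) * killingForm ℂ (ℂ ⊗[ℝ] g) ⁅V, W⁆ U = 0 := by
    push_cast
    linear_combination h4
  refine (mul_eq_zero.1 h7).resolve_left fun h8 => ?_
  have h9 : l + m + n = 0 := by exact_mod_cast h8
  rcases abs_cases l with hl' | hl' <;> rcases abs_cases m with hm' | hm' <;>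
    rcases abs_cases n with hn' | hn' <;> omega

lemma killingForm_lie_eq_zero_of_commuting {i j k : Fin 6}
    (h : (Commuting (c ≠ TypeIIb3.E7_3) i j ∨ Commuting (c ≠ TypeIIb3.E7_3) j i) ∨
      (Commuting (c ≠ TypeIIb3.E7_3) j k ∨ Commuting (c ≠ TypeIIb3.E7_3) k j) ∨
      (Commuting (c ≠ TypeIIb3.E7_3) i k ∨ Commuting (c ≠ TypeIIb3.E7_3) k i)) {V W U : ℂ ⊗[ℝ] g}
    (hV : V ∈ D.summandC i) (hW : W ∈ D.summandC j) (hU : U ∈ D.summandC k) :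
    killingForm ℂ (ℂ ⊗[ℝ] g) ⁅V, W⁆ U = 0 := by
  have key : ∀ {i j : Fin 6},
      (Commuting (c ≠ TypeIIb3.E7_3) i j ∨ Commuting (c ≠ TypeIIb3.E7_3) j i) →
      ∀ {x y : ℂ ⊗[ℝ] g}, x ∈ D.summandC i → y ∈ D.summandC j → ⁅x, y⁆ = 0 := by
    rintro i j (h | h) x y hx hy
    · exact h.lie_eq_zero hx hy
    · rw [← lie_skew, h.lie_eq_zero hy hx, neg_zero]
  rcases h with h | h | h
  · rw [key h hV hW, map_zero, LinearMap.zero_apply]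
  · rw [killingForm_lie, key h hW hU, map_zero]
  · rw [killingForm_lie_rotate, killingForm_lie_rotate, ← lie_skew, key h hV hU, neg_zero, map_zero,
      LinearMap.zero_apply]

lemma killingForm_simpleCoroot {H : D.tC} {j : Fin c.rank}
    (h : (rootSystem D.tC).root (D.simpleRoot j) H = 0) :
    killingForm ℂ (ℂ ⊗[ℝ] g) H (D.simpleCoroot j : D.tC) = 0 := by
  obtain ⟨e, he, y, hy, ht⟩ := (hasCoeffs_simpleRoot (D := D) j).exists_isSl2Triple
  have hh : ⁅e, y⁆ = ((D.simpleCoroot j : D.tC) : ℂ ⊗[ℝ] g) := ht.lie_e_f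
  have h0 : D.eval (Pi.single j 1) H = 0 := by
    rw [← h]
    exact (LinearMap.congr_fun (hasCoeffs_simpleRoot (D := D) j) H).symm
  rw [← hh, ← killingForm_lie, lie_rootVector he, h0, zero_smul, map_zero, LinearMap.zero_apply]

lemma killingForm_torusPart_span {S : Finset (Fin c.rank)} {H H' : D.tC}
    (hH : ∀ j ∈ S, (rootSystem D.tC).root (D.simpleRoot j) H = 0)
    (hH' : H' ∈ Submodule.span ℂ (D.simpleCoroot '' S)) :
    killingForm ℂ (ℂ ⊗[ℝ] g) H H' = 0 := by
  suffices h : Submodule.span ℂ (D.simpleCoroot '' S) ≤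
      LinearMap.ker (killingForm ℂ (ℂ ⊗[ℝ] g) H ∘ₗ D.tC.toSubmodule.subtype) from h hH'
  rw [Submodule.span_le]
  rintro _ ⟨j, hj, rfl⟩
  exact killingForm_simpleCoroot (hH j hj)

lemma killingForm_summandC_of_torusPart {i j : Fin 6} (h0 : ∀ f, InSummand c i f →
      ∀ f', InSummand c j f' → f ≠ 0 → f + f' ≠ 0)
    (h : ∀ H ∈ D.torusPart i, ∀ H' ∈ D.torusPart j,
      killingForm ℂ (ℂ ⊗[ℝ] g) (H : ℂ ⊗[ℝ] g) (H' : ℂ ⊗[ℝ] g) = 0) {x y : ℂ ⊗[ℝ] g}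
    (hx : x ∈ D.summandC i) (hy : y ∈ D.summandC j) : killingForm ℂ (ℂ ⊗[ℝ] g) x y = 0 := by
  refine linearMap_summandC_eq_zero (killingForm ℂ (ℂ ⊗[ℝ] g) x) (fun H hH => ?_)
    (fun f' hf' y hy => ?_) hy
  · rw [killingForm_comm]
    refine linearMap_summandC_eq_zero (killingForm ℂ (ℂ ⊗[ℝ] g) H) (fun H' hH' => ?_)
      (fun f hf x hx => killingForm_tC_rootVector hx H) hx
    rw [killingForm_comm]
    exact h H' hH' H hH
  · rw [killingForm_comm]
    refine linearMap_summandC_eq_zero (killingForm ℂ (ℂ ⊗[ℝ] g) y) (fun H hH => ?_)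
      (fun f hf x hx => ?_) hx
    · rw [killingForm_comm, killingForm_tC_rootVector hy]
    · rw [killingForm_comm]
      exact killingForm_rootVectors hx hy (h0 f hf f' hf' (ne_zero_of_mem_rootVectors hx))

/-- The complexified summands are mutually orthogonal. -/
lemma killingForm_summandC {i j : Fin 6} (hij : i ≠ j) {x y : ℂ ⊗[ℝ] g}
    (hx : x ∈ D.summandC i) (hy : y ∈ D.summandC j) : killingForm ℂ (ℂ ⊗[ℝ] g) x y = 0 := by
  wlog h : i < j generalizing i j x y
  · rw [killingForm_comm]
    exact this hij.symm hy hx (lt_of_le_of_ne (not_lt.1 h) hij.symm)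
  have hT : D.torusPart 3 = ⊥ ∧ D.torusPart 4 = ⊥ ∧ D.torusPart 5 = ⊥ := ⟨rfl, rfl, rfl⟩
  have hS : ∀ {S S' : Finset (Fin c.rank)} {f f' : Fin c.rank → ℤ}, (∀ j ∉ S, f j = 0) →
      (∀ j ∉ S', f' j = 0) → (∀ j ∈ S, j ∉ S') → f ≠ 0 → f + f' ≠ 0 := by
    intro S S' f f' hf hf' hSS hne h0
    refine hne (funext fun j => ?_)
    by_cases hj : j ∈ S
    · have h1 := congrFun h0 j
      rw [Pi.add_apply, hf' j (hSS j hj), add_zero] at h1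
      exact h1
    · exact hf j hj
  have hcase : (i = 0 ∧ j = 1) ∨ (i = 0 ∧ j = 2) ∨ (i = 1 ∧ j = 2) ∨
      (level i ≠ level j ∧ D.torusPart j = ⊥) := by
    obtain ⟨h3, h4, h5⟩ := hT
    have hd : ∀ i j : Fin 6, i < j → (i = 0 ∧ j = 1) ∨ (i = 0 ∧ j = 2) ∨ (i = 1 ∧ j = 2) ∨
      (level i ≠ level j ∧ (j = 3 ∨ j = 4 ∨ j = 5)) := by decide
    rcases hd i j h with h | h | h | ⟨h, rfl | rfl | rfl⟩ <;> simp_all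
  rcases hcase with ⟨rfl, rfl⟩ | ⟨rfl, rfl⟩ | ⟨rfl, rfl⟩ | ⟨hl, hj⟩
  · refine killingForm_summandC_of_torusPart (c := c) (i := 0) (j := 1) (fun f hf => False.elim hf)
      (fun H hH H' hH' => ?_) hx hy
    refine killingForm_torusPart_span (fun j hj => ?_) hH'
    refine LinearMap.mem_ker.1 ((Submodule.mem_iInf _).1 ((Submodule.mem_iInf _).1 hH j) ?_)
    rintro rfl
    exact c.node_notMem_nodes₁ hj
  · refine killingForm_summandC_of_torusPart (c := c) (i := 0) (j := 2) (fun f hf => False.elim hf)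
      (fun H hH H' hH' => ?_) hx hy
    refine killingForm_torusPart_span (fun j hj => ?_) hH'
    refine LinearMap.mem_ker.1 ((Submodule.mem_iInf _).1 ((Submodule.mem_iInf _).1 hH j) ?_)
    rintro rfl
    exact c.node_notMem_nodes₂ hj
  · refine killingForm_summandC_of_torusPart (i := 1) (j := 2)
      (fun f hf f' hf' => hS hf hf' fun j hj => TypeIIb3.notMem_nodes₂ hj) (fun H hH H' hH' => ?_)
      hx hy
    refine killingForm_torusPart_span (fun j hj => ?_) hH'
    have h1 := eval_eq_zero_of_mem_span hH (f := Pi.single j 1) fun i hi => by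
      rw [TypeIIb3.pairing_single]
      exact (c.cartan_nodes₁_nodes₂ i hi j hj).2
    rw [← h1]
    exact LinearMap.congr_fun (hasCoeffs_simpleRoot (D := D) j) H
  · refine killingForm_summandC_of_torusPart (fun f hf f' hf' _ h0 => hl ?_)
      (fun H hH H' hH' => ?_) hx hy
    · have h1 := hf.abs_eq_level
      rw [eq_neg_of_add_eq_zero_left h0, Pi.neg_apply, abs_neg, hf'.abs_eq_level] at h1
      exact_mod_cast h1.symm
    · rw [hj, Submodule.mem_bot] at hH'
      rw [hH', ZeroMemClass.coe_zero, map_zero]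

/-- The complexified summands span `𝔤^ℂ`. -/
lemma iSup_summandC : ⨆ i, D.summandC i = ⊤ := by
  have hle : ∀ i, D.summandC i ≤ ⨆ i, D.summandC i := le_iSup D.summandC
  rw [eq_top_iff, ← span_tC_union_rootVectors (D := D), Submodule.span_le]
  obtain ⟨Z, hZ0, hZ, hn⟩ := exists_fundamentalCoweight D
  have h1 : ∀ j ≠ c.node, (D.simpleCoroot j : ℂ ⊗[ℝ] g) ∈ ⨆ i, D.summandC i := by
    intro j hj
    rcases c.mem_nodes₁_or_mem_nodes₂ hj with h | h
    · exact hle 1 (mem_summandC_of_mem_torusPart (Submodule.subset_span ⟨j, h, rfl⟩))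
    · exact hle 2 (mem_summandC_of_mem_torusPart (Submodule.subset_span ⟨j, h, rfl⟩))
  have h2 : ∀ j, (D.simpleCoroot j : ℂ ⊗[ℝ] g) ∈ ⨆ i, D.summandC i := by
    intro j
    by_cases hj : j = c.node
    · rw [hj]
      suffices h : Submodule.span ℂ {Z} ⊔ Submodule.span ℂ (D.simpleCoroot '' {c.node}ᶜ) ≤
        (⨆ i, D.summandC i).comap D.tC.toSubmodule.subtype from h hn
      refine sup_le (Submodule.span_le.2 ?_) (Submodule.span_le.2 ?_)
      · rintro _ rfl
        exact hle 0 (mem_summandC_of_mem_torusPart hZ0)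
      · rintro _ ⟨k, hk, rfl⟩
        exact h1 k hk
    · exact h1 j hj
  rintro x (hx | hx)
  · suffices h : (⊤ : Submodule ℂ D.tC) ≤ (⨆ i, D.summandC i).comap D.tC.toSubmodule.subtype from
      h (Submodule.mem_top (x := (⟨x, hx⟩ : D.tC)))
    rw [← span_simpleCoroot (D := D), Submodule.span_le]
    rintro _ ⟨j, rfl⟩
    exact h2 j
  · obtain ⟨f, hf⟩ := Set.mem_iUnion.1 hx
    have hle' := form_le_of_mem_rootVectors hf
    have h3 := TypeIIb3.abs_apply_node_le hle'
    have h4 := abs_nonneg (f c.node)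
    have h5 : |f c.node| = 0 ∨ |f c.node| = (1 : ℕ) ∨ |f c.node| = (2 : ℕ) ∨
        |f c.node| = (3 : ℕ) := by omega
    rcases h5 with h5 | h5 | h5 | h5
    · have h6 := abs_eq_zero.1 h5
      rcases TypeIIb3.support_subset hle' h6 with h7 | h7
      · refine hle 1 (mem_summandC_of_mem_rootVectors (i := 1) (fun j hj => ?_) hf)
        by_cases hj' : j = c.node
        · rw [hj', h6]
        · exact h7 j ((c.mem_nodes₁_or_mem_nodes₂ hj').resolve_left hj)
      · refine hle 2 (mem_summandC_of_mem_rootVectors (i := 2) (fun j hj => ?_) hf)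
        by_cases hj' : j = c.node
        · rw [hj', h6]
        · exact h7 j ((c.mem_nodes₁_or_mem_nodes₂ hj').resolve_right hj)
    · exact hle 3 (mem_summandC_of_mem_rootVectors (i := 3) h5 hf)
    · exact hle 4 (mem_summandC_of_mem_rootVectors (i := 4) h5 hf)
    · exact hle 5 (mem_summandC_of_mem_rootVectors (i := 5) h5 hf)

lemma Linked.swap {i j k : Fin 6} (h : D.Linked i j k) : D.Linked j i k := by
  obtain ⟨V, hV, W, hW, U, hU, h⟩ := h
  exact ⟨W, hW, V, hV, U, hU, by rwa [killingForm_lie_swap, neg_ne_zero]⟩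

lemma exists_killingForm_ne_zero {f : Fin c.rank → ℤ} {x : ℂ ⊗[ℝ] g} (hx : x ∈ D.rootVectors f)
    (hx0 : x ≠ 0) : ∃ y ∈ D.rootVectors (-f), killingForm ℂ (ℂ ⊗[ℝ] g) x y ≠ 0 := by
  by_contra! h
  have h1 : killingForm ℂ (ℂ ⊗[ℝ] g) x = 0 := by
    refine linearMap_eq_zero (D := D) _ (fun H => ?_) fun f' y hy => ?_
    · rw [killingForm_comm, killingForm_tC_rootVector hx]
    · by_cases hf : f + f' = 0
      · exact h y (by rwa [neg_eq_of_add_eq_zero_right hf])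
      · exact killingForm_rootVectors hx hy hf
  have h2 : x ∈ LinearMap.ker (killingForm ℂ (ℂ ⊗[ℝ] g)) := LinearMap.mem_ker.2 h1
  rw [ker_killingForm_eq_bot, Submodule.mem_bot] at h2
  exact hx0 h2

lemma linked_of_eval_ne_zero {i k : Fin 6} {H : D.tC} (hH : H ∈ D.torusPart i) {α : D.tC.root}
    {f : Fin c.rank → ℤ} (hα : D.HasCoeffs α f) (hf : InSummand c k f) (hf' : InSummand c k (-f))
    (h : D.eval f H ≠ 0) : D.Linked i k k := by
  obtain ⟨x, hx, _, _, ht⟩ := hα.exists_isSl2Triple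
  obtain ⟨y, hy, hxy⟩ := exists_killingForm_ne_zero hx ht.e_ne_zero
  refine ⟨H, mem_summandC_of_mem_torusPart hH, x, mem_summandC_of_mem_rootVectors hf hx, y,
    mem_summandC_of_mem_rootVectors hf' hy, ?_⟩
  rw [lie_rootVector hx, map_smul, LinearMap.smul_apply, smul_eq_mul]
  exact mul_ne_zero h hxy

lemma linked_of_pairing_neg {i j k : Fin 6} (hi : InSummand c i (Pi.single c.node 1))
    {α : D.tC.root} {f : Fin c.rank → ℤ} (hα : D.HasCoeffs α f) (hj : InSummand c j f)
    (h : c.pairing f c.node < 0) (h0 : Pi.single c.node 1 + f ≠ 0)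
    (hk : InSummand c k (-(Pi.single c.node 1 + f))) : D.Linked i j k := by
  obtain ⟨x, hx, _, _, ht⟩ := hα.exists_isSl2Triple
  obtain ⟨e, he, y, hy, ht'⟩ := (hasCoeffs_simpleRoot (D := D) c.node).exists_isSl2Triple
  have h1 := lie_ne_zero hx ht.e_ne_zero h ht' rfl
  obtain ⟨z, hz, hxz⟩ := exists_killingForm_ne_zero (lie_mem_rootVectors he hx h0 h1) h1
  exact ⟨e, mem_summandC_of_mem_rootVectors hi he, x, mem_summandC_of_mem_rootVectors hj hx, z,
    mem_summandC_of_mem_rootVectors hk hz, hxz⟩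

lemma linked_level_one_two (D : PaintedRootDatum c g) : D.Linked 3 3 4 ∧ D.Linked 0 4 4 ∧
    D.Linked 2 4 4 ∧ (c = TypeIIb3.E7_3 → D.Linked 1 4 4) := by
  obtain ⟨w, hw, hp, ⟨j, hj, hj'⟩, h1⟩ := c.exists_word_level_one
  obtain ⟨α, hα⟩ := exists_hasCoeffs_word (D := D) w
  obtain ⟨Z, hZ0, hZ, -⟩ := exists_fundamentalCoweight D
  have hβ := hα.reflection c.node
  have hn : c.refl c.node (c.word w) c.node = 2 := by
    rw [TypeIIb3.refl, if_pos rfl, hw, hp]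
    rfl
  have h4 : InSummand c 4 (c.refl c.node (c.word w)) := by
    change |c.refl c.node (c.word w) c.node| = (2 : ℕ)
    rw [hn]; rfl
  have h4' : InSummand c 4 (-c.refl c.node (c.word w)) := by
    change |-c.refl c.node (c.word w) c.node| = (2 : ℕ)
    rw [hn]; rfl
  have hsum : (Pi.single c.node 1 + c.word w : Fin c.rank → ℤ) c.node = 2 := by
    rw [Pi.add_apply, Pi.single_eq_same, hw]
    rfl
  refine ⟨linked_of_pairing_neg ?_ hα ?_ (by rw [hp]; norm_num) (fun h => ?_) ?_,
    linked_of_eval_ne_zero hZ0 hβ h4 h4' ?_, linked_of_eval_ne_zero (H := D.simpleCoroot j)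
      (Submodule.subset_span ⟨j, hj, rfl⟩) hβ h4 h4' ?_, fun hc => ?_⟩
  · change |(Pi.single c.node 1 : Fin c.rank → ℤ) c.node| = (1 : ℕ)
    rw [Pi.single_eq_same]; rfl
  · change |c.word w c.node| = (1 : ℕ)
    rw [hw]; rfl
  · rw [h] at hsum
    exact absurd hsum (by norm_num)
  · change |-(Pi.single c.node 1 + c.word w : Fin c.rank → ℤ) c.node| = (2 : ℕ)
    rw [hsum]; rfl
  · rw [hZ, hn]
    norm_num
  · rw [eval_simpleCoroot]
    exact_mod_cast hj'
  · obtain ⟨k, hk, hk'⟩ := h1 hc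
    refine linked_of_eval_ne_zero (H := D.simpleCoroot k)
      (Submodule.subset_span ⟨k, hk, rfl⟩) hβ h4 h4' ?_
    rw [eval_simpleCoroot]
    exact_mod_cast hk'

lemma linked_level_two_three (D : PaintedRootDatum c g) : D.Linked 3 4 5 ∧ D.Linked 0 5 5 ∧
    D.Linked 1 5 5 := by
  obtain ⟨w, hw, hp, ⟨j, hj, hj'⟩⟩ := c.exists_word_level_two
  obtain ⟨α, hα⟩ := exists_hasCoeffs_word (D := D) w
  obtain ⟨Z, hZ0, hZ, -⟩ := exists_fundamentalCoweight D
  have hβ := hα.reflection c.node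
  have hn : c.refl c.node (c.word w) c.node = 3 := by
    rw [TypeIIb3.refl, if_pos rfl, hw, hp]
    rfl
  have h5 : InSummand c 5 (c.refl c.node (c.word w)) := by
    change |c.refl c.node (c.word w) c.node| = (3 : ℕ)
    rw [hn]; rfl
  have h5' : InSummand c 5 (-c.refl c.node (c.word w)) := by
    change |-c.refl c.node (c.word w) c.node| = (3 : ℕ)
    rw [hn]; rfl
  have hsum : (Pi.single c.node 1 + c.word w : Fin c.rank → ℤ) c.node = 3 := by
    rw [Pi.add_apply, Pi.single_eq_same, hw]
    rfl
  refine ⟨linked_of_pairing_neg ?_ hα ?_ (by rw [hp]; norm_num) (fun h => ?_) ?_,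
    linked_of_eval_ne_zero hZ0 hβ h5 h5' ?_, linked_of_eval_ne_zero (H := D.simpleCoroot j)
      (Submodule.subset_span ⟨j, hj, rfl⟩) hβ h5 h5' ?_⟩
  · change |(Pi.single c.node 1 : Fin c.rank → ℤ) c.node| = (1 : ℕ)
    rw [Pi.single_eq_same]; rfl
  · change |c.word w c.node| = (2 : ℕ)
    rw [hw]; rfl
  · rw [h] at hsum
    exact absurd hsum (by norm_num)
  · change |-(Pi.single c.node 1 + c.word w : Fin c.rank → ℤ) c.node| = (3 : ℕ)
    rw [hsum]; rfl
  · rw [hZ, hn]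
    norm_num
  · rw [eval_simpleCoroot]
    exact_mod_cast hj'

end PaintedRootDatum

/-! ### The real form -/

section Conjugation

variable (g : Type*) [LieRing g] [LieAlgebra ℝ g]

/-- The complex conjugation of `𝔤^ℂ` with respect to `𝔤`. -/
def complexConj : (ℂ ⊗[ℝ] g) →ₛₗ[starRingEnd ℂ] (ℂ ⊗[ℝ] g) :=
  { LinearMap.rTensor g Complex.conjAe.toLinearMap with
    map_smul' := fun z x => by
      induction x using TensorProduct.induction_on with
      | zero => simp
      | tmul w x => simp [TensorProduct.smul_tmul']
      | add x y hx hy =>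
        simp only [AddHom.toFun_eq_coe, LinearMap.coe_toAddHom, smul_add, map_add] at hx hy ⊢
        rw [hx, hy] }

variable {g}

@[simp] lemma complexConj_tmul (z : ℂ) (x : g) :
    complexConj g (z ⊗ₜ[ℝ] x) = (starRingEnd ℂ z) ⊗ₜ[ℝ] x := rfl

lemma complexConj_lie (x y : ℂ ⊗[ℝ] g) :
    complexConj g ⁅x, y⁆ = ⁅complexConj g x, complexConj g y⁆ := by
  suffices h : complexConj g (LieAlgebra.ad ℂ _ x y) =
    LieAlgebra.ad ℂ _ (complexConj g x) (complexConj g y) from h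
  induction x using TensorProduct.induction_on with
  | zero => simp only [map_zero, LinearMap.zero_apply]
  | add x x' hx hx' => simp only [map_add, LinearMap.add_apply, hx, hx']
  | tmul z x =>
    induction y using TensorProduct.induction_on with
    | zero => simp only [map_zero]
    | add y y' hy hy' => simp only [map_add, hy, hy']
    | tmul w y =>
      change complexConj g ⁅z ⊗ₜ[ℝ] x, w ⊗ₜ[ℝ] y⁆ =
        ⁅(starRingEnd ℂ z) ⊗ₜ[ℝ] x, (starRingEnd ℂ w) ⊗ₜ[ℝ] y⁆
      rw [LieAlgebra.ExtendScalars.bracket_tmul, LieAlgebra.ExtendScalars.bracket_tmul,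
        complexConj_tmul, map_mul]

lemma complexConj_complexConj (x : ℂ ⊗[ℝ] g) : complexConj g (complexConj g x) = x := by
  induction x using TensorProduct.induction_on with
  | zero => simp
  | add x y hx hy => rw [map_add, map_add, hx, hy]
  | tmul z x => simp

lemma exists_eq_add_I_smul (x : ℂ ⊗[ℝ] g) :
    ∃ a b : g, x = (1 : ℂ) ⊗ₜ[ℝ] a + Complex.I • ((1 : ℂ) ⊗ₜ[ℝ] b) := by
  induction x using TensorProduct.induction_on with
  | zero => exact ⟨0, 0, by simp⟩
  | add x y hx hy =>
    obtain ⟨a, b, rfl⟩ := hx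
    obtain ⟨a', b', rfl⟩ := hy
    refine ⟨a + a', b + b', ?_⟩
    simp only [TensorProduct.tmul_add, smul_add]
    abel
  | tmul z x =>
    refine ⟨z.re • x, z.im • x, ?_⟩
    rw [← TensorProduct.smul_tmul, ← TensorProduct.smul_tmul, TensorProduct.smul_tmul',
      ← TensorProduct.add_tmul]
    congr 1
    apply Complex.ext <;> simp

lemma complexConj_add_I_smul (a b : g) :
    complexConj g ((1 : ℂ) ⊗ₜ[ℝ] a + Complex.I • ((1 : ℂ) ⊗ₜ[ℝ] b)) =
      (1 : ℂ) ⊗ₜ[ℝ] a - Complex.I • ((1 : ℂ) ⊗ₜ[ℝ] b) := by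
  rw [map_add, LinearMap.map_smulₛₗ, complexConj_tmul, complexConj_tmul, map_one, Complex.conj_I,
    neg_smul, sub_eq_add_neg]

lemma one_tmul_injective : Function.Injective fun a : g => (1 : ℂ) ⊗ₜ[ℝ] a :=
  Module.FaithfullyFlat.tensorProduct_mk_injective (A := ℝ) (B := ℂ) g

lemma one_tmul_smul (r : ℝ) (a : g) : (1 : ℂ) ⊗ₜ[ℝ] (r • a) = (r : ℂ) • ((1 : ℂ) ⊗ₜ[ℝ] a) := by
  rw [← TensorProduct.smul_tmul, TensorProduct.smul_tmul']
  simp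

lemma add_I_smul_injective {a b a' b' : g}
    (h : (1 : ℂ) ⊗ₜ[ℝ] a + Complex.I • ((1 : ℂ) ⊗ₜ[ℝ] b) =
      (1 : ℂ) ⊗ₜ[ℝ] a' + Complex.I • ((1 : ℂ) ⊗ₜ[ℝ] b')) : a = a' ∧ b = b' := by
  have h1 := congrArg (complexConj g) h
  rw [complexConj_add_I_smul, complexConj_add_I_smul] at h1
  constructor
  · refine one_tmul_injective ?_
    have h2 : (2 : ℂ) • (1 : ℂ) ⊗ₜ[ℝ] a = (2 : ℂ) • (1 : ℂ) ⊗ₜ[ℝ] a' := by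
      have h3 := congrArg₂ (· + ·) h h1
      simp only [add_add_sub_cancel] at h3
      rwa [two_smul, two_smul]
    exact smul_right_injective _ (two_ne_zero (α := ℂ)) h2
  · refine one_tmul_injective ?_
    have h2 : (2 * Complex.I) • (1 : ℂ) ⊗ₜ[ℝ] b = (2 * Complex.I) • (1 : ℂ) ⊗ₜ[ℝ] b' := by
      have h3 := congrArg₂ (· - ·) h h1
      simp only [add_sub_sub_cancel, add_sub_sub_cancel] at h3
      rw [mul_smul, mul_smul, two_smul, two_smul]
      convert h3 using 1
    exact smul_right_injective _ (mul_ne_zero two_ne_zero Complex.I_ne_zero) h2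

/-- A complex subspace that is stable under conjugation is spanned by its real points. -/
lemma exists_realPoints {V : Submodule ℂ (ℂ ⊗[ℝ] g)} (hV : ∀ x ∈ V, complexConj g x ∈ V)
    {x : ℂ ⊗[ℝ] g} (hx : x ∈ V) : ∃ a ∈ realPoints V, ∃ b ∈ realPoints V,
      x = (1 : ℂ) ⊗ₜ[ℝ] a + Complex.I • ((1 : ℂ) ⊗ₜ[ℝ] b) := by
  obtain ⟨a, b, rfl⟩ := exists_eq_add_I_smul x
  have h := hV _ hx
  rw [complexConj_add_I_smul] at h
  refine ⟨a, ?_, b, ?_, rfl⟩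
  · have h1 := V.smul_mem (2⁻¹ : ℂ) (V.add_mem hx h)
    rwa [add_add_sub_cancel, ← two_smul ℂ, inv_smul_smul₀ two_ne_zero] at h1
  · have h1 := V.smul_mem (2 * Complex.I)⁻¹ (V.sub_mem hx h)
    rw [add_sub_sub_cancel, ← two_smul ℂ, smul_smul (2 : ℂ) Complex.I,
      inv_smul_smul₀ (mul_ne_zero two_ne_zero Complex.I_ne_zero)] at h1
    exact h1

end Conjugation

namespace PaintedRootDatum

open LieAlgebra LieAlgebra.IsKilling LieModule

variable {c : TypeIIb3} {g : Type*} [LieRing g] [LieAlgebra ℝ g]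
  [Module.Finite ℝ g] [LieAlgebra.IsKilling ℝ g] {D : PaintedRootDatum c g}

lemma complexConj_mem_tC {H : ℂ ⊗[ℝ] g} (hH : H ∈ D.tC) : complexConj g H ∈ D.tC := by
  change H ∈ D.t.toSubmodule.baseChange ℂ at hH
  change complexConj g H ∈ D.t.toSubmodule.baseChange ℂ
  rw [Submodule.baseChange_eq_span] at hH ⊢
  induction hH using Submodule.span_induction with
  | zero => simp
  | add a b _ _ ha hb => rw [map_add]; exact add_mem ha hb
  | smul z a _ ha => rw [LinearMap.map_smulₛₗ]; exact Submodule.smul_mem _ _ ha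
  | mem a ha =>
    obtain ⟨a, ha, rfl⟩ := ha
    refine Submodule.subset_span ⟨a, ha, ?_⟩
    simp

/-- The restriction of the conjugation to `𝔱^ℂ`. -/
def conjTC (D : PaintedRootDatum c g) (H : D.tC) : D.tC := ⟨complexConj g H, complexConj_mem_tC H.2⟩

lemma InSummand.neg {i : Fin 6} {f : Fin c.rank → ℤ} (h : InSummand c i f) :
    InSummand c i (-f) := by
  fin_cases i
  · exact h
  · exact fun j hj => neg_eq_zero.2 (h j hj)
  · exact fun j hj => neg_eq_zero.2 (h j hj)
  all_goals exact (abs_neg _).trans h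

section Compact

/- The real parts of the eigenvalues of `ad X` are zero for all `X ∈ 𝔤`, as for the Lie algebra of a
compact group. -/
variable (hre : ∀ (X a b : g) (p q : ℝ), ⁅X, a⁆ = p • a - q • b → ⁅X, b⁆ = q • a + p • b →
  (a ≠ 0 ∨ b ≠ 0) → p = 0)

include hre

lemma re_eval_eq_zero {X : g} (hX : (1 : ℂ) ⊗ₜ[ℝ] X ∈ D.tC) {α : D.tC.root}
    {f : Fin c.rank → ℤ} (hα : D.HasCoeffs α f) : (D.eval f ⟨_, hX⟩).re = 0 := by
  obtain ⟨x, hx, _, _, ht⟩ := hα.exists_isSl2Triple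
  have h0 := ht.e_ne_zero
  have h1 := lie_rootVector hx ⟨_, hX⟩
  generalize D.eval f ⟨_, hX⟩ = z at h1
  obtain ⟨a, b, rfl⟩ := exists_eq_add_I_smul x
  have h2 : z • ((1 : ℂ) ⊗ₜ[ℝ] a + Complex.I • ((1 : ℂ) ⊗ₜ[ℝ] b)) =
      (1 : ℂ) ⊗ₜ[ℝ] (z.re • a - z.im • b) +
        Complex.I • ((1 : ℂ) ⊗ₜ[ℝ] (z.im • a + z.re • b)) := by
    nth_rewrite 1 [← Complex.re_add_im z]
    rw [TensorProduct.tmul_sub, TensorProduct.tmul_add, one_tmul_smul, one_tmul_smul,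
      one_tmul_smul, one_tmul_smul]
    match_scalars
    · ring
    · linear_combination (z.im : ℂ) * Complex.I_mul_I
  have h3 : ⁅(1 : ℂ) ⊗ₜ[ℝ] X, (1 : ℂ) ⊗ₜ[ℝ] a + Complex.I • ((1 : ℂ) ⊗ₜ[ℝ] b)⁆ =
      (1 : ℂ) ⊗ₜ[ℝ] ⁅X, a⁆ + Complex.I • ((1 : ℂ) ⊗ₜ[ℝ] ⁅X, b⁆) := by
    change LieAlgebra.ad ℂ _ ((1 : ℂ) ⊗ₜ[ℝ] X) _ = _
    rw [map_add, map_smul]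
    change ⁅(1 : ℂ) ⊗ₜ[ℝ] X, (1 : ℂ) ⊗ₜ[ℝ] a⁆ + Complex.I • ⁅(1 : ℂ) ⊗ₜ[ℝ] X, (1 : ℂ) ⊗ₜ[ℝ] b⁆ = _
    rw [LieAlgebra.ExtendScalars.bracket_tmul, LieAlgebra.ExtendScalars.bracket_tmul, mul_one]
  obtain ⟨h4, h5⟩ := add_I_smul_injective (h3.symm.trans (h1.trans h2))
  refine hre X a b _ _ h4 h5 ?_
  by_contra! h6
  exact h0 (by rw [h6.1, h6.2, TensorProduct.tmul_zero, smul_zero, add_zero])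

/-- The roots have imaginary values on `𝔱`. -/
lemma eval_conjTC {α : D.tC.root} {f : Fin c.rank → ℤ} (hα : D.HasCoeffs α f) (H : D.tC) :
    D.eval f (conjTC D H) = -starRingEnd ℂ (D.eval f H) := by
  suffices h : ∀ x (hx : x ∈ D.t.toSubmodule.baseChange ℂ),
      D.eval f (conjTC D ⟨x, hx⟩) = -starRingEnd ℂ (D.eval f ⟨x, hx⟩) from h H H.2
  intro x hx
  have hx' := hx
  rw [Submodule.baseChange_eq_span] at hx'
  induction hx' using Submodule.span_induction with
  | mem a ha =>
    obtain ⟨a, ha, rfl⟩ := ha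
    have h1 : conjTC D ⟨_, hx⟩ = ⟨_, hx⟩ := by
      refine Subtype.ext ?_
      change complexConj g ((1 : ℂ) ⊗ₜ[ℝ] a) = (1 : ℂ) ⊗ₜ[ℝ] a
      rw [complexConj_tmul, map_one]
    rw [h1]
    have h2 := re_eval_eq_zero hre (X := a) hx hα
    change D.eval f ⟨(1 : ℂ) ⊗ₜ[ℝ] a, hx⟩ = -starRingEnd ℂ (D.eval f ⟨(1 : ℂ) ⊗ₜ[ℝ] a, hx⟩)
    apply Complex.ext
    · rw [Complex.neg_re, Complex.conj_re, h2, neg_zero]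
    · rw [Complex.neg_im, Complex.conj_im, neg_neg]
  | zero =>
    have h1 : conjTC D ⟨0, hx⟩ = 0 := Subtype.ext (map_zero _)
    have h2 : (⟨0, hx⟩ : D.tC) = 0 := rfl
    rw [h1, h2, map_zero, map_zero, neg_zero]
  | add y z hy hz hy' hz' =>
    rw [← Submodule.baseChange_eq_span] at hy hz
    have h1 : conjTC D ⟨y + z, hx⟩ = conjTC D ⟨y, hy⟩ + conjTC D ⟨z, hz⟩ :=
      Subtype.ext (map_add _ _ _)
    have h2 : (⟨y + z, hx⟩ : D.tC) = ⟨y, hy⟩ + ⟨z, hz⟩ := rfl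
    rw [h1, h2, map_add, map_add, hy' hy, hz' hz, map_add, neg_add]
  | smul w y hy hy' =>
    rw [← Submodule.baseChange_eq_span] at hy
    have h1 : conjTC D ⟨w • y, hx⟩ = starRingEnd ℂ w • conjTC D ⟨y, hy⟩ :=
      Subtype.ext (LinearMap.map_smulₛₗ _ _ _)
    have h2 : (⟨w • y, hx⟩ : D.tC) = w • ⟨y, hy⟩ := rfl
    rw [h1, h2, map_smul, map_smul, hy' hy, smul_eq_mul, smul_eq_mul, map_mul, mul_neg]

/-- The conjugation interchanges the root spaces of `α` and `-α`. -/
lemma complexConj_mem_rootVectors {f : Fin c.rank → ℤ} {x : ℂ ⊗[ℝ] g}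
    (hx : x ∈ D.rootVectors f) : complexConj g x ∈ D.rootVectors (-f) := by
  have hx1 := hx
  obtain ⟨α, hα, -⟩ := hx1
  refine ⟨_, hα.neg, ?_⟩
  rw [hα.neg.coe_eq]
  refine weightSpace_le_genWeightSpace _ _ ((mem_weightSpace _ _).2 fun H => ?_)
  have h1 := congrArg (complexConj g) (lie_rootVector hx (conjTC D H))
  rw [complexConj_lie, LinearMap.map_smulₛₗ, eval_conjTC hre hα, map_neg, Complex.conj_conj] at h1
  have h2 : complexConj g (conjTC D H : D.tC) = (H : ℂ ⊗[ℝ] g) := complexConj_complexConj _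
  rw [h2] at h1
  rw [eval_neg]
  exact h1

lemma conjTC_simpleCoroot (j : Fin c.rank) :
    ∃ r : ℂ, conjTC D (D.simpleCoroot j) = r • D.simpleCoroot j := by
  obtain ⟨e, he, y, hy, ht⟩ := (hasCoeffs_simpleRoot (D := D) j).exists_isSl2Triple
  have hh : ⁅e, y⁆ = ((D.simpleCoroot j : D.tC) : ℂ ⊗[ℝ] g) := ht.lie_e_f
  obtain ⟨s, hs⟩ := exists_eq_smul (complexConj_mem_rootVectors hre he) hy ht.f_ne_zero
  have h1 := complexConj_mem_rootVectors hre hy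
  rw [neg_neg] at h1
  obtain ⟨t, ht'⟩ := exists_eq_smul h1 he ht.e_ne_zero
  refine ⟨-(t * s), Subtype.ext ?_⟩
  change complexConj g (D.simpleCoroot j : D.tC) = (-(t * s)) • ((D.simpleCoroot j : D.tC) : _)
  rw [← hh, complexConj_lie, hs, ht']
  change LieAlgebra.ad ℂ _ (s • y) (t • e) = _
  rw [map_smul, map_smul, LinearMap.smul_apply, smul_smul, neg_smul, ← smul_neg]
  exact congrArg _ (lie_skew _ _).symm

lemma conjTC_mem_torusPart {i : Fin 6} {H : D.tC} (hH : H ∈ D.torusPart i) :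
    conjTC D H ∈ D.torusPart i := by
  have hS : ∀ (S : Finset (Fin c.rank)), ∀ H ∈ Submodule.span ℂ (D.simpleCoroot '' S),
      conjTC D H ∈ Submodule.span ℂ (D.simpleCoroot '' S) := by
    intro S H hH
    induction hH using Submodule.span_induction with
    | mem H hH =>
      obtain ⟨j, hj, rfl⟩ := hH
      obtain ⟨r, hr⟩ := conjTC_simpleCoroot hre (D := D) j
      rw [hr]
      exact Submodule.smul_mem _ _ (Submodule.subset_span ⟨j, hj, rfl⟩)
    | zero =>
      have h1 : conjTC D 0 = 0 := Subtype.ext (map_zero _)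
      rw [h1]
      exact zero_mem _
    | add y z _ _ hy hz =>
      have h1 : conjTC D (y + z) = conjTC D y + conjTC D z := Subtype.ext (map_add _ _ _)
      rw [h1]
      exact add_mem hy hz
    | smul w y _ hy =>
      have h1 : conjTC D (w • y) = starRingEnd ℂ w • conjTC D y :=
        Subtype.ext (LinearMap.map_smulₛₗ _ _ _)
      rw [h1]
      exact Submodule.smul_mem _ _ hy
  have h0 : ∀ H ∈ (⊥ : Submodule ℂ D.tC), conjTC D H ∈ (⊥ : Submodule ℂ D.tC) := by
    intro H hH
    rw [Submodule.mem_bot] at hH ⊢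
    rw [hH]
    exact Subtype.ext (map_zero _)
  fin_cases i
  · refine (Submodule.mem_iInf _).2 fun j => (Submodule.mem_iInf _).2 fun hj => ?_
    have h1 : (rootSystem D.tC).root (D.simpleRoot j) H = 0 :=
      LinearMap.mem_ker.1 ((Submodule.mem_iInf _).1 ((Submodule.mem_iInf _).1 hH j) hj)
    have h2 : (rootSystem D.tC).root (D.simpleRoot j) = D.eval (Pi.single j 1) :=
      hasCoeffs_simpleRoot (D := D) j
    rw [LinearMap.mem_ker, h2, eval_conjTC hre (hasCoeffs_simpleRoot (D := D) j), ← h2, h1,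
      map_zero, neg_zero]
  · exact hS _ _ hH
  · exact hS _ _ hH
  all_goals exact h0 _ hH

lemma complexConj_mem_summandC {i : Fin 6} {x : ℂ ⊗[ℝ] g} (hx : x ∈ D.summandC i) :
    complexConj g x ∈ D.summandC i := by
  suffices h : D.summandC i ≤ (D.summandC i).comap (complexConj g) from h hx
  refine sup_le ?_ (iSup₂_le fun α hα y hy => ?_)
  · rintro _ ⟨H, hH, rfl⟩
    exact mem_summandC_of_mem_torusPart (conjTC_mem_torusPart hre hH)
  · obtain ⟨f, hf, hi⟩ := hα
    exact mem_summandC_of_mem_rootVectors hi.neg (complexConj_mem_rootVectors hre ⟨α, hf, hy⟩)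

/-- To vanish on a complexified summand, it suffices for a complex linear map to vanish on the
summand. -/
lemma linearMap_summand_eq_zero {N : Type*} [AddCommGroup N] [Module ℂ N]
    (φ : (ℂ ⊗[ℝ] g) →ₗ[ℂ] N) {i : Fin 6} (h : ∀ a ∈ D.summand i, φ ((1 : ℂ) ⊗ₜ[ℝ] a) = 0)
    {x : ℂ ⊗[ℝ] g} (hx : x ∈ D.summandC i) : φ x = 0 := by
  obtain ⟨a, ha, b, hb, rfl⟩ := exists_realPoints (fun x => complexConj_mem_summandC hre) hx
  rw [realPoints_summandC] at ha hb
  rw [map_add, map_smul, h a ha, h b hb, smul_zero, add_zero]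

end Compact

end PaintedRootDatum

/-! ### Diagonal forms -/

lemma killingForm_one_tmul {g : Type*} [LieRing g] [LieAlgebra ℝ g] [Module.Finite ℝ g] (a b : g) :
    killingForm ℂ (ℂ ⊗[ℝ] g) ((1 : ℂ) ⊗ₜ[ℝ] a) ((1 : ℂ) ⊗ₜ[ℝ] b) = (killingForm ℝ g a b : ℂ) := by
  have h' : killingForm ℂ (ℂ ⊗[ℝ] g) = (killingForm ℝ g).baseChange ℂ :=
    LieModule.traceForm_baseChange ℝ g g ℂ
  rw [h', LinearMap.BilinForm.baseChange_tmul]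
  simp

namespace PaintedRootDatum

open LieAlgebra LieAlgebra.IsKilling LieModule

variable {c : TypeIIb3} {g : Type*} [LieRing g] [LieAlgebra ℝ g]
  [Module.Finite ℝ g] [LieAlgebra.IsKilling ℝ g] {D : PaintedRootDatum c g}

lemma one_tmul_mem_summandC {i : Fin 6} {a : g} (ha : a ∈ D.summand i) :
    (1 : ℂ) ⊗ₜ[ℝ] a ∈ D.summandC i := by
  rw [← realPoints_summandC] at ha
  exact ha

lemma killingForm_summand {i j : Fin 6} (hij : i ≠ j) {a b : g} (ha : a ∈ D.summand i)
    (hb : b ∈ D.summand j) : killingForm ℝ g a b = 0 := by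
  have h := killingForm_summandC hij (one_tmul_mem_summandC ha) (one_tmul_mem_summandC hb)
  rw [killingForm_one_tmul] at h
  exact_mod_cast h

/-- The trilinear form `κ([V, W], U)` vanishes on these triples of summands for one of two reasons:
the coefficients at the painted node cannot add up to zero, or two of the summands commute. -/
def Unlinked (P : Prop) (i j k : Fin 6) : Prop :=
  (level i ≠ level j + level k ∧ level j ≠ level i + level k ∧ level k ≠ level i + level j) ∨
    (Commuting P i j ∨ Commuting P j i) ∨ (Commuting P j k ∨ Commuting P k j) ∨
      (Commuting P i k ∨ Commuting P k i)

instance (P : Prop) [Decidable P] (i j k : Fin 6) : Decidable (Unlinked P i j k) :=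
  inferInstanceAs (Decidable (_ ∨ _))

lemma Commuting.mono {P P' : Prop} (hP : P → P') {i j : Fin 6} :
    Commuting P i j → Commuting P' i j :=
  Or.imp_right (Or.imp_right (Or.imp_right (Or.imp_right (And.imp_left hP))))

lemma Unlinked.mono {P P' : Prop} (hP : P → P') {i j k : Fin 6} :
    Unlinked P i j k → Unlinked P' i j k :=
  Or.imp_right (Or.imp (Or.imp (Commuting.mono hP) (Commuting.mono hP))
    (Or.imp (Or.imp (Commuting.mono hP) (Commuting.mono hP))
      (Or.imp (Commuting.mono hP) (Commuting.mono hP))))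

lemma Unlinked.killingForm_lie {i j k : Fin 6} (h : Unlinked (c ≠ TypeIIb3.E7_3) i j k) {V W U : g}
    (hV : V ∈ D.summand i) (hW : W ∈ D.summand j) (hU : U ∈ D.summand k) :
    killingForm ℝ g ⁅V, W⁆ U = 0 := by
  have h1 : killingForm ℂ (ℂ ⊗[ℝ] g) ⁅(1 : ℂ) ⊗ₜ[ℝ] V, (1 : ℂ) ⊗ₜ[ℝ] W⁆ ((1 : ℂ) ⊗ₜ[ℝ] U) = 0 := by
    rcases h with ⟨h1, h2, h3⟩ | h
    · exact killingForm_lie_eq_zero_of_level h1 h2 h3 (one_tmul_mem_summandC hV)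
        (one_tmul_mem_summandC hW) (one_tmul_mem_summandC hU)
    · exact killingForm_lie_eq_zero_of_commuting h (one_tmul_mem_summandC hV)
        (one_tmul_mem_summandC hW) (one_tmul_mem_summandC hU)
  rw [LieAlgebra.ExtendScalars.bracket_tmul, mul_one, killingForm_one_tmul] at h1
  exact_mod_cast h1

/-- A linear map `τ` with `[τ V, V] = 0` for all `V` is a homothety. -/
lemma exists_eq_smul_of_lie_alternating (D : PaintedRootDatum c g) {τ : g →ₗ[ℝ] g}
    (hτ : ∀ V W, ⁅τ V, W⁆ + ⁅τ W, V⁆ = 0) : ∃ r : ℝ, ∀ V, τ V = r • V := by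
  let τC := τ.baseChange ℂ
  let B : (ℂ ⊗[ℝ] g) →ₗ[ℂ] (ℂ ⊗[ℝ] g) →ₗ[ℂ] (ℂ ⊗[ℝ] g) :=
    LinearMap.mk₂ ℂ (fun x y => ad ℂ (ℂ ⊗[ℝ] g) x y)
      (fun x y z => by rw [map_add, LinearMap.add_apply])
      (fun r x y => by rw [map_smul, LinearMap.smul_apply])
      (fun x y z => map_add _ _ _) (fun r x y => map_smul _ _ _)
  have h0 : ∀ a : g, τC ((1 : ℂ) ⊗ₜ[ℝ] a) = (1 : ℂ) ⊗ₜ[ℝ] τ a := fun a => rfl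
  have h1 : ∀ a b : g, B (τC ((1 : ℂ) ⊗ₜ[ℝ] a)) ((1 : ℂ) ⊗ₜ[ℝ] b) +
      B (τC ((1 : ℂ) ⊗ₜ[ℝ] b)) ((1 : ℂ) ⊗ₜ[ℝ] a) = 0 := by
    intro a b
    rw [h0, h0]
    change ⁅(1 : ℂ) ⊗ₜ[ℝ] τ a, (1 : ℂ) ⊗ₜ[ℝ] b⁆ + ⁅(1 : ℂ) ⊗ₜ[ℝ] τ b, (1 : ℂ) ⊗ₜ[ℝ] a⁆ = 0
    rw [LieAlgebra.ExtendScalars.bracket_tmul, LieAlgebra.ExtendScalars.bracket_tmul, mul_one,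
      ← TensorProduct.tmul_add, hτ, TensorProduct.tmul_zero]
  have h2 : ∀ x y, B (τC x) y + B (τC y) x = 0 := by
    intro x y
    obtain ⟨a, b, rfl⟩ := exists_eq_add_I_smul x
    obtain ⟨a', b', rfl⟩ := exists_eq_add_I_smul y
    simp only [map_add, map_smul, LinearMap.add_apply, LinearMap.smul_apply, smul_add]
    have e1 := h1 a a'
    have e2 := h1 a b'
    have e3 := h1 b a'
    have e4 := h1 b b'
    rw [← eq_neg_iff_add_eq_zero] at e1 e2 e3 e4
    rw [e1, e2, e3, e4]
    module
  obtain ⟨r, hr⟩ := exists_eq_smul_killingForm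
    (b := (killingForm ℂ (ℂ ⊗[ℝ] g)).comp τC LinearMap.id) (fun V W U => by
      change killingForm ℂ (ℂ ⊗[ℝ] g) (τC V) ⁅W, U⁆ + killingForm ℂ (ℂ ⊗[ℝ] g) (τC W) ⁅V, U⁆ = 0
      rw [← killingForm_lie, ← killingForm_lie, ← LinearMap.add_apply, ← map_add]
      have h3 : ⁅τC V, W⁆ + ⁅τC W, V⁆ = 0 := h2 V W
      rw [h3, map_zero, LinearMap.zero_apply]) D
  have h3 : ∀ x, τC x = r • x := by
    intro x
    have h4 : τC x - r • x ∈ LinearMap.ker (killingForm ℂ (ℂ ⊗[ℝ] g)) := by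
      rw [LinearMap.mem_ker, map_sub, map_smul, sub_eq_zero]
      exact LinearMap.congr_fun hr x
    rw [ker_killingForm_eq_bot, Submodule.mem_bot, sub_eq_zero] at h4
    exact h4
  refine ⟨r.re, fun V => ?_⟩
  have h4 := h3 ((1 : ℂ) ⊗ₜ[ℝ] V)
  rw [h0] at h4
  refine (add_I_smul_injective (a := τ V) (b := 0) (b' := r.im • V) ?_).1
  rw [TensorProduct.tmul_zero, smul_zero, add_zero, h4, one_tmul_smul, one_tmul_smul]
  nth_rewrite 1 [← Complex.re_add_im r]
  module

section Compact

variable (hre : ∀ (X a b : g) (p q : ℝ), ⁅X, a⁆ = p • a - q • b → ⁅X, b⁆ = q • a + p • b →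
  (a ≠ 0 ∨ b ≠ 0) → p = 0)

include hre

lemma iSup_summand (D : PaintedRootDatum c g) : ⨆ i, D.summand i = ⊤ := by
  rw [eq_top_iff]
  rintro a -
  have h : ∀ x ∈ ⨆ i, D.summandC i, ∃ a ∈ ⨆ i, D.summand i, ∃ b ∈ ⨆ i, D.summand i,
      x = (1 : ℂ) ⊗ₜ[ℝ] a + Complex.I • ((1 : ℂ) ⊗ₜ[ℝ] b) := by
    intro x hx
    induction hx using Submodule.iSup_induction' with
    | mem i x hx =>
      obtain ⟨a, ha, b, hb, rfl⟩ := exists_realPoints (fun x => complexConj_mem_summandC hre) hx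
      rw [realPoints_summandC] at ha hb
      exact ⟨a, le_iSup D.summand i ha, b, le_iSup D.summand i hb, rfl⟩
    | zero => exact ⟨0, zero_mem _, 0, zero_mem _, by simp⟩
    | add x y _ _ hx hy =>
      obtain ⟨a, ha, b, hb, rfl⟩ := hx
      obtain ⟨a', ha', b', hb', rfl⟩ := hy
      refine ⟨a + a', add_mem ha ha', b + b', add_mem hb hb', ?_⟩
      simp only [TensorProduct.tmul_add, smul_add]
      abel
  obtain ⟨a', ha', b', -, hab⟩ := h ((1 : ℂ) ⊗ₜ[ℝ] a) (by rw [iSup_summandC]; trivial)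
  have h1 := add_I_smul_injective (a := a) (b := 0) (by simpa using hab)
  rwa [h1.1]

lemma linearMap_ext_summand (D : PaintedRootDatum c g) {N : Type*} [AddCommGroup N] [Module ℝ N]
    {φ ψ : g →ₗ[ℝ] N} (h : ∀ i, ∀ a ∈ D.summand i, φ a = ψ a) : φ = ψ := by
  have h1 : ⨆ i, D.summand i ≤ LinearMap.eqLocus φ ψ := iSup_le fun i a ha => h i a ha
  rw [iSup_summand hre] at h1
  exact LinearMap.ext fun a => h1 trivial

lemma Linked.exists_summand {i j k : Fin 6} (h : D.Linked i j k) : ∃ V ∈ D.summand i,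
    ∃ W ∈ D.summand j, ∃ U ∈ D.summand k, killingForm ℝ g ⁅V, W⁆ U ≠ 0 := by
  by_contra! h0
  obtain ⟨V, hV, W, hW, U, hU, h⟩ := h
  refine h (linearMap_summand_eq_zero hre (killingForm ℂ (ℂ ⊗[ℝ] g) ⁅V, W⁆) (fun U hU => ?_) hU)
  rw [killingForm_lie_rotate]
  refine linearMap_summand_eq_zero hre (killingForm ℂ (ℂ ⊗[ℝ] g) ⁅W, (1 : ℂ) ⊗ₜ[ℝ] U⁆)
    (fun V hV => ?_) hV
  rw [killingForm_lie_rotate]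
  refine linearMap_summand_eq_zero hre (killingForm ℂ (ℂ ⊗[ℝ] g) ⁅(1 : ℂ) ⊗ₜ[ℝ] U, (1 : ℂ) ⊗ₜ[ℝ] V⁆)
    (fun W hW => ?_) hW
  rw [killingForm_lie_rotate, LieAlgebra.ExtendScalars.bracket_tmul, mul_one, killingForm_one_tmul,
    h0 V hV W hW U hU, Complex.ofReal_zero]

lemma eq_of_forall_killingForm (D : PaintedRootDatum c g) {a a' : g}
    (h : ∀ i, ∀ b ∈ D.summand i, killingForm ℝ g a b = killingForm ℝ g a' b) : a = a' := by
  have h1 : killingForm ℝ g a = killingForm ℝ g a' := linearMap_ext_summand hre D h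
  have h2 : a - a' ∈ LinearMap.ker (killingForm ℝ g) := by
    rw [LinearMap.mem_ker, map_sub, h1, sub_self]
  rw [ker_killingForm_eq_bot, Submodule.mem_bot, sub_eq_zero] at h2
  exact h2

/-- A diagonal form is `B(φ ·, ·)` for an endomorphism `φ` that is a homothety on each summand. -/
lemma IsDiagonalForm.exists_endomorphism {Q : LinearMap.BilinForm ℝ g} {y : Fin 6 → ℝ}
    (hQ : D.IsDiagonalForm Q y) : ∃ φ : g →ₗ[ℝ] g, (∀ X Y, Q X Y = -killingForm ℝ g (φ X) Y) ∧
      (∀ i, ∀ a ∈ D.summand i, φ a = y i • a) ∧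
      ∀ X Y, killingForm ℝ g (φ X) Y = killingForm ℝ g X (φ Y) := by
  let e := (killingForm ℝ g).toDual (killingForm_nondegenerate ℝ g)
  let φ : g →ₗ[ℝ] g := -(e.symm.toLinearMap ∘ₗ Q)
  have h1 : ∀ X Y, Q X Y = -killingForm ℝ g (φ X) Y := by
    intro X Y
    have h : killingForm ℝ g (e.symm (Q X)) Y = Q X Y :=
      LinearMap.BilinForm.apply_toDual_symm_apply (hB := killingForm_nondegenerate ℝ g) _ _
    change Q X Y = -killingForm ℝ g (-e.symm (Q X)) Y
    rw [map_neg, LinearMap.neg_apply, neg_neg, h]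
  have h2 : ∀ i, ∀ a ∈ D.summand i, φ a = y i • a := by
    intro i a ha
    refine eq_of_forall_killingForm hre D fun j b hb => ?_
    have h3 := hQ i j a ha b hb
    rw [h1] at h3
    rw [map_smul, LinearMap.smul_apply, smul_eq_mul]
    split_ifs at h3 with hij
    · linarith
    · rw [killingForm_summand hij ha hb, mul_zero]
      linarith
  refine ⟨φ, h1, h2, fun X Y => ?_⟩
  suffices h : (killingForm ℝ g) ∘ₗ φ = (killingForm ℝ g).compl₂ φ from
    LinearMap.congr_fun (LinearMap.congr_fun h X) Y
  refine linearMap_ext_summand hre D fun i a ha => linearMap_ext_summand hre D fun j b hb => ?_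
  change killingForm ℝ g (φ a) b = killingForm ℝ g a (φ b)
  rw [h2 i a ha, h2 j b hb, map_smul, map_smul, LinearMap.smul_apply, smul_eq_mul, smul_eq_mul]
  by_cases hij : i = j
  · rw [hij]
  · rw [killingForm_summand hij ha hb, mul_zero, mul_zero]

/-- The endomorphism `σ` of a naturally reductive metric `B(φ ·, ·)` is `r φ` for some `r`, so the
condition that it commutes with `ad (σ V - V)` is one on the eigenvalues of `φ`, for each triple of
summands on which the trilinear form `κ([V, W], U)` is not zero. -/
lemma exists_forall_linked {Q : LinearMap.BilinForm ℝ g} {y : Fin 6 → ℝ}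
    (hQ : D.IsDiagonalForm Q y) (hy : ∀ i, 0 < y i) {σ : g →ₗ[ℝ] g}
    (h₁ : ∀ V W Z : g, Q ⁅σ V - V, W⁆ Z + Q W ⁅σ V - V, Z⁆ = 0)
    (h₂ : ∀ U V W : g, Q ⁅U, σ V⁆ W + Q V ⁅U, σ W⁆ = 0) :
    ∃ r : ℝ, ∀ i j k, D.Linked i j k → r * y i = 1 ∨ y j = y k := by
  obtain ⟨φ, hφ, hφy, hφs⟩ := hQ.exists_endomorphism hre
  have hsurj : Function.Surjective φ := by
    rw [← LinearMap.range_eq_top, eq_top_iff, ← iSup_summand hre D]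
    refine iSup_le fun i a ha => ⟨(y i)⁻¹ • a, ?_⟩
    rw [map_smul, hφy i a ha, inv_smul_smul₀ (hy i).ne']
  have hbij : Function.Bijective φ := ⟨LinearMap.injective_iff_surjective.2 hsurj, hsurj⟩
  let e := LinearEquiv.ofBijective φ hbij
  have h3 : ∀ V W, ⁅σ V, φ W⁆ + ⁅σ W, φ V⁆ = 0 := by
    intro V W
    refine eq_of_forall_killingForm hre D fun _ U _ => ?_
    have h4 := h₂ U V W
    rw [hφ, hφ, hφs, killingForm_lie, killingForm_comm (φ V), killingForm_lie] at h4
    rw [killingForm_comm, map_add, map_zero, LinearMap.zero_apply]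
    linarith
  obtain ⟨r, hr⟩ := exists_eq_smul_of_lie_alternating D (τ := σ ∘ₗ e.symm.toLinearMap)
    fun V W => by
      have h4 := h3 (e.symm V) (e.symm W)
      have h5 : ∀ V, φ (e.symm V) = V := e.apply_symm_apply
      rw [h5, h5] at h4
      exact h4
  have hσ : ∀ V, σ V = r • φ V := fun V => by
    have h4 := hr (φ V)
    have h5 : e.symm (φ V) = V := e.symm_apply_apply V
    change σ (e.symm (φ V)) = _ at h4
    rwa [h5] at h4
  refine ⟨r, fun i j k hl => ?_⟩
  obtain ⟨V, hV, W, hW, U, hU, h⟩ := hl.exists_summand hre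
  have h4 := h₁ V W U
  have h5 : σ V - V = (r * y i - 1) • V := by
    rw [hσ, hφy i V hV, sub_smul, one_smul, smul_smul]
  have h6 : killingForm ℝ g W ⁅V, U⁆ = -killingForm ℝ g ⁅V, W⁆ U := by
    rw [← killingForm_lie, killingForm_lie_swap]
  rw [h5, smul_lie, smul_lie, map_smul, map_smul, LinearMap.smul_apply, hφ, hφ, hφs, hφy k U hU,
    hφy j W hW, map_smul, map_smul, LinearMap.smul_apply, h6, smul_eq_mul, smul_eq_mul,
    smul_eq_mul, smul_eq_mul] at h4
  have h7 : (r * y i - 1) * ((y j - y k) * killingForm ℝ g ⁅V, W⁆ U) = 0 := by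
    linear_combination h4
  rcases mul_eq_zero.1 h7 with h8 | h8
  · exact Or.inl (sub_eq_zero.1 h8)
  · exact Or.inr (sub_eq_zero.1 ((mul_eq_zero.1 h8).resolve_right h))

/-- Conversely, `σ = r φ` has the properties required in the construction of a naturally reductive
decomposition if the same condition holds for all triples of summands that are not excluded for
structural reasons. -/
lemma exists_endomorphism_of_unlinked {Q : LinearMap.BilinForm ℝ g} {y : Fin 6 → ℝ}
    (hQ : D.IsDiagonalForm Q y) {x : ℝ} (hx : x ≠ 0)
    (h : ∀ i j k, Unlinked (c ≠ TypeIIb3.E7_3) i j k ∨ y i = x ∨ y j = y k) :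
    ∃ σ : g →ₗ[ℝ] g, (∀ X Y, Q X Y = -x * killingForm ℝ g (σ X) Y) ∧
      (∀ X Y, killingForm ℝ g (σ X) Y = killingForm ℝ g X (σ Y)) ∧
      ∀ V W, σ ⁅σ V - V, W⁆ = ⁅σ V - V, σ W⁆ := by
  obtain ⟨φ, hφ, hφy, hφs⟩ := hQ.exists_endomorphism hre
  have hσ : ∀ X Y, killingForm ℝ g ((x⁻¹ • φ) X) Y = killingForm ℝ g X ((x⁻¹ • φ) Y) := by
    intro X Y
    rw [LinearMap.smul_apply, LinearMap.smul_apply, map_smul, map_smul, LinearMap.smul_apply, hφs]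
  refine ⟨x⁻¹ • φ, fun X Y => ?_, hσ, fun V W => ?_⟩
  · rw [hφ, LinearMap.smul_apply, map_smul, LinearMap.smul_apply, smul_eq_mul]
    field_simp
  · set σ := x⁻¹ • φ with hσdef
    have hσy : ∀ i, ∀ a ∈ D.summand i, σ a = (x⁻¹ * y i) • a := fun i a ha => by
      rw [hσdef, LinearMap.smul_apply, hφy i a ha, smul_smul]
    have hV : ∀ i, ∀ V ∈ D.summand i, ∀ W, σ ⁅σ V - V, W⁆ = ⁅σ V - V, σ W⁆ := by
      intro i V hV W
      suffices hh : σ ∘ₗ (ad ℝ g (σ V - V)) = (ad ℝ g (σ V - V)) ∘ₗ σ from LinearMap.congr_fun hh W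
      refine linearMap_ext_summand hre D fun j W hW => ?_
      change σ ⁅σ V - V, W⁆ = ⁅σ V - V, σ W⁆
      refine eq_of_forall_killingForm hre D fun k U hU => ?_
      have h5 : σ V - V = (x⁻¹ * y i - 1) • V := by rw [hσy i V hV, sub_smul, one_smul]
      rw [hσ, hσy k U hU, hσy j W hW, h5, smul_lie, lie_smul, smul_lie, map_smul, map_smul,
        map_smul, map_smul, LinearMap.smul_apply, LinearMap.smul_apply, LinearMap.smul_apply,
        smul_eq_mul, smul_eq_mul, smul_eq_mul]
      rcases h i j k with h6 | h6 | h6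
      · rw [h6.killingForm_lie hV hW hU]
        ring
      · rw [h6, inv_mul_cancel₀ hx]
        ring
      · rw [h6]
    suffices hh : σ ∘ₗ ad ℝ g W ∘ₗ (σ - LinearMap.id) = ad ℝ g (σ W) ∘ₗ (σ - LinearMap.id) by
      have h5 : σ ⁅W, σ V - V⁆ = ⁅σ W, σ V - V⁆ := LinearMap.congr_fun hh V
      rw [← lie_skew, map_neg, h5, lie_skew]
    refine linearMap_ext_summand hre D fun i V hV' => ?_
    change σ ⁅W, σ V - V⁆ = ⁅σ W, σ V - V⁆
    rw [← lie_skew, map_neg, hV i V hV' W, lie_skew]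

end Compact

end PaintedRootDatum

/-! ### Naturally reductive metrics -/

theorem proposition5p5
    -- a compact connected simple Lie group of type `II_b(3)`
    {n : ℕ} {G : Type*} [TopologicalSpace G] [T2Space G] [CompactSpace G] [ConnectedSpace G]
    [ChartedSpace (EuclideanSpace ℝ (Fin n)) G] [Group G] [LieGroup (𝓡 n) ∞ G]
    [LieAlgebra.IsSimple ℝ (GroupLieAlgebra (𝓡 n) G)]
    (c : TypeIIb3) (D : PaintedRootDatum c (GroupLieAlgebra (𝓡 n) G))
    -- the left-invariant metric `u₀ B|𝔨₀ + u₁ B|𝔨₁ + u₂ B|𝔨₂ + x₁ B|𝔭₁ + x₂ B|𝔭₂ + x₃ B|𝔭₃`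
    (u₀ u₁ u₂ x₁ x₂ x₃ : ℝ) (hu₀ : 0 < u₀) (hu₁ : 0 < u₁) (hu₂ : 0 < u₂)
    (hx₁ : 0 < x₁) (hx₂ : 0 < x₂) (hx₃ : 0 < x₃)
    (Q : LinearMap.BilinForm ℝ (GroupLieAlgebra (𝓡 n) G))
    (hQ : D.IsDiagonalForm Q ![u₀, u₁, u₂, x₁, x₂, x₃]) :
    (∃ L : Subgroup G, IsClosed (L : Set G) ∧ IsNaturallyReductive Q L) ↔
      (u₀ = u₂ ∧ u₂ = x₂ ∧ x₁ = x₃ ∧ (c = TypeIIb3.E7_3 → u₁ = x₂)) ∨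
      (u₀ = u₁ ∧ u₁ = x₃ ∧ x₁ = x₂) ∨
      (x₁ = x₂ ∧ x₂ = x₃) := by
  have hre : ∀ (X a b : GroupLieAlgebra (𝓡 n) G) (p q : ℝ), ⁅X, a⁆ = p • a - q • b →
      ⁅X, b⁆ = q • a + p • b → (a ≠ 0 ∨ b ≠ 0) → p = 0 :=
    fun X a b p q ha hb hab => re_eigenvalue_eq_zero ha hb hab
  constructor
  · rintro ⟨L, -, hL⟩
    obtain ⟨σ, h₁, h₂⟩ := hL.exists_endomorphism
    obtain ⟨r, hr⟩ := PaintedRootDatum.exists_forall_linked hre hQ (fun i => by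
      fin_cases i <;> assumption) h₁ h₂
    obtain ⟨l334, l044, l244, l144⟩ := PaintedRootDatum.linked_level_one_two D
    obtain ⟨l345, l055, l155⟩ := PaintedRootDatum.linked_level_two_three D
    -- the summand `𝔭ₘ` has index `m + 2`, and a linked triple stays linked when it is permuted
    by_cases h3 : r * x₁ = 1
    · by_cases h4 : r * x₂ = 1
      · have h12 : x₁ = x₂ := mul_left_cancel₀ (left_ne_zero_of_mul_eq_one h3) (h3.trans h4.symm)
        by_cases h5 : r * x₃ = 1
        · exact Or.inr (Or.inr ⟨h12, mul_left_cancel₀ (left_ne_zero_of_mul_eq_one h3)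
            (h4.trans h5.symm)⟩)
        · have e0 : u₀ = x₃ := (hr 5 0 5 l055.swap).resolve_left h5
          have e1 : u₁ = x₃ := (hr 5 1 5 l155.swap).resolve_left h5
          exact Or.inr (Or.inl ⟨e0.trans e1.symm, e1, h12⟩)
      · have e13 : x₁ = x₃ := (hr 4 3 5 l345.swap).resolve_left h4
        have e0 : u₀ = x₂ := (hr 4 0 4 l044.swap).resolve_left h4
        have e2 : u₂ = x₂ := (hr 4 2 4 l244.swap).resolve_left h4
        exact Or.inl ⟨e0.trans e2.symm, e2, e13, fun hc =>
          (hr 4 1 4 (l144 hc).swap).resolve_left h4⟩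
    · have e12 : x₁ = x₂ := (hr 3 3 4 l334).resolve_left h3
      have e23 : x₂ = x₃ := (hr 3 4 5 l345).resolve_left h3
      exact Or.inr (Or.inr ⟨e12, e23⟩)
  · intro h
    have key : ∀ i j k : Fin 6, PaintedRootDatum.Unlinked (c ≠ TypeIIb3.E7_3) i j k ∨
        (![u₀, u₁, u₂, x₁, x₂, x₃] : Fin 6 → ℝ) i = x₁ ∨
        (![u₀, u₁, u₂, x₁, x₂, x₃] : Fin 6 → ℝ) j = ![u₀, u₁, u₂, x₁, x₂, x₃] k := by
      -- the parameters `y` only matter through the classes `cl` of the summands on which they are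
      -- equal, class `1` being the one of `x₁`; this leaves a finite check on the triples
      have hcl : ∀ (cl : Fin 6 → Fin 4) (z : Fin 4 → ℝ) (P : Prop), (P → c ≠ TypeIIb3.E7_3) →
          (![u₀, u₁, u₂, x₁, x₂, x₃] : Fin 6 → ℝ) = z ∘ cl → z 1 = x₁ →
          (∀ i j k, PaintedRootDatum.Unlinked P i j k ∨ cl i = 1 ∨ cl j = cl k) →
          ∀ i j k : Fin 6, PaintedRootDatum.Unlinked (c ≠ TypeIIb3.E7_3) i j k ∨
            (![u₀, u₁, u₂, x₁, x₂, x₃] : Fin 6 → ℝ) i = x₁ ∨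
            (![u₀, u₁, u₂, x₁, x₂, x₃] : Fin 6 → ℝ) j = ![u₀, u₁, u₂, x₁, x₂, x₃] k := by
        intro cl z P hP hy hz hd i j k
        rw [hy]
        rcases hd i j k with h | h | h
        · exact Or.inl (h.mono hP)
        · exact Or.inr (Or.inl (by rw [Function.comp_apply, h, hz]))
        · exact Or.inr (Or.inr (by rw [Function.comp_apply, Function.comp_apply, h]))
      rcases h with ⟨rfl, rfl, rfl, h⟩ | ⟨rfl, rfl, rfl⟩ | ⟨rfl, rfl⟩
      · by_cases hc : c = TypeIIb3.E7_3
        · obtain rfl := h hc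
          refine hcl ![0, 0, 0, 1, 0, 1] ![u₁, x₁, 0, 0] False False.elim ?_ rfl (by decide)
          funext i
          fin_cases i <;> rfl
        · refine hcl ![0, 2, 0, 1, 0, 1] ![u₀, x₁, u₁, 0] True (fun _ => hc) ?_ rfl (by decide)
          funext i
          fin_cases i <;> rfl
      · refine hcl ![0, 0, 2, 1, 1, 0] ![u₀, x₁, u₂, 0] False False.elim ?_ rfl (by decide)
        funext i
        fin_cases i <;> rfl
      · refine hcl ![0, 2, 3, 1, 1, 1] ![u₀, x₁, u₁, u₂] False False.elim ?_ rfl (by decide)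
        funext i
        fin_cases i <;> rfl
    obtain ⟨σ, h₁, h₂, h₃⟩ := PaintedRootDatum.exists_endomorphism_of_unlinked hre hQ hx₁.ne' key
    exact exists_isNaturallyReductive σ _ h₁ h₂ h₃

end
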